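/- Let $\mathbf k$ be an algebraically closed field of characteristic $0$ and let $V=\bigoplus_{r\ge -m}V[r]$ be a vertex operator algebra over $\mathbf k$: a $\mathbb Z$-graded vector space whose weights are bounded below, with bilinear products $u_{(n)}v$ ($n\in\mathbb Z$), $V[r]_{(n)}V[s]\subset V[r+s-n-1]$, satisfying the Borcherds identities, a vacuum $\mathbf 1\in V[0]$ ($u_{(-1)}\mathbf 1=u$, $u_{(n)}\mathbf 1=0$ for $n\ge 0$), and a conformal vector $\omega\in V[2]$ with $\omega_{(n)}\omega=0$ for $n\ge4$ or $n=2$, $\omega_{(1)}\omega=2\omega$, $\omega_{(3)}\omega\in\mathbf k\mathbf 1$, $V[r]=\{v:\omega_{(1)}v=rv\}$ and $\omega_{(0)}u=u_{(-2)}\mathbf 1=:Du$. Write $\Delta(u)=r$ for $u\in V[r]$. *Degreewise topologies.* For a graded algebra $A=\bigoplus_d A(d)$ the standard degreewise topology on $A(d)$ is the linear topology defined by $I_n(A(d))=\sum_{j\le -n-1}A(d-j)A(j)$. The degreewise completion of a graded algebra with linear topologies $I_n(A(d))$ is $\hat A=\bigoplus_d\varprojlim_n A(d)/I_n(A(d))$.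 A homomorphism of degreewise topological Poisson algebras is a homomorphism of (unital associative) algebras and of Lie algebras which preserves the gradings and is continuous on each homogeneous subspace. *The current algebra and $\mathbf S$.* Let $\mathfrak g=V[t,t^{-1}]/\partial V[t,t^{-1}]$, $\partial(u\otimes t^n)=Du\otimes t^n+n\,u\otimes t^{n-1}$, be the current Lie algebra, with bracket $[u\otimes t^m,v\otimes t^n]=\sum_{i\ge0}\binom mi (u_{(i)}v)\otimes t^{m+n-i}$. Put $J_n(u)=u\otimes t^{n+\Delta(u)-1}$, of degree $-n$, and let $\mathcal U$ be the quotient of the universal enveloping algebra of $\mathfrak g$ by the two-sided ideal generated by $J_0(\mathbf 1)-1$, a graded algebra. Let $\hat{\mathcal U}$ be its degreewise completion for the standard degreewise topology, let $\hat{\mathfrak B}$ be the degreewise closure of the ideal of $\hat{\mathcal U}$ generated by the elements $$\sum_{i\ge0}\tbinom{k+\Delta(u)-1}{i}J_{k+m+n}(u_{(n+i)}v)-\sum_{i\ge0}(-1)^i\tbinom ni J_{k+n-i}(u)J_{m+i}(v)+(-1)^n\sum_{i\ge0}(-1)^i\tbinom ni J_{m+n-i}(v)J_{k+i}(u)$$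 for homogeneous $u,v\in V$ and $k,m,n\in\mathbb Z$, and let $U(V)=\hat{\mathcal U}/\hat{\mathfrak B}$ be the current algebra. Let $G_p\mathfrak g$ be the image of $\bigoplus_{r\le p}V[r]\otimes\mathbf k[t,t^{-1}]$, let $G_p\,\mathcal U$ be the sum of all $G_{p_1}\mathfrak g\cdots G_{p_l}\mathfrak g$ with $l\ge0$ and $p_1+\dots+p_l=p$, let $G_p\,\hat{\mathcal U}(d)$ be the closure of the image of $G_p\,\mathcal U\cap\mathcal U(d)$ in $\hat{\mathcal U}(d)$, and let $G_pU(V)(d)$ be the image of $G_p\,\hat{\mathcal U}(d)$ in $U(V)$. Then $\operatorname{gr}^GU(V)=\bigoplus_{d}\bigoplus_p G_pU(V)(d)/G_{p-1}U(V)(d)$ is a Poisson algebra, the bracket of the classes of $a\in G_pU(V)$ and $b\in G_qU(V)$ being the class of $ab-ba$ in $G_{p+q-1}/G_{p+q-2}$. It carries the degreewise topology induced from $\hat{\mathcal U}$, in which $I_n(\operatorname{gr}^G U(V)(d))$ is the direct sum over $p$ of the images of $G_p\,\hat{\mathcal U}(d)\cap I_n(\hat{\mathcal U}(d))$. Let $\mathbf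 S$ be its degreewise completion. *The Poisson current algebra.* Let $\mathfrak p=V/C_2(V)$, where $C_2(V)$ is the span of all $u_{(n)}v$ with $n\le-2$, be Zhu's Poisson algebra: it has product $u\cdot v=u_{(-1)}v$, bracket $\{u,v\}=u_{(0)}v$ and the grading induced by the weights. Let $\mathfrak q$ be the quotient of the loop Lie algebra $\mathfrak p[t,t^{-1}]$, with bracket $[x\otimes t^m,y\otimes t^n]=\{x,y\}\otimes t^{m+n}$, by the span of the elements $1\otimes t^n$, $n\ne-1$. Put $\tilde\Psi_n(x)=x\otimes t^{n+\Delta(x)-1}$, of degree $-n$. Let $\mathbb S$ be the quotient of the Poisson algebra $\operatorname{Sym}(\mathfrak q)$ by the ideal generated by $\tilde\Psi_0(1)-1$, let $\hat{\mathbb S}$ be its degreewise completion for the standard degreewise topology, and let $\hat{\mathbb D}$ be the degreewise closure of the ideal of $\hat{\mathbb S}$ generated by the elements $\tilde\Psi_m(xy)-\sum_{j\in\mathbb Z}\tilde\Psi_{m-j}(x)\tilde\Psi_j(y)$ for homogeneous $x,y\in\mathfrak p$ and $m\in\mathbb Z$; it is a Poisson ideal. The Poisson current algebra of $\mathfrak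 p$ is $\tilde{\mathcal S}(\mathfrak p)=\hat{\mathbb S}/\hat{\mathbb D}$, with the quotient degreewise topology. **Theorem.** There exists a surjective homomorphism $\tilde{\mathcal S}(V/C_2(V))\to\mathbf S$ of degreewise topological Poisson algebras. -/

import Mathlib

namespace CurrentAlg

/-! ### Brackets -/

/-- A Lie bracket on an associative algebra acting by derivations of the product.  A commutative
algebra with such a bracket is a Poisson algebra. -/
structure PoissonBracket (k A : Type*) [Field k] [Ring A] [Algebra k A] where
  br : A →ₗ[k] A →ₗ[k] A
  br_self : ∀ a, br a a = 0
  jacobi : ∀ a b c, br a (br b c) = br (br a b) c + br b (br a c)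
  leibniz : ∀ a b c, br a (b * c) = br a b * c + b * br a c

theorem bilin_mem_of_iSup {k M N P ι κ : Type*} [Field k] [AddCommGroup M] [Module k M]
    [AddCommGroup N] [Module k N] [AddCommGroup P] [Module k P] (F : ι → Submodule k M)
    (G : κ → Submodule k N) (B : M →ₗ[k] N →ₗ[k] P) (Q : Submodule k P)
    (h : ∀ i j, ∀ a ∈ F i, ∀ b ∈ G j, B a b ∈ Q) :
    ∀ a ∈ ⨆ i, F i, ∀ b ∈ ⨆ j, G j, B a b ∈ Q := by
  intro a ha b hb
  have h1 : ∀ i, ∀ a ∈ F i, B a b ∈ Q := by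
    intro i a ha
    have : (⨆ j, G j) ≤ Q.comap (B a) := iSup_le fun j b hb => h i j a ha b hb
    exact this hb
  have : (⨆ i, F i) ≤ Q.comap (B.flip b) := iSup_le fun i a ha => h1 i a ha
  exact this ha

namespace PoissonBracket

variable {k A : Type*} [Field k] [Ring A] [Algebra k A] (B : PoissonBracket k A)

theorem skew (a b : A) : B.br a b = - B.br b a := by
  have h := B.br_self (a + b)
  simp only [map_add, LinearMap.add_apply, B.br_self, zero_add, add_zero] at h
  exact eq_neg_of_add_eq_zero_right h

theorem leibniz' (a b c : A) : B.br (a * b) c = B.br a c * b + a * B.br b c := by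
  rw [B.skew, B.leibniz, B.skew c a, B.skew c b]; simp [add_comm]

theorem br_one (a : A) : B.br a 1 = 0 := by
  simpa using B.leibniz a 1 1

/-- The commutator bracket. -/
def commutator (k A : Type*) [Field k] [Ring A] [Algebra k A] : PoissonBracket k A where
  br := LinearMap.mul k A - (LinearMap.mul k A).flip
  br_self a := by simp
  jacobi a b c := by simp; noncomm_ring
  leibniz a b c := by simp; noncomm_ring

theorem commutator_apply (a b : A) : (commutator k A).br a b = a * b - b * a := by
  simp [commutator]

/-- The pointwise bracket on sequences. -/
def pi : PoissonBracket k (ℕ → A) where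
  br := LinearMap.mk₂ k (fun a b i => B.br (a i) (b i))
    (by intros; ext; simp) (by intros; ext; simp) (by intros; ext; simp) (by intros; ext; simp)
  br_self a := by ext i; simp [B.br_self]
  jacobi a b c := by ext i; exact B.jacobi _ _ _
  leibniz a b c := by ext i; exact B.leibniz _ _ _

/-- Restriction to a subalgebra closed under the bracket. -/
def restrict (S : Subalgebra k A) (h : ∀ a ∈ S, ∀ b ∈ S, B.br a b ∈ S) : PoissonBracket k S where
  br := LinearMap.mk₂ k (fun a b => ⟨B.br a b, h a a.2 b b.2⟩)
    (by intros; ext; simp) (by intros; ext; simp) (by intros; ext; simp) (by intros; ext; simp)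
  br_self a := by ext; exact B.br_self _
  jacobi a b c := by ext; exact B.jacobi _ _ _
  leibniz a b c := by ext; exact B.leibniz _ _ _

theorem quot_aux (I : Ideal A) (h : ∀ a, ∀ b ∈ I, B.br a b ∈ I) {a a' b b' : A}
    (ha : a - a' ∈ I) (hb : b - b' ∈ I) : B.br a b - B.br a' b' ∈ I := by
  have h1 : B.br a (b - b') ∈ I := h _ _ hb
  have h2 : B.br (a - a') b' ∈ I := by
    rw [B.skew]; exact I.neg_mem (h _ _ ha)
  have := I.add_mem h1 h2
  simpa [map_sub] using this

/-- The bracket on the quotient by an ideal stable under the bracket. -/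
def quot (I : Ideal A) [I.IsTwoSided] (h : ∀ a, ∀ b ∈ I, B.br a b ∈ I) :
    PoissonBracket k (A ⧸ I) where
  br := LinearMap.mk₂ k
    (fun x y => Quotient.liftOn₂' x y (fun a b => Ideal.Quotient.mk I (B.br a b)) (by
      intro a b a' b' ha hb
      exact (Ideal.Quotient.eq).2 (B.quot_aux I h ((Submodule.quotientRel_def I).1 ha)
        ((Submodule.quotientRel_def I).1 hb))))
    (by
      rintro ⟨a⟩ ⟨b⟩ ⟨c⟩
      change Ideal.Quotient.mk I (B.br (a + b) c) = Ideal.Quotient.mk I (B.br a c) +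
        Ideal.Quotient.mk I (B.br b c)
      simp)
    (by
      rintro r ⟨a⟩ ⟨b⟩
      change Ideal.Quotient.mkₐ k I (B.br (r • a) b) = r • Ideal.Quotient.mkₐ k I (B.br a b)
      simp only [map_smul, LinearMap.smul_apply])
    (by
      rintro ⟨a⟩ ⟨b⟩ ⟨c⟩
      change Ideal.Quotient.mk I (B.br a (b + c)) = Ideal.Quotient.mk I (B.br a b) +
        Ideal.Quotient.mk I (B.br a c)
      simp)
    (by
      rintro r ⟨a⟩ ⟨b⟩
      change Ideal.Quotient.mkₐ k I (B.br a (r • b)) = r • Ideal.Quotient.mkₐ k I (B.br a b)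
      simp only [map_smul])
  br_self := by
    rintro ⟨a⟩
    change Ideal.Quotient.mk I (B.br a a) = 0
    rw [B.br_self, map_zero]
  jacobi := by
    rintro ⟨a⟩ ⟨b⟩ ⟨c⟩
    exact congrArg (Ideal.Quotient.mk I) (B.jacobi a b c)
  leibniz := by
    rintro ⟨a⟩ ⟨b⟩ ⟨c⟩
    exact congrArg (Ideal.Quotient.mk I) (B.leibniz a b c)

theorem quot_br_mk (I : Ideal A) [I.IsTwoSided] (h : ∀ a, ∀ b ∈ I, B.br a b ∈ I) (a b : A) :
    (B.quot I h).br (Ideal.Quotient.mk I a) (Ideal.Quotient.mk I b) =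
      Ideal.Quotient.mk I (B.br a b) := rfl

end PoissonBracket

/-! ### Subspaces of subquotients -/

section imageSub

variable {k A : Type*} [Field k] [Ring A] [Algebra k A] (S : Subalgebra k A) (I : Ideal S)
  [I.IsTwoSided]

/-- The image of `M ∩ S` in `S / I`, for `S ⊆ A` a subalgebra and `I` an ideal of `S`. -/
def imageSub (M : Submodule k A) : Submodule k (S ⧸ I) :=
  (M.comap S.val.toLinearMap).map (Ideal.Quotient.mkₐ k I).toLinearMap

theorem imageSub_mono {M M' : Submodule k A} (h : M ≤ M') : imageSub S I M ≤ imageSub S I M' :=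
  Submodule.map_mono (Submodule.comap_mono h)

theorem mul_mem_imageSub {M M' M'' : Submodule k A} (h : ∀ a ∈ M, ∀ b ∈ M', a * b ∈ M'')
    {x y : S ⧸ I} (hx : x ∈ imageSub S I M) (hy : y ∈ imageSub S I M') :
    x * y ∈ imageSub S I M'' := by
  obtain ⟨a, ha, rfl⟩ := hx
  obtain ⟨b, hb, rfl⟩ := hy
  exact ⟨a * b, h _ ha _ hb, rfl⟩

theorem br_mem_imageSub (B : PoissonBracket k A) (hS : ∀ a ∈ S, ∀ b ∈ S, B.br a b ∈ S)
    (hI : ∀ a, ∀ b ∈ I, (B.restrict S hS).br a b ∈ I) {M M' M'' : Submodule k A}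
    (h : ∀ a ∈ M, ∀ b ∈ M', B.br a b ∈ M'') {x y : S ⧸ I} (hx : x ∈ imageSub S I M)
    (hy : y ∈ imageSub S I M') :
    ((B.restrict S hS).quot I hI).br x y ∈ imageSub S I M'' := by
  obtain ⟨a, ha, rfl⟩ := hx
  obtain ⟨b, hb, rfl⟩ := hy
  exact ⟨(B.restrict S hS).br a b, h _ ha _ hb, rfl⟩

theorem iSup_imageSub (M : ℤ → Submodule k A) (h : ∀ a, a ∈ S ↔ a ∈ ⨆ d, M d) :
    ⨆ d, imageSub S I (M d) = ⊤ := by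
  rw [eq_top_iff]
  rintro x -
  obtain ⟨⟨a, ha⟩, rfl⟩ := Ideal.Quotient.mk_surjective x
  have h1 : ∀ b ∈ ⨆ d, M d, ∀ hb : b ∈ S,
      Ideal.Quotient.mk I ⟨b, hb⟩ ∈ ⨆ d, imageSub S I (M d) := by
    intro b hb
    induction hb using Submodule.iSup_induction' with
    | mem d b hb => exact fun h => le_iSup (fun d => imageSub S I (M d)) d ⟨⟨b, h⟩, hb, rfl⟩
    | zero => exact fun h => zero_mem _
    | add x y hx hy ihx ihy =>
      intro _
      exact add_mem (ihx ((h x).2 hx)) (ihy ((h y).2 hy))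
  exact h1 a ((h a).1 ha) ha

end imageSub

/-! ### Algebras generated by graded spaces -/

section wordSpan

variable {k A L : Type*} [Field k] [Ring A] [Algebra k A] [AddCommGroup L] [Module k L]

/-- The span of the products `j x₁ ⋯ j xₗ` with `xᵢ ∈ F pᵢ` and `p₁ + ⋯ + pₗ = p`, `l ≥ 0`. -/
def wordSpan (F : ℤ → Submodule k L) (j : L →ₗ[k] A) (p : ℤ) : Submodule k A :=
  Submodule.span k {a | ∃ l : List (ℤ × L), (∀ y ∈ l, y.2 ∈ F y.1) ∧ (l.map Prod.fst).sum = p ∧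
    a = (l.map fun y => j y.2).prod}

variable (F : ℤ → Submodule k L) (j : L →ₗ[k] A)

theorem one_mem_wordSpan : (1 : A) ∈ wordSpan F j 0 :=
  Submodule.subset_span ⟨[], by simp, by simp, by simp⟩

theorem mem_wordSpan {p : ℤ} {x : L} (hx : x ∈ F p) : j x ∈ wordSpan F j p :=
  Submodule.subset_span ⟨[(p, x)], by simpa using hx, by simp, by simp⟩

theorem mul_mem_wordSpan {p q : ℤ} {a b : A} (ha : a ∈ wordSpan F j p)
    (hb : b ∈ wordSpan F j q) : a * b ∈ wordSpan F j (p + q) := by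
  have : wordSpan F j p * wordSpan F j q ≤ wordSpan F j (p + q) := by
    unfold wordSpan
    rw [Submodule.span_mul_span]
    refine Submodule.span_le.2 ?_
    rintro _ ⟨a, ⟨l, h1, h2, rfl⟩, b, ⟨l', h1', h2', rfl⟩, rfl⟩
    refine Submodule.subset_span ⟨l ++ l', ?_, by simp [h2, h2'], by simp⟩
    intro y hy
    rcases List.mem_append.1 hy with h | h
    exacts [h1 y h, h1' y h]
  exact this (Submodule.mul_mem_mul ha hb)

theorem iSup_wordSpan (hF : ⨆ p, F p = ⊤) (hj : Algebra.adjoin k (Set.range j) = ⊤) :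
    ⨆ p, wordSpan F j p = ⊤ := by
  let S : Subalgebra k A := Submodule.toSubalgebra (⨆ p, wordSpan F j p)
    (le_iSup (wordSpan F j) 0 (one_mem_wordSpan F j))
    (fun a b ha hb => bilin_mem_of_iSup _ _ (LinearMap.mul k A) _ (fun p q a ha b hb =>
      le_iSup (wordSpan F j) (p + q) (mul_mem_wordSpan F j ha hb)) a ha b hb)
  have hS : S = ⊤ := by
    rw [eq_top_iff, ← hj, Algebra.adjoin_le_iff]
    rintro _ ⟨x, rfl⟩
    have hx : x ∈ ⨆ p, F p := hF ▸ Submodule.mem_top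
    have : (⨆ p, F p) ≤ (⨆ p, wordSpan F j p).comap j :=
      iSup_le fun p x hx => le_iSup (wordSpan F j) p (mem_wordSpan F j hx)
    exact this hx
  rw [eq_top_iff]
  intro x _
  have hx : x ∈ S := hS ▸ Algebra.mem_top
  exact hx

/-- If the generators satisfy `{F p, F q} ⊆ F (p + q + c)`, so do the spans of products. -/
theorem bracket_mem_wordSpan (B : PoissonBracket k A) (c : ℤ)
    (h : ∀ p q, ∀ x ∈ F p, ∀ y ∈ F q, B.br (j x) (j y) ∈ wordSpan F j (p + q + c))
    {p q : ℤ} {a b : A} (ha : a ∈ wordSpan F j p) (hb : b ∈ wordSpan F j q) :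
    B.br a b ∈ wordSpan F j (p + q + c) := by
  have h1 : ∀ (l : List (ℤ × L)), (∀ y ∈ l, y.2 ∈ F y.1) → ∀ p, ∀ x ∈ F p,
      B.br (j x) (l.map fun y => j y.2).prod ∈ wordSpan F j (p + (l.map Prod.fst).sum + c) := by
    intro l
    induction l with
    | nil => intro _ p x hx; simp [B.br_one]
    | cons y l ih =>
      intro hl p x hx
      have hl' : ∀ y ∈ l, y.2 ∈ F y.1 := fun z hz => hl z (List.mem_cons_of_mem _ hz)
      have hy : y.2 ∈ F y.1 := hl y List.mem_cons_self
      have hw : (l.map fun y => j y.2).prod ∈ wordSpan F j (l.map Prod.fst).sum :=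
        Submodule.subset_span ⟨l, hl', rfl, rfl⟩
      simp only [List.map_cons, List.prod_cons, List.sum_cons, B.leibniz]
      refine Submodule.add_mem _ ?_ ?_
      · have := mul_mem_wordSpan F j (h p y.1 x hx y.2 hy) hw
        convert this using 2; ring
      · have := mul_mem_wordSpan F j (mem_wordSpan F j hy) (ih hl' p x hx)
        convert this using 2; ring
  have h2 : ∀ (l' : List (ℤ × L)), (∀ y ∈ l', y.2 ∈ F y.1) →
      ∀ (l : List (ℤ × L)), (∀ y ∈ l, y.2 ∈ F y.1) →
      B.br (l.map fun y => j y.2).prod (l'.map fun y => j y.2).prod ∈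
        wordSpan F j ((l.map Prod.fst).sum + (l'.map Prod.fst).sum + c) := by
    intro l' hl' l
    induction l with
    | nil => intro _; rw [B.skew]; simp [B.br_one]
    | cons y l ih =>
      intro hl
      have hl'' : ∀ y ∈ l, y.2 ∈ F y.1 := fun z hz => hl z (List.mem_cons_of_mem _ hz)
      have hy : y.2 ∈ F y.1 := hl y List.mem_cons_self
      have hw : (l.map fun y => j y.2).prod ∈ wordSpan F j (l.map Prod.fst).sum :=
        Submodule.subset_span ⟨l, hl'', rfl, rfl⟩
      simp only [List.map_cons, List.prod_cons, List.sum_cons, B.leibniz']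
      refine Submodule.add_mem _ ?_ ?_
      · have := mul_mem_wordSpan F j (h1 l' hl' y.1 y.2 hy) hw
        convert this using 2; ring
      · have := mul_mem_wordSpan F j (mem_wordSpan F j hy) (ih hl'')
        convert this using 2; ring
  have h3 : wordSpan F j p ≤ (wordSpan F j (p + q + c)).comap (B.br.flip b) := by
    refine Submodule.span_le.2 ?_
    rintro _ ⟨l, hl, hp, rfl⟩
    have h4 : wordSpan F j q ≤
        (wordSpan F j (p + q + c)).comap (B.br (l.map fun y => j y.2).prod) := by
      refine Submodule.span_le.2 ?_
      rintro _ ⟨l', hl', hq, rfl⟩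
      subst hp; subst hq
      exact h2 l' hl' l hl
    exact h4 hb
  exact h3 ha

end wordSpan

/-! ### Degreewise topologies and degreewise completion -/

/-- A graded algebra `A = ∑ A(d)` with a linear topology on each `A(d)`, defined by a decreasing
sequence `I₀(A(d)), I₁(A(d)), …` of subspaces such that
`A(d) · Iₙ(A(e)) ⊆ Iₙ(A(d+e))` and `Iₘ(A(d)) · A(e) ⊆ Iₙ(A(d+e))` for `m ≥ n + e`;
in particular the products `A(d) × A(e) → A(d+e)` are continuous. -/
structure DegreewiseTop (k A : Type*) [Field k] [Ring A] [Algebra k A] where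
  deg : ℤ → Submodule k A
  nhd : ℤ → ℕ → Submodule k A
  iSup_deg : ⨆ d, deg d = ⊤
  one_mem : (1 : A) ∈ deg 0
  mul_mem : ∀ {d e : ℤ} {a b : A}, a ∈ deg d → b ∈ deg e → a * b ∈ deg (d + e)
  nhd_le : ∀ d n, nhd d n ≤ deg d
  nhd_anti : ∀ d, Antitone (nhd d)
  mul_nhd : ∀ {d e : ℤ} {n : ℕ} {a b : A}, a ∈ deg d → b ∈ nhd e n → a * b ∈ nhd (d + e) n
  nhd_mul : ∀ {d e : ℤ} {m n : ℕ} {a b : A}, (n : ℤ) + e ≤ m → a ∈ nhd d m → b ∈ deg e →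
    a * b ∈ nhd (d + e) n

namespace DegreewiseTop

variable {k A : Type*} [Field k] [Ring A] [Algebra k A]

/-- The standard degreewise topology of a graded algebra:
`Iₙ(A(d)) = ∑_{j ≤ -n-1} A(d-j) · A(j)`. -/
def standard (deg : ℤ → Submodule k A) (iSup_deg : ⨆ d, deg d = ⊤) (one_mem : (1 : A) ∈ deg 0)
    (mul_mem : ∀ {d e : ℤ} {a b : A}, a ∈ deg d → b ∈ deg e → a * b ∈ deg (d + e)) :
    DegreewiseTop k A where
  deg := deg
  nhd d n := ⨆ (j : ℤ) (_ : j ≤ -(n : ℤ) - 1), deg (d - j) * deg j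
  iSup_deg := iSup_deg
  one_mem := one_mem
  mul_mem := mul_mem
  nhd_le d n := iSup₂_le fun j _ => Submodule.mul_le.2 fun a ha b hb => by
    have := mul_mem ha hb
    rwa [sub_add_cancel] at this
  nhd_anti d m n h := iSup₂_le fun j hj =>
    le_iSup₂_of_le (f := fun (j : ℤ) (_ : j ≤ -(m : ℤ) - 1) => deg (d - j) * deg j) j
      (by omega) le_rfl
  mul_nhd {d e n a b} ha hb := by
    have : (⨆ (j : ℤ) (_ : j ≤ -(n : ℤ) - 1), deg (e - j) * deg j) ≤
        (⨆ (j : ℤ) (_ : j ≤ -(n : ℤ) - 1), deg (d + e - j) * deg j).comap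
          (LinearMap.mulLeft k a) := by
      refine iSup₂_le fun j hj => Submodule.mul_le.2 fun x hx y hy => ?_
      have h1 : a * x ∈ deg (d + e - j) := by
        have := mul_mem ha hx
        rwa [← add_sub_assoc] at this
      have h2 := Submodule.mul_mem_mul h1 hy
      simp only [Submodule.mem_comap, LinearMap.mulLeft_apply, ← mul_assoc]
      exact (le_iSup₂_of_le (f := fun (j : ℤ) (_ : j ≤ -(n : ℤ) - 1) =>
        deg (d + e - j) * deg j) j hj le_rfl) h2
    exact this hb
  nhd_mul {d e m n a b} hmn ha hb := by
    have : (⨆ (j : ℤ) (_ : j ≤ -(m : ℤ) - 1), deg (d - j) * deg j) ≤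
        (⨆ (j : ℤ) (_ : j ≤ -(n : ℤ) - 1), deg (d + e - j) * deg j).comap
          (LinearMap.mulRight k b) := by
      refine iSup₂_le fun j hj => Submodule.mul_le.2 fun x hx y hy => ?_
      have h1 : x ∈ deg (d + e - (j + e)) := by
        rwa [show d + e - (j + e) = d - j by ring]
      have h2 := Submodule.mul_mem_mul h1 (mul_mem hy hb)
      simp only [Submodule.mem_comap, LinearMap.mulRight_apply, mul_assoc]
      exact (le_iSup₂_of_le (f := fun (j : ℤ) (_ : j ≤ -(n : ℤ) - 1) =>
        deg (d + e - j) * deg j) (j + e) (by omega) le_rfl) h2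
    exact this ha

variable (T : DegreewiseTop k A)

/-- Cauchy sequences in `A(d)`. -/
def cauchySeq (d : ℤ) : Submodule k (ℕ → A) where
  carrier := {a | (∀ i, a i ∈ T.deg d) ∧
    ∀ n, ∃ M, ∀ i, M ≤ i → ∀ j, M ≤ j → a i - a j ∈ T.nhd d n}
  add_mem' := by
    rintro a b ⟨ha, ha'⟩ ⟨hb, hb'⟩
    refine ⟨fun i => add_mem (ha i) (hb i), fun n => ?_⟩
    obtain ⟨M, hM⟩ := ha' n
    obtain ⟨N, hN⟩ := hb' n
    refine ⟨max M N, fun i hi j hj => ?_⟩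
    have := add_mem (hM i (by omega) j (by omega)) (hN i (by omega) j (by omega))
    simpa [add_sub_add_comm] using this
  zero_mem' := ⟨fun i => zero_mem _, fun n => ⟨0, by simp⟩⟩
  smul_mem' := by
    rintro r a ⟨ha, ha'⟩
    refine ⟨fun i => Submodule.smul_mem _ _ (ha i), fun n => ?_⟩
    obtain ⟨M, hM⟩ := ha' n
    refine ⟨M, fun i hi j hj => ?_⟩
    simpa [smul_sub] using Submodule.smul_mem _ r (hM i hi j hj)

/-- Cauchy sequences in `A(d)` that are eventually in `Iₙ(A(d))`. -/
def eventuallySeq (d : ℤ) (n : ℕ) : Submodule k (ℕ → A) where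
  carrier := {a | a ∈ T.cauchySeq d ∧ ∃ M, ∀ i, M ≤ i → a i ∈ T.nhd d n}
  add_mem' := by
    rintro a b ⟨ha, M, hM⟩ ⟨hb, N, hN⟩
    exact ⟨add_mem ha hb, max M N, fun i hi => add_mem (hM i (by omega)) (hN i (by omega))⟩
  zero_mem' := ⟨zero_mem _, 0, fun i _ => zero_mem _⟩
  smul_mem' := by
    rintro r a ⟨ha, M, hM⟩
    exact ⟨Submodule.smul_mem _ _ ha, M, fun i hi => Submodule.smul_mem _ _ (hM i hi)⟩

/-- Sequences in `A(d)` converging to zero. -/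
def nullSeq (d : ℤ) : Submodule k (ℕ → A) := ⨅ n, T.eventuallySeq d n

theorem mul_mem_cauchySeq {d e : ℤ} {a b : ℕ → A} (ha : a ∈ T.cauchySeq d)
    (hb : b ∈ T.cauchySeq e) : a * b ∈ T.cauchySeq (d + e) := by
  refine ⟨fun i => T.mul_mem (ha.1 i) (hb.1 i), fun n => ?_⟩
  obtain ⟨M, hM⟩ := ha.2 (n + e).toNat
  obtain ⟨N, hN⟩ := hb.2 n
  refine ⟨max M N, fun i hi j hj => ?_⟩
  have h1 := T.mul_nhd (ha.1 i) (hN i (by omega) j (by omega))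
  have h2 := T.nhd_mul (n := n) (by omega) (hM i (by omega) j (by omega)) (hb.1 j)
  have := add_mem h1 h2
  simpa [mul_sub, sub_mul] using this

theorem mul_mem_eventuallySeq {d e : ℤ} {n : ℕ} {a b : ℕ → A} (ha : a ∈ T.cauchySeq d)
    (hb : b ∈ T.eventuallySeq e n) : a * b ∈ T.eventuallySeq (d + e) n := by
  obtain ⟨hb, M, hM⟩ := hb
  exact ⟨T.mul_mem_cauchySeq ha hb, M, fun i hi => T.mul_nhd (ha.1 i) (hM i hi)⟩

theorem eventuallySeq_mul_mem {d e : ℤ} {m n : ℕ} {a b : ℕ → A} (h : (n : ℤ) + e ≤ m)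
    (ha : a ∈ T.eventuallySeq d m) (hb : b ∈ T.cauchySeq e) :
    a * b ∈ T.eventuallySeq (d + e) n := by
  obtain ⟨ha, M, hM⟩ := ha
  exact ⟨T.mul_mem_cauchySeq ha hb, M, fun i hi => T.nhd_mul h (hM i hi) (hb.1 i)⟩

theorem mul_mem_nullSeq {d e : ℤ} {a b : ℕ → A} (ha : a ∈ T.cauchySeq d)
    (hb : b ∈ T.nullSeq e) : a * b ∈ T.nullSeq (d + e) := by
  simp only [nullSeq, Submodule.mem_iInf] at hb ⊢
  exact fun n => T.mul_mem_eventuallySeq ha (hb n)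

theorem nullSeq_mul_mem {d e : ℤ} {a b : ℕ → A} (ha : a ∈ T.nullSeq d)
    (hb : b ∈ T.cauchySeq e) : a * b ∈ T.nullSeq (d + e) := by
  simp only [nullSeq, Submodule.mem_iInf] at ha ⊢
  exact fun n => T.eventuallySeq_mul_mem (m := (n + e).toNat) (by omega) (ha _) hb

theorem const_mem_cauchySeq {d : ℤ} {a : A} (ha : a ∈ T.deg d) :
    (fun _ => a) ∈ T.cauchySeq d :=
  ⟨fun _ => ha, fun n => ⟨0, fun i _ j _ => by simp⟩⟩

/-- Finite sums of Cauchy sequences in the homogeneous subspaces. -/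
def cauchySubalg : Subalgebra k (ℕ → A) :=
  Submodule.toSubalgebra (⨆ d, T.cauchySeq d)
    (le_iSup T.cauchySeq 0 (T.const_mem_cauchySeq T.one_mem))
    (fun a b ha hb => bilin_mem_of_iSup _ _ (LinearMap.mul k (ℕ → A)) _
      (fun d e _ ha _ hb => le_iSup T.cauchySeq (d + e) (T.mul_mem_cauchySeq ha hb)) a ha b hb)

theorem mem_cauchySubalg {a : ℕ → A} : a ∈ T.cauchySubalg ↔ a ∈ ⨆ d, T.cauchySeq d :=
  Iff.rfl

theorem mem_cauchySubalg_of_mem {d : ℤ} {a : ℕ → A} (ha : a ∈ T.cauchySeq d) :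
    a ∈ T.cauchySubalg := T.mem_cauchySubalg.2 (le_iSup T.cauchySeq d ha)

/-- The ideal of finite sums of null sequences in the homogeneous subspaces. -/
def nullIdeal : Ideal T.cauchySubalg where
  carrier := {a | (a : ℕ → A) ∈ ⨆ d, T.nullSeq d}
  add_mem' ha hb := Submodule.add_mem (⨆ d, T.nullSeq d) ha hb
  zero_mem' := zero_mem (⨆ d, T.nullSeq d)
  smul_mem' c x hx := bilin_mem_of_iSup _ _ (LinearMap.mul k (ℕ → A)) _
      (fun d e _ ha _ hb => le_iSup T.nullSeq (d + e) (T.mul_mem_nullSeq ha hb)) c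
      (T.mem_cauchySubalg.1 c.2) x hx

instance : T.nullIdeal.IsTwoSided where
  mul_mem_of_left {a} b ha := bilin_mem_of_iSup T.nullSeq T.cauchySeq
      (LinearMap.mul k (ℕ → A)) (⨆ d, T.nullSeq d)
      (fun d e _ ha _ hb => le_iSup T.nullSeq (d + e) (T.nullSeq_mul_mem ha hb)) a.1
      (show (a : ℕ → A) ∈ ⨆ d, T.nullSeq d from ha) b.1
      (T.mem_cauchySubalg.1 b.2)

/-- The degreewise completion `⨁ Â(d)`, where `Â(d)` is the completion of `A(d)`, realised as
Cauchy sequences modulo null sequences. -/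
abbrev Completion := T.cauchySubalg ⧸ T.nullIdeal

/-- The class of a sequence of homogeneous elements. -/
def limit {d : ℤ} (a : ℕ → A) (ha : a ∈ T.cauchySeq d) : T.Completion :=
  Ideal.Quotient.mk T.nullIdeal ⟨a, T.mem_cauchySubalg_of_mem ha⟩

theorem const_mem_cauchySubalg (a : A) : Pi.constAlgHom k ℕ A a ∈ T.cauchySubalg := by
  have ha : a ∈ ⨆ d, T.deg d := T.iSup_deg ▸ Submodule.mem_top
  have : (⨆ d, T.deg d) ≤
      (Subalgebra.toSubmodule T.cauchySubalg).comap (Pi.constAlgHom k ℕ A).toLinearMap :=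
    iSup_le fun d a ha => T.mem_cauchySubalg_of_mem (T.const_mem_cauchySeq ha)
  exact this ha

/-- The canonical map `A → Â`. -/
def of : A →ₐ[k] T.Completion :=
  (Ideal.Quotient.mkₐ k T.nullIdeal).comp
    ((Pi.constAlgHom k ℕ A).codRestrict T.cauchySubalg T.const_mem_cauchySubalg)

/-- The image in the completion of a space of sequences. -/
abbrev image (S : Submodule k (ℕ → A)) : Submodule k T.Completion :=
  imageSub T.cauchySubalg T.nullIdeal S

/-- The degreewise completion as a graded algebra with degreewise topology: `Iₙ(Â(d))` is the
kernel of `Â(d) → A(d) / Iₙ(A(d))`. -/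
def completion : DegreewiseTop k T.Completion where
  deg d := T.image (T.cauchySeq d)
  nhd d n := T.image (T.eventuallySeq d n)
  iSup_deg := iSup_imageSub _ _ _ fun _ => T.mem_cauchySubalg
  one_mem := ⟨1, T.const_mem_cauchySeq T.one_mem, rfl⟩
  mul_mem := mul_mem_imageSub _ _ fun _ ha _ hb => T.mul_mem_cauchySeq ha hb
  nhd_le _ _ := imageSub_mono _ _ fun _ h => h.1
  nhd_anti d _ _ h := imageSub_mono _ _ fun _ ha =>
    ⟨ha.1, ha.2.imp fun _ hM i hi => T.nhd_anti d h (hM i hi)⟩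
  mul_nhd := mul_mem_imageSub _ _ fun _ ha _ hb => T.mul_mem_eventuallySeq ha hb
  nhd_mul h := mul_mem_imageSub _ _ fun _ ha _ hb => T.eventuallySeq_mul_mem h ha hb

theorem of_mem {d : ℤ} {a : A} (ha : a ∈ T.deg d) : T.of a ∈ T.completion.deg d :=
  ⟨⟨fun _ => a, T.const_mem_cauchySubalg a⟩, T.const_mem_cauchySeq ha, rfl⟩

theorem limit_mem {d : ℤ} {a : ℕ → A} (ha : a ∈ T.cauchySeq d) :
    T.limit a ha ∈ T.completion.deg d := ⟨⟨a, T.mem_cauchySubalg_of_mem ha⟩, ha, rfl⟩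

/-- Every element of `Â(d)` is approximated by elements of `A(d)`. -/
theorem exists_sub_of_mem {d : ℤ} {x : T.Completion} (hx : x ∈ T.completion.deg d) (n : ℕ) :
    ∃ a ∈ T.deg d, x - T.of a ∈ T.completion.nhd d n := by
  obtain ⟨⟨a, ha'⟩, ha, rfl⟩ := hx
  obtain ⟨M, hM⟩ := ha.2 n
  refine ⟨a M, ha.1 M, ⟨⟨a, ha'⟩ - ⟨fun _ => a M, T.const_mem_cauchySubalg _⟩, ?_, rfl⟩⟩
  exact ⟨sub_mem ha (T.const_mem_cauchySeq (ha.1 M)), M, fun i hi => hM i hi M le_rfl⟩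

/-! ### Degreewise closures and quotients -/

/-- The component of degree `d` of the two-sided ideal generated by the elements of `S j ⊆ A(j)`,
`j ∈ ℤ`. -/
def genIdeal (S : ℤ → Set A) (d : ℤ) : Submodule k A :=
  Submodule.span k {x | ∃ i j l : ℤ, i + j + l = d ∧ ∃ a ∈ T.deg i, ∃ s ∈ S j, ∃ b ∈ T.deg l,
    x = a * s * b}

/-- The closure in `A(d)` of a subspace. -/
def closure (J : Submodule k A) (d : ℤ) : Submodule k A where
  carrier := {x | x ∈ T.deg d ∧ ∀ n, ∃ y ∈ J, x - y ∈ T.nhd d n}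
  add_mem' := by
    rintro a b ⟨ha, ha'⟩ ⟨hb, hb'⟩
    refine ⟨add_mem ha hb, fun n => ?_⟩
    obtain ⟨y, hy, h⟩ := ha' n
    obtain ⟨z, hz, h'⟩ := hb' n
    exact ⟨y + z, add_mem hy hz, by simpa [add_sub_add_comm] using add_mem h h'⟩
  zero_mem' := ⟨zero_mem _, fun n => ⟨0, zero_mem _, by simp⟩⟩
  smul_mem' := by
    rintro r a ⟨ha, ha'⟩
    refine ⟨Submodule.smul_mem _ _ ha, fun n => ?_⟩
    obtain ⟨y, hy, h⟩ := ha' n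
    exact ⟨r • y, Submodule.smul_mem _ _ hy, by
      simpa [smul_sub] using Submodule.smul_mem _ r h⟩

theorem mul_mem_genIdeal (S : ℤ → Set A) {e d : ℤ} {a x : A} (ha : a ∈ T.deg e)
    (hx : x ∈ T.genIdeal S d) : a * x ∈ T.genIdeal S (e + d) := by
  have : T.genIdeal S d ≤ (T.genIdeal S (e + d)).comap (LinearMap.mulLeft k a) := by
    refine Submodule.span_le.2 ?_
    rintro _ ⟨i, j, l, rfl, b, hb, s, hs, c, hc, rfl⟩
    exact Submodule.subset_span ⟨e + i, j, l, by ring, a * b, T.mul_mem ha hb, s, hs, c, hc,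
      by simp [mul_assoc]⟩
  exact this hx

theorem genIdeal_mul_mem (S : ℤ → Set A) {e d : ℤ} {a x : A} (ha : a ∈ T.deg e)
    (hx : x ∈ T.genIdeal S d) : x * a ∈ T.genIdeal S (d + e) := by
  have : T.genIdeal S d ≤ (T.genIdeal S (d + e)).comap (LinearMap.mulRight k a) := by
    refine Submodule.span_le.2 ?_
    rintro _ ⟨i, j, l, rfl, b, hb, s, hs, c, hc, rfl⟩
    exact Submodule.subset_span ⟨i, j, l + e, by ring, b, hb, s, hs, c * a, T.mul_mem hc ha,
      by simp [mul_assoc]⟩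
  exact this hx

theorem mem_genIdeal (S : ℤ → Set A) {d : ℤ} {s : A} (hs : s ∈ S d) : s ∈ T.genIdeal S d :=
  Submodule.subset_span ⟨0, d, 0, by ring, 1, T.one_mem, s, hs, 1, T.one_mem, by simp⟩

/-- The degreewise closure of the two-sided ideal generated by the homogeneous elements `S`. -/
def closedIdeal (S : ℤ → Set A) : Ideal A where
  carrier := {x | x ∈ ⨆ d, T.closure (T.genIdeal S d) d}
  add_mem' ha hb := Submodule.add_mem (⨆ d, T.closure (T.genIdeal S d) d) ha hb
  zero_mem' := zero_mem (⨆ d, T.closure (T.genIdeal S d) d)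
  smul_mem' c x hx := bilin_mem_of_iSup T.deg (fun d => T.closure (T.genIdeal S d) d)
    (LinearMap.mul k A) (⨆ d, T.closure (T.genIdeal S d) d)
    (fun e d a ha b hb => le_iSup (fun d => T.closure (T.genIdeal S d) d) (e + d)
      ⟨T.mul_mem ha hb.1, fun n => by
        obtain ⟨y, hy, h⟩ := hb.2 n
        exact ⟨a * y, T.mul_mem_genIdeal S ha hy, by simpa [mul_sub] using T.mul_nhd ha h⟩⟩) c
    (T.iSup_deg ▸ Submodule.mem_top) x hx

theorem mem_closedIdeal (S : ℤ → Set A) {x : A} :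
    x ∈ T.closedIdeal S ↔ x ∈ ⨆ d, T.closure (T.genIdeal S d) d := Iff.rfl

instance (S : ℤ → Set A) : (T.closedIdeal S).IsTwoSided where
  mul_mem_of_left {x} c hx := bilin_mem_of_iSup (fun d => T.closure (T.genIdeal S d) d) T.deg
    (LinearMap.mul k A) (⨆ d, T.closure (T.genIdeal S d) d)
    (fun d e b hb a ha => le_iSup (fun d => T.closure (T.genIdeal S d) d) (d + e)
      ⟨T.mul_mem hb.1 ha, fun n => by
        obtain ⟨y, hy, h⟩ := hb.2 (n + e).toNat
        exact ⟨y * a, T.genIdeal_mul_mem S ha hy, by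
          simpa [sub_mul] using T.nhd_mul (n := n) (by omega) h ha⟩⟩) x hx c
    (T.iSup_deg ▸ Submodule.mem_top)

/-- The image of a degreewise topology under a surjection (the quotient topology). -/
def map {A' : Type*} [Ring A'] [Algebra k A'] (f : A →ₐ[k] A') (hf : Function.Surjective f) :
    DegreewiseTop k A' where
  deg d := (T.deg d).map f.toLinearMap
  nhd d n := (T.nhd d n).map f.toLinearMap
  iSup_deg := by
    rw [← Submodule.map_iSup, T.iSup_deg, Submodule.map_top, LinearMap.range_eq_top]
    exact hf
  one_mem := ⟨1, T.one_mem, map_one f⟩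
  mul_mem := by
    rintro d e _ _ ⟨a, ha, rfl⟩ ⟨b, hb, rfl⟩
    exact ⟨a * b, T.mul_mem ha hb, map_mul f a b⟩
  nhd_le d n := Submodule.map_mono (T.nhd_le d n)
  nhd_anti d m n h := Submodule.map_mono (T.nhd_anti d h)
  mul_nhd := by
    rintro d e n _ _ ⟨a, ha, rfl⟩ ⟨b, hb, rfl⟩
    exact ⟨a * b, T.mul_nhd ha hb, map_mul f a b⟩
  nhd_mul := by
    rintro d e m n _ _ h ⟨a, ha, rfl⟩ ⟨b, hb, rfl⟩
    exact ⟨a * b, T.nhd_mul h ha hb, map_mul f a b⟩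

end DegreewiseTop

/-! ### Degreewise topological Poisson algebras -/

/-- A commutative graded algebra with degreewise topology and a Poisson bracket of degree `0` such
that `{A(d), Iₘ(A(e))} ⊆ Iₙ(A(d+e))` for `m ≥ n` and `m ≥ n + d`; in particular the brackets
`A(d) × A(e) → A(d+e)` are continuous. -/
structure DegreewisePoisson (k A : Type*) [Field k] [Ring A] [Algebra k A] extends
    DegreewiseTop k A, PoissonBracket k A where
  mul_comm : ∀ a b : A, a * b = b * a
  br_mem : ∀ {d e : ℤ} {a b : A}, a ∈ deg d → b ∈ deg e → br a b ∈ deg (d + e)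
  br_nhd : ∀ {d e : ℤ} {m n : ℕ} {a b : A}, n ≤ m → (n : ℤ) + d ≤ m → a ∈ deg d → b ∈ nhd e m →
    br a b ∈ nhd (d + e) n

/-- Homomorphisms of degreewise topological Poisson algebras: homomorphisms of algebras and of Lie
algebras which preserve the gradings and are continuous on each homogeneous subspace (for linear
maps and linear topologies it suffices to consider neighbourhoods of zero). -/
structure IsDegreewisePoissonHom {k A A' : Type*} [Field k] [Ring A] [Algebra k A] [Ring A']
    [Algebra k A'] (P : DegreewisePoisson k A) (P' : DegreewisePoisson k A') (f : A →ₐ[k] A') :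
    Prop where
  map_br : ∀ a b, f (P.br a b) = P'.br (f a) (f b)
  map_deg : ∀ d, ∀ a ∈ P.deg d, f a ∈ P'.deg d
  continuous : ∀ d n, ∃ m, ∀ a ∈ P.nhd d m, f a ∈ P'.nhd d n

namespace DegreewisePoisson

variable {k A : Type*} [Field k] [Ring A] [Algebra k A] (P : DegreewisePoisson k A)

theorem nhd_br {d e : ℤ} {m n : ℕ} {a b : A} (h : n ≤ m) (h' : (n : ℤ) + e ≤ m)
    (ha : a ∈ P.nhd d m) (hb : b ∈ P.deg e) : P.br a b ∈ P.nhd (d + e) n := by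
  rw [P.skew, add_comm]
  exact neg_mem (P.br_nhd h h' hb ha)

theorem br_mem_cauchySeq {d e : ℤ} {a b : ℕ → A} (ha : a ∈ P.cauchySeq d)
    (hb : b ∈ P.cauchySeq e) : P.pi.br a b ∈ P.cauchySeq (d + e) := by
  refine ⟨fun i => P.br_mem (ha.1 i) (hb.1 i), fun n => ?_⟩
  obtain ⟨M, hM⟩ := ha.2 (max n (n + e).toNat)
  obtain ⟨N, hN⟩ := hb.2 (max n (n + d).toNat)
  refine ⟨max M N, fun i hi j hj => ?_⟩
  have h1 := P.br_nhd (n := n) (by omega) (by omega) (ha.1 i) (hN i (by omega) j (by omega))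
  have h2 := P.nhd_br (n := n) (by omega) (by omega) (hM i (by omega) j (by omega)) (hb.1 j)
  have h3 := add_mem h1 h2
  simp only [map_sub, LinearMap.sub_apply] at h3
  rwa [sub_add_sub_cancel] at h3

theorem br_mem_eventuallySeq {d e : ℤ} {m n : ℕ} {a b : ℕ → A} (h : n ≤ m)
    (h' : (n : ℤ) + d ≤ m) (ha : a ∈ P.cauchySeq d)
    (hb : b ∈ P.eventuallySeq e m) : P.pi.br a b ∈ P.eventuallySeq (d + e) n := by
  obtain ⟨hb, M, hM⟩ := hb
  exact ⟨P.br_mem_cauchySeq ha hb, M, fun i hi => P.br_nhd h h' (ha.1 i) (hM i hi)⟩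

theorem br_mem_nullSeq {d e : ℤ} {a b : ℕ → A} (ha : a ∈ P.cauchySeq d)
    (hb : b ∈ P.nullSeq e) : P.pi.br a b ∈ P.nullSeq (d + e) := by
  simp only [DegreewiseTop.nullSeq, Submodule.mem_iInf] at hb ⊢
  exact fun n => P.br_mem_eventuallySeq (m := max n (n + d).toNat) (by omega) (by omega) ha (hb _)

theorem br_mem_cauchySubalg : ∀ a ∈ P.cauchySubalg, ∀ b ∈ P.cauchySubalg,
    P.pi.br a b ∈ P.cauchySubalg :=
  bilin_mem_of_iSup P.cauchySeq P.cauchySeq P.pi.br (⨆ d, P.cauchySeq d)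
    (fun d e _ ha _ hb => le_iSup P.cauchySeq (d + e) (P.br_mem_cauchySeq ha hb))

theorem br_mem_nullIdeal (a : P.cauchySubalg) (b : P.cauchySubalg) (hb : b ∈ P.nullIdeal) :
    (P.pi.restrict _ P.br_mem_cauchySubalg).br a b ∈ P.nullIdeal :=
  bilin_mem_of_iSup P.cauchySeq P.nullSeq P.pi.br (⨆ d, P.nullSeq d)
    (fun d e _ ha _ hb => le_iSup P.nullSeq (d + e) (P.br_mem_nullSeq ha hb)) a.1
    (P.mem_cauchySubalg.1 a.2) b.1 hb

/-- The degreewise completion of a degreewise topological Poisson algebra. -/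
def completion : DegreewisePoisson k P.Completion where
  __ := P.toDegreewiseTop.completion
  __ := (P.pi.restrict _ P.br_mem_cauchySubalg).quot P.nullIdeal P.br_mem_nullIdeal
  mul_comm x y := by
    obtain ⟨a, rfl⟩ := Ideal.Quotient.mk_surjective x
    obtain ⟨b, rfl⟩ := Ideal.Quotient.mk_surjective y
    rw [← map_mul, ← map_mul]
    congr 1
    ext i
    exact P.mul_comm _ _
  br_mem := br_mem_imageSub _ _ P.pi P.br_mem_cauchySubalg P.br_mem_nullIdeal
    fun _ ha _ hb => P.br_mem_cauchySeq ha hb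
  br_nhd h h' := br_mem_imageSub _ _ P.pi P.br_mem_cauchySubalg P.br_mem_nullIdeal
    fun _ ha _ hb => P.br_mem_eventuallySeq h h' ha hb

theorem completion_br_of (a b : A) :
    P.completion.br (P.of a) (P.of b) = P.of (P.br a b) := rfl

/-- The quotient by an ideal stable under the bracket, with the quotient topologies. -/
def quotient (I : Ideal A) [I.IsTwoSided] (h : ∀ a, ∀ b ∈ I, P.br a b ∈ I) :
    DegreewisePoisson k (A ⧸ I) where
  __ := P.toDegreewiseTop.map (Ideal.Quotient.mkₐ k I) (Ideal.Quotient.mkₐ_surjective k I)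
  __ := P.toPoissonBracket.quot I h
  mul_comm := by
    rintro ⟨a⟩ ⟨b⟩
    exact congrArg (Ideal.Quotient.mk I) (P.mul_comm a b)
  br_mem := by
    rintro d e _ _ ⟨a, ha, rfl⟩ ⟨b, hb, rfl⟩
    exact ⟨P.br a b, P.br_mem ha hb, rfl⟩
  br_nhd := by
    rintro d e m n _ _ h h' ⟨a, ha, rfl⟩ ⟨b, hb, rfl⟩
    exact ⟨P.br a b, P.br_nhd h h' ha hb, rfl⟩

end DegreewisePoisson

/-! ### Filtrations and associated graded Poisson algebras -/

/-- A filtration `⋯ ⊆ G_p A ⊆ G_{p+1} A ⊆ ⋯`, `G_p A = ∑_d G_p A(d)`, of a graded algebra such that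
`[G_p A, G_q A] ⊆ G_{p+q-1} A`, with a linear topology on each `G_p A(d)`. -/
structure TopFiltration (k A : Type*) [Field k] [Ring A] [Algebra k A] where
  fil : ℤ → ℤ → Submodule k A
  nhd : ℤ → ℤ → ℕ → Submodule k A
  mono : ∀ d, Monotone fun p => fil p d
  one_mem : (1 : A) ∈ fil 0 0
  mul_mem : ∀ {p q d e : ℤ} {a b : A}, a ∈ fil p d → b ∈ fil q e → a * b ∈ fil (p + q) (d + e)
  comm_mem : ∀ {p q d e : ℤ} {a b : A}, a ∈ fil p d → b ∈ fil q e →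
    a * b - b * a ∈ fil (p + q - 1) (d + e)
  nhd_le : ∀ p d n, nhd p d n ≤ fil p d
  nhd_anti : ∀ p d, Antitone (nhd p d)
  mul_nhd : ∀ {p q d e : ℤ} {n : ℕ} {a b : A}, a ∈ fil p d → b ∈ nhd q e n →
    a * b ∈ nhd (p + q) (d + e) n
  nhd_mul : ∀ {p q d e : ℤ} {m n : ℕ} {a b : A}, (n : ℤ) + e ≤ m → a ∈ nhd p d m → b ∈ fil q e →
    a * b ∈ nhd (p + q) (d + e) n
  comm_nhd : ∀ {p q d e : ℤ} {m n : ℕ} {a b : A}, n ≤ m → (n : ℤ) + d ≤ m → a ∈ fil p d →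
    b ∈ nhd q e m → a * b - b * a ∈ nhd (p + q - 1) (d + e) n

section Laurent

variable {k A : Type*} [Field k] [Ring A] [Algebra k A]

/-- The space `⨁ₚ S(p) sᵖ` of Laurent polynomials in `s`. -/
noncomputable def laurent (S : ℤ → Submodule k A) : Submodule k (AddMonoidAlgebra A ℤ) :=
  ⨆ p, (S p).map (AddMonoidAlgebra.lsingle (R := k) p)

theorem single_mem_laurent {S : ℤ → Submodule k A} {p : ℤ} {a : A} (ha : a ∈ S p) :
    AddMonoidAlgebra.single p a ∈ laurent S :=
  le_iSup (fun p => (S p).map (AddMonoidAlgebra.lsingle (R := k) p)) p ⟨a, ha, rfl⟩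

theorem laurent_mono {S S' : ℤ → Submodule k A} (h : ∀ p, S p ≤ S' p) :
    laurent S ≤ laurent S' :=
  iSup_mono fun p => Submodule.map_mono (h p)

theorem mul_mem_laurent {S S' S'' : ℤ → Submodule k A}
    (h : ∀ p q, ∀ a ∈ S p, ∀ b ∈ S' q, a * b ∈ S'' (p + q)) :
    ∀ x ∈ laurent S, ∀ y ∈ laurent S', x * y ∈ laurent S'' := by
  refine bilin_mem_of_iSup _ _ (LinearMap.mul k (AddMonoidAlgebra A ℤ)) _ ?_
  rintro p q _ ⟨a, ha, rfl⟩ _ ⟨b, hb, rfl⟩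
  have := single_mem_laurent (h p q a ha b hb)
  rwa [← AddMonoidAlgebra.single_mul_single] at this

/-- The bracket `s⁻¹ [f, g]` on Laurent polynomials with coefficients in `A`. -/
noncomputable def laurentBracket (k A : Type*) [Field k] [Ring A] [Algebra k A] :
    PoissonBracket k (AddMonoidAlgebra A ℤ) :=
  have key : ∀ a x : AddMonoidAlgebra A ℤ, a * (AddMonoidAlgebra.single (-1 : ℤ) (1 : A) * x) =
      AddMonoidAlgebra.single (-1 : ℤ) (1 : A) * (a * x) := fun a x => by
    rw [← mul_assoc, ← mul_assoc]
    congr 1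
    exact (AddMonoidAlgebra.single_commute (fun _ => AddCommute.all _ _)
      (fun _ => Commute.one_left _) a).eq.symm
  { br := (PoissonBracket.commutator k (AddMonoidAlgebra A ℤ)).br.compr₂
      (LinearMap.mulLeft k (AddMonoidAlgebra.single (-1 : ℤ) (1 : A)))
    br_self := fun a => by simp [PoissonBracket.commutator_apply]
    jacobi := fun a b c => by
      simp only [LinearMap.compr₂_apply, PoissonBracket.commutator_apply, LinearMap.mulLeft_apply,
        mul_sub, sub_mul, mul_assoc, key]
      abel
    leibniz := fun a b c => by
      simp only [LinearMap.compr₂_apply, PoissonBracket.commutator_apply, LinearMap.mulLeft_apply,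
        mul_sub, sub_mul, mul_assoc, key]
      abel }

theorem laurentBracket_apply (x y : AddMonoidAlgebra A ℤ) :
    (laurentBracket k A).br x y = AddMonoidAlgebra.single (-1 : ℤ) 1 * (x * y - y * x) := by
  simp [laurentBracket, PoissonBracket.commutator_apply]

theorem br_mem_laurent {S S' S'' : ℤ → Submodule k A}
    (h : ∀ p q, ∀ a ∈ S p, ∀ b ∈ S' q, a * b - b * a ∈ S'' (p + q - 1)) :
    ∀ x ∈ laurent S, ∀ y ∈ laurent S', (laurentBracket k A).br x y ∈ laurent S'' := by
  refine bilin_mem_of_iSup _ _ (laurentBracket k A).br _ ?_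
  rintro p q _ ⟨a, ha, rfl⟩ _ ⟨b, hb, rfl⟩
  have := single_mem_laurent (h p q a ha b hb)
  rw [laurentBracket_apply]
  simp only [AddMonoidAlgebra.lsingle_apply, AddMonoidAlgebra.single_mul_single, mul_sub, one_mul]
  rw [add_comm q p, show -1 + (p + q) = p + q - 1 by ring, ← AddMonoidAlgebra.single_sub]
  exact this

end Laurent

namespace TopFiltration

variable {k A : Type*} [Field k] [Ring A] [Algebra k A] (F : TopFiltration k A)

/-- The image of a filtration under a homomorphism, with the quotient topologies. -/
def map {A' : Type*} [Ring A'] [Algebra k A'] (f : A →ₐ[k] A') : TopFiltration k A' where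
  fil p d := (F.fil p d).map f.toLinearMap
  nhd p d n := (F.nhd p d n).map f.toLinearMap
  mono d _ _ h := Submodule.map_mono (F.mono d h)
  one_mem := ⟨1, F.one_mem, map_one f⟩
  mul_mem := by
    rintro p q d e _ _ ⟨a, ha, rfl⟩ ⟨b, hb, rfl⟩
    exact ⟨a * b, F.mul_mem ha hb, map_mul f a b⟩
  comm_mem := by
    rintro p q d e _ _ ⟨a, ha, rfl⟩ ⟨b, hb, rfl⟩
    exact ⟨a * b - b * a, F.comm_mem ha hb, by simp⟩
  nhd_le p d n := Submodule.map_mono (F.nhd_le p d n)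
  nhd_anti p d _ _ h := Submodule.map_mono (F.nhd_anti p d h)
  mul_nhd := by
    rintro p q d e n _ _ ⟨a, ha, rfl⟩ ⟨b, hb, rfl⟩
    exact ⟨a * b, F.mul_nhd ha hb, map_mul f a b⟩
  nhd_mul := by
    rintro p q d e m n _ _ h ⟨a, ha, rfl⟩ ⟨b, hb, rfl⟩
    exact ⟨a * b, F.nhd_mul h ha hb, map_mul f a b⟩
  comm_nhd := by
    rintro p q d e m n _ _ h h' ⟨a, ha, rfl⟩ ⟨b, hb, rfl⟩
    exact ⟨a * b - b * a, F.comm_nhd h h' ha hb, by simp⟩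

/-- The space `⨁ₚ (G_p A(d)) sᵖ`. -/
noncomputable def reesDeg (d : ℤ) : Submodule k (AddMonoidAlgebra A ℤ) :=
  laurent fun p => F.fil p d

/-- The space `⨁ₚ (G_{p-1} A(d)) sᵖ`. -/
noncomputable def reesIdealDeg (d : ℤ) : Submodule k (AddMonoidAlgebra A ℤ) :=
  laurent fun p => F.fil (p - 1) d

/-- The space `⨁ₚ U_p sᵖ`, where `U_p` is the `n`-th neighbourhood of zero in `G_p A(d)`. -/
noncomputable def reesNhd (d : ℤ) (n : ℕ) : Submodule k (AddMonoidAlgebra A ℤ) :=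
  laurent fun p => F.nhd p d n

theorem mul_mem_reesDeg {d e : ℤ} : ∀ x ∈ F.reesDeg d, ∀ y ∈ F.reesDeg e,
    x * y ∈ F.reesDeg (d + e) :=
  mul_mem_laurent fun _ _ _ ha _ hb => F.mul_mem ha hb

theorem br_mem_reesDeg {d e : ℤ} : ∀ x ∈ F.reesDeg d, ∀ y ∈ F.reesDeg e,
    (laurentBracket k A).br x y ∈ F.reesDeg (d + e) :=
  br_mem_laurent fun _ _ _ ha _ hb => F.comm_mem ha hb

theorem mul_mem_reesIdealDeg {d e : ℤ} : ∀ x ∈ F.reesDeg d, ∀ y ∈ F.reesIdealDeg e,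
    x * y ∈ F.reesIdealDeg (d + e) :=
  mul_mem_laurent fun p q a ha b hb => by
    rw [add_sub_assoc]
    exact F.mul_mem ha hb

theorem reesIdealDeg_mul_mem {d e : ℤ} : ∀ x ∈ F.reesIdealDeg d, ∀ y ∈ F.reesDeg e,
    x * y ∈ F.reesIdealDeg (d + e) :=
  mul_mem_laurent fun p q a ha b hb => by
    rw [← sub_add_eq_add_sub]
    exact F.mul_mem ha hb

theorem br_mem_reesIdealDeg {d e : ℤ} : ∀ x ∈ F.reesDeg d, ∀ y ∈ F.reesIdealDeg e,
    (laurentBracket k A).br x y ∈ F.reesIdealDeg (d + e) :=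
  br_mem_laurent fun p q a ha b hb => by
    have := F.comm_mem ha hb
    rwa [← add_sub_assoc] at this

theorem comm_mem_reesIdealDeg {d e : ℤ} : ∀ x ∈ F.reesDeg d, ∀ y ∈ F.reesDeg e,
    (PoissonBracket.commutator k (AddMonoidAlgebra A ℤ)).br x y ∈ F.reesIdealDeg (d + e) := by
  refine bilin_mem_of_iSup _ _ (PoissonBracket.commutator k (AddMonoidAlgebra A ℤ)).br _ ?_
  rintro p q _ ⟨a, ha, rfl⟩ _ ⟨b, hb, rfl⟩
  rw [PoissonBracket.commutator_apply]
  simp only [AddMonoidAlgebra.lsingle_apply]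
  rw [AddMonoidAlgebra.single_mul_single, AddMonoidAlgebra.single_mul_single, add_comm q p,
    ← AddMonoidAlgebra.single_sub]
  exact single_mem_laurent (S := fun p => F.fil (p - 1) (d + e)) (F.comm_mem ha hb)

/-- The Rees algebra `⨁ₚ (G_p A) sᵖ`, where `G_p A = ∑_d G_p A(d)`. -/
noncomputable def rees : Subalgebra k (AddMonoidAlgebra A ℤ) :=
  Submodule.toSubalgebra (⨆ d, F.reesDeg d)
    (le_iSup F.reesDeg 0 (single_mem_laurent (S := fun p => F.fil p 0) F.one_mem))
    (fun x y hx hy => bilin_mem_of_iSup F.reesDeg F.reesDeg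
      (LinearMap.mul k (AddMonoidAlgebra A ℤ)) (⨆ d, F.reesDeg d)
      (fun d e x hx y hy => le_iSup F.reesDeg (d + e) (F.mul_mem_reesDeg x hx y hy)) x hx y hy)

/-- The ideal `⨁ₚ (G_{p-1} A) sᵖ` of the Rees algebra. -/
noncomputable def reesIdeal : Ideal F.rees where
  carrier := {x | (x : AddMonoidAlgebra A ℤ) ∈ ⨆ d, F.reesIdealDeg d}
  add_mem' ha hb := Submodule.add_mem (⨆ d, F.reesIdealDeg d) ha hb
  zero_mem' := zero_mem (⨆ d, F.reesIdealDeg d)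
  smul_mem' c x hx := bilin_mem_of_iSup F.reesDeg F.reesIdealDeg
      (LinearMap.mul k (AddMonoidAlgebra A ℤ)) (⨆ d, F.reesIdealDeg d)
      (fun d e x hx y hy => le_iSup F.reesIdealDeg (d + e) (F.mul_mem_reesIdealDeg x hx y hy))
      c.1 c.2 x.1 hx

instance : F.reesIdeal.IsTwoSided where
  mul_mem_of_left {x} c hx := bilin_mem_of_iSup F.reesIdealDeg F.reesDeg
      (LinearMap.mul k (AddMonoidAlgebra A ℤ)) (⨆ d, F.reesIdealDeg d)
      (fun d e x hx y hy => le_iSup F.reesIdealDeg (d + e) (F.reesIdealDeg_mul_mem x hx y hy))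
      x.1 hx c.1 c.2

/-- The associated graded algebra `⨁ₚ G_p A / G_{p-1} A`, as the quotient of the Rees algebra
`⨁ₚ (G_p A) sᵖ` by the ideal `⨁ₚ (G_{p-1} A) sᵖ`. -/
abbrev Gr := F.rees ⧸ F.reesIdeal

theorem br_mem_rees : ∀ x ∈ F.rees, ∀ y ∈ F.rees, (laurentBracket k A).br x y ∈ F.rees :=
  bilin_mem_of_iSup F.reesDeg F.reesDeg (laurentBracket k A).br (⨆ d, F.reesDeg d)
    (fun d e x hx y hy => le_iSup F.reesDeg (d + e) (F.br_mem_reesDeg x hx y hy))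

theorem br_mem_reesIdeal (x y : F.rees) (hy : y ∈ F.reesIdeal) :
    ((laurentBracket k A).restrict _ F.br_mem_rees).br x y ∈ F.reesIdeal :=
  bilin_mem_of_iSup F.reesDeg F.reesIdealDeg (laurentBracket k A).br (⨆ d, F.reesIdealDeg d)
    (fun d e x hx y hy => le_iSup F.reesIdealDeg (d + e) (F.br_mem_reesIdealDeg x hx y hy))
    x.1 x.2 y.1 hy

theorem comm_mem_reesIdeal (x y : F.rees) : x * y - y * x ∈ F.reesIdeal := by
  have := bilin_mem_of_iSup F.reesDeg F.reesDeg
    (PoissonBracket.commutator k (AddMonoidAlgebra A ℤ)).br (⨆ d, F.reesIdealDeg d)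
    (fun d e x hx y hy => le_iSup F.reesIdealDeg (d + e) (F.comm_mem_reesIdealDeg x hx y hy))
    x.1 x.2 y.1 y.2
  rwa [PoissonBracket.commutator_apply] at this

/-- The associated graded Poisson algebra `gr A = ⨁_d ⨁_p G_p A(d) / G_{p-1} A(d)`: the bracket of
the classes of `a ∈ G_p A` and `b ∈ G_q A` is the class of `[a, b]` in `G_{p+q-1} A / G_{p+q-2} A`.
The topology on `G_p A(d) / G_{p-1} A(d)` is the quotient of the one on `G_p A(d)`. -/
noncomputable def gr : DegreewisePoisson k F.Gr where
  deg d := imageSub F.rees F.reesIdeal (F.reesDeg d)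
  nhd d n := imageSub F.rees F.reesIdeal (F.reesNhd d n)
  iSup_deg := iSup_imageSub _ _ _ fun _ => Iff.rfl
  one_mem := ⟨1, single_mem_laurent (S := fun p => F.fil p 0) F.one_mem, rfl⟩
  mul_mem := mul_mem_imageSub _ _ F.mul_mem_reesDeg
  nhd_le d n := imageSub_mono _ _ (laurent_mono fun p => F.nhd_le p d n)
  nhd_anti d _ _ h := imageSub_mono _ _ (laurent_mono fun p => F.nhd_anti p d h)
  mul_nhd := mul_mem_imageSub _ _ (mul_mem_laurent fun _ _ _ ha _ hb => F.mul_nhd ha hb)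
  nhd_mul h := mul_mem_imageSub _ _ (mul_mem_laurent fun _ _ _ ha _ hb => F.nhd_mul h ha hb)
  __ := ((laurentBracket k A).restrict _ F.br_mem_rees).quot F.reesIdeal F.br_mem_reesIdeal
  mul_comm x y := by
    obtain ⟨a, rfl⟩ := Ideal.Quotient.mk_surjective x
    obtain ⟨b, rfl⟩ := Ideal.Quotient.mk_surjective y
    rw [← map_mul, ← map_mul]
    exact Ideal.Quotient.eq.2 (F.comm_mem_reesIdeal a b)
  br_mem := br_mem_imageSub _ _ _ F.br_mem_rees F.br_mem_reesIdeal F.br_mem_reesDeg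
  br_nhd h h' := br_mem_imageSub _ _ _ F.br_mem_rees F.br_mem_reesIdeal
    (br_mem_laurent fun _ _ _ ha _ hb => F.comm_nhd h h' ha hb)

end TopFiltration

namespace DegreewiseTop

variable {k A : Type*} [Field k] [Ring A] [Algebra k A] (T : DegreewiseTop k A)

/-- The filtration of the degreewise completion induced by a filtration `G_p A` of `A`:
`G_p Â(d)` is the closure in `Â(d)` of the image of `G_p A ∩ A(d)`, with the subspace topology. -/
def completionFiltration (G : ℤ → Submodule k A) (mono : Monotone G) (one_mem : (1 : A) ∈ G 0)
    (mul_mem : ∀ {p q : ℤ} {a b : A}, a ∈ G p → b ∈ G q → a * b ∈ G (p + q))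
    (comm_mem : ∀ {p q : ℤ} {a b : A}, a ∈ G p → b ∈ G q → a * b - b * a ∈ G (p + q - 1)) :
    TopFiltration k T.Completion :=
  have hmul : ∀ {p q d e : ℤ} {x y : T.Completion},
      x ∈ T.completion.closure ((G p ⊓ T.deg d).map T.of.toLinearMap) d →
      y ∈ T.completion.closure ((G q ⊓ T.deg e).map T.of.toLinearMap) e → ∀ n : ℕ,
      ∃ a ∈ G p ⊓ T.deg d, ∃ b ∈ G q ⊓ T.deg e, x * y - T.of (a * b) ∈
        T.completion.nhd (d + e) n ∧ y * x - T.of (b * a) ∈ T.completion.nhd (d + e) n := by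
    rintro p q d e x y ⟨hx, hx'⟩ ⟨hy, hy'⟩ n
    obtain ⟨_, ⟨a, ha, rfl⟩, h1⟩ := hx' (max n (n + e).toNat)
    obtain ⟨_, ⟨b, hb, rfl⟩, h2⟩ := hy' (max n (n + d).toNat)
    have ha' := T.of_mem ha.2
    have hb' := T.of_mem hb.2
    refine ⟨a, ha, b, hb, ?_, ?_⟩
    · have h3 := T.completion.nhd_anti _ (le_max_left n _)
        (T.completion.mul_nhd hx h2)
      have h4 := T.completion.nhd_mul (n := n) (by omega) h1 hb'
      have := add_mem h3 h4
      simp only [AlgHom.toLinearMap_apply, mul_sub, sub_mul] at this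
      rw [sub_add_sub_cancel] at this
      simpa using this
    · have h3 := T.completion.nhd_anti _ (le_max_left n _)
        (T.completion.mul_nhd hy h1)
      have h4 := T.completion.nhd_mul (n := n) (by omega) h2 ha'
      have := add_mem h3 h4
      simp only [AlgHom.toLinearMap_apply, mul_sub, sub_mul] at this
      rw [sub_add_sub_cancel, add_comm e d] at this
      simpa using this
  have hcomm : ∀ {p q d e : ℤ} {x y : T.Completion},
      x ∈ T.completion.closure ((G p ⊓ T.deg d).map T.of.toLinearMap) d →
      y ∈ T.completion.closure ((G q ⊓ T.deg e).map T.of.toLinearMap) e →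
      x * y - y * x ∈
        T.completion.closure ((G (p + q - 1) ⊓ T.deg (d + e)).map T.of.toLinearMap) (d + e) := by
    intro p q d e x y hx hy
    refine ⟨sub_mem (T.completion.mul_mem hx.1 hy.1) (by
      rw [add_comm d e]; exact T.completion.mul_mem hy.1 hx.1), fun n => ?_⟩
    obtain ⟨a, ha, b, hb, h1, h2⟩ := hmul hx hy n
    refine ⟨T.of (a * b - b * a), ⟨_, ⟨comm_mem ha.1 hb.1, sub_mem (T.mul_mem ha.2 hb.2) ?_⟩, rfl⟩,
      ?_⟩
    · rw [add_comm d e]; exact T.mul_mem hb.2 ha.2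
    · have := sub_mem h1 h2
      rw [map_sub]
      convert this using 1
      abel
  have hmul' : ∀ {p q d e : ℤ} {x y : T.Completion},
      x ∈ T.completion.closure ((G p ⊓ T.deg d).map T.of.toLinearMap) d →
      y ∈ T.completion.closure ((G q ⊓ T.deg e).map T.of.toLinearMap) e →
      x * y ∈
        T.completion.closure ((G (p + q) ⊓ T.deg (d + e)).map T.of.toLinearMap) (d + e) := by
    intro p q d e x y hx hy
    refine ⟨T.completion.mul_mem hx.1 hy.1, fun n => ?_⟩
    obtain ⟨a, ha, b, hb, h1, h2⟩ := hmul hx hy n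
    exact ⟨_, ⟨a * b, ⟨mul_mem ha.1 hb.1, T.mul_mem ha.2 hb.2⟩, rfl⟩, h1⟩
  { fil := fun p d => T.completion.closure ((G p ⊓ T.deg d).map T.of.toLinearMap) d
    nhd := fun p d n => T.completion.closure ((G p ⊓ T.deg d).map T.of.toLinearMap) d ⊓
      T.completion.nhd d n
    mono := fun d p q h x hx => ⟨hx.1, fun n => by
      obtain ⟨_, ⟨a, ha, rfl⟩, h'⟩ := hx.2 n
      exact ⟨_, ⟨a, ⟨mono h ha.1, ha.2⟩, rfl⟩, h'⟩⟩
    one_mem := ⟨T.completion.one_mem, fun n =>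
      ⟨1, ⟨1, ⟨one_mem, T.one_mem⟩, map_one T.of⟩, by simp⟩⟩
    mul_mem := hmul'
    comm_mem := hcomm
    nhd_le := fun p d n => inf_le_left
    nhd_anti := fun p d m n h => inf_le_inf_left _ (T.completion.nhd_anti d h)
    mul_nhd := fun ha hb => ⟨hmul' ha hb.1, T.completion.mul_nhd ha.1 hb.2⟩
    nhd_mul := fun h ha hb => ⟨hmul' ha.1 hb, T.completion.nhd_mul h ha.2 hb.1⟩
    comm_nhd := by
      intro p q d e m n a b h h' ha hb
      refine ⟨hcomm ha hb.1, sub_mem ?_ ?_⟩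
      · exact T.completion.mul_nhd ha.1 (T.completion.nhd_anti _ h hb.2)
      · rw [add_comm d e]
        exact T.completion.nhd_mul h' hb.2 ha.1 }

end DegreewiseTop

/-! ### The Poisson bracket on a symmetric algebra -/

/-- A commutative algebra generated by the image of `j : L → S` such that linear maps `L → S`
extend to derivations of `S`; satisfied by the symmetric algebra. -/
structure DerivExt (k L S : Type*) [Field k] [AddCommGroup L] [Module k L] [CommRing S]
    [Algebra k S] where
  j : L →ₗ[k] S
  lift : (L →ₗ[k] S) → Derivation k S S
  adjoin : Algebra.adjoin k (Set.range j) = ⊤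
  lift_j : ∀ f x, lift f (j x) = f x

namespace DerivExt

variable {k L S : Type*} [Field k] [LieRing L] [LieAlgebra k L] [CommRing S] [Algebra k S]
  (E : DerivExt k L S)

theorem ext' {D D' : Derivation k S S} (h : ∀ x, D (E.j x) = D' (E.j x)) : D = D' :=
  Derivation.ext_of_adjoin_eq_top _ E.adjoin (by rintro _ ⟨x, rfl⟩; exact h x)

/-- The derivation `{x, ·}` for `x ∈ L`. -/
def ad : L →ₗ[k] Derivation k S S where
  toFun x := E.lift (E.j ∘ₗ (LieAlgebra.ad k L x : L →ₗ[k] L))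
  map_add' x y := E.ext' fun z => by simp [E.lift_j]
  map_smul' r x := E.ext' fun z => by simp [E.lift_j]

theorem ad_j (x y : L) : E.ad x (E.j y) = E.j ⁅x, y⁆ := by simp [ad, E.lift_j]

/-- The linear map `x ↦ {a, x}` on `L`. -/
def negAd (a : S) : L →ₗ[k] S where
  toFun x := - E.ad x a
  map_add' x y := by rw [map_add, Derivation.add_apply, neg_add]
  map_smul' r x := by rw [map_smul, Derivation.smul_apply, RingHom.id_apply, smul_neg]

theorem negAd_apply (a : S) (x : L) : E.negAd a x = - E.ad x a := rfl

/-- The derivation `{a, ·}` for `a ∈ S`. -/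
def ham : S →ₗ[k] Derivation k S S where
  toFun a := E.lift (E.negAd a)
  map_add' a b := E.ext' fun z => by
    rw [Derivation.add_apply, E.lift_j, E.lift_j, E.lift_j, negAd_apply, negAd_apply, negAd_apply,
      map_add, neg_add]
  map_smul' r a := E.ext' fun z => by
    rw [RingHom.id_apply, Derivation.smul_apply, E.lift_j, E.lift_j, negAd_apply, negAd_apply,
      Derivation.map_smul, smul_neg]

theorem ham_apply_j (a : S) (x : L) : E.ham a (E.j x) = - E.ad x a := E.lift_j _ _

theorem ham_j (x : L) : E.ham (E.j x) = E.ad x :=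
  E.ext' fun y => by rw [ham_apply_j, ad_j, ad_j, ← lie_skew, map_neg, neg_neg]

theorem ham_mul (a b : S) : E.ham (a * b) = a • E.ham b + b • E.ham a :=
  E.ext' fun x => by
    simp only [ham_apply_j, Derivation.leibniz, Derivation.add_apply, Derivation.smul_apply,
      smul_eq_mul]
    ring

theorem ham_algebraMap (r : k) : E.ham (algebraMap k S r) = 0 :=
  E.ext' fun x => by simp [ham_apply_j]

theorem ham_skew (a b : S) : E.ham a b = - E.ham b a := by
  have hb : b ∈ Algebra.adjoin k (Set.range E.j) := E.adjoin ▸ Algebra.mem_top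
  induction hb using Algebra.adjoin_induction with
  | mem x h => obtain ⟨x, rfl⟩ := h; rw [ham_apply_j, ham_j]
  | algebraMap r => simp [ham_algebraMap]
  | add x y _ _ hx hy => rw [map_add, map_add, Derivation.add_apply, hx, hy]; ring
  | mul x y _ _ hx hy =>
    rw [Derivation.leibniz, ham_mul, Derivation.add_apply, hx, hy]
    simp only [smul_eq_mul, Derivation.smul_apply]; ring

theorem ad_ham (x : L) (a : S) : ⁅E.ad x, E.ham a⁆ = E.ham (E.ad x a) :=
  E.ext' fun y => by
    have h : ⁅E.ad x, E.ad y⁆ = E.ad ⁅x, y⁆ := E.ext' fun z => by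
      rw [Derivation.commutator_apply]
      simp only [ad_j, ← map_sub, lie_lie]
    have h' := congrArg (fun D => D a) h
    simp only [Derivation.commutator_apply] at h' ⊢
    simp only [ham_apply_j, ad_j, map_neg, ← h']
    ring

theorem ham_ham (a b : S) : ⁅E.ham a, E.ham b⁆ = E.ham (E.ham a b) :=
  E.ext' fun x => by
    have h := congrArg (fun D => D b) (E.ad_ham x a)
    simp only [Derivation.commutator_apply] at h ⊢
    simp only [ham_apply_j, map_neg]
    rw [E.ham_skew b (E.ad x a), ← h]
    ring

/-- The Poisson bracket extending the bracket of `L`. -/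
def poissonBracket [CharZero k] : PoissonBracket k S where
  br := LinearMap.mk₂ k (fun a b => E.ham a b) (fun a b c => by simp) (fun r a b => by simp)
    (fun a b c => by simp) (fun r a b => by simp)
  br_self a := by
    have h := E.ham_skew a a
    have h2 : (2 : k) • E.ham a a = 0 := by
      rw [two_smul]
      nth_rewrite 1 [h]
      simp
    exact (smul_eq_zero.1 h2).resolve_left two_ne_zero
  jacobi a b c := by
    have h := congrArg (fun D => D c) (E.ham_ham a b)
    simp only [Derivation.commutator_apply] at h
    simp only [LinearMap.mk₂_apply, ← h]
    ring
  leibniz a b c := by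
    simp only [LinearMap.mk₂_apply, Derivation.leibniz, smul_eq_mul]
    ring

theorem poissonBracket_j [CharZero k] (x y : L) :
    (E.poissonBracket).br (E.j x) (E.j y) = E.j ⁅x, y⁆ := by
  simp [poissonBracket, ham_j, ad_j]

end DerivExt

section sym

variable (k L : Type*) [Field k] [AddCommGroup L] [Module k L]

/-- The homomorphism `Sym L → Sym L ⊕ ε Sym L`, `ε² = 0`, with `x ↦ x + ε f(x)` for `x ∈ L`. -/
noncomputable def symDualLift (f : L →ₗ[k] SymmetricAlgebra k L) :
    SymmetricAlgebra k L →ₐ[k] TrivSqZeroExt (SymmetricAlgebra k L) (SymmetricAlgebra k L) :=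
  SymmetricAlgebra.lift
    ((TrivSqZeroExt.inlAlgHom k (SymmetricAlgebra k L) (SymmetricAlgebra k L)).toLinearMap ∘ₗ
      SymmetricAlgebra.ι k L +
    (TrivSqZeroExt.inrHom (SymmetricAlgebra k L) (SymmetricAlgebra k L)).restrictScalars k ∘ₗ f)

theorem fst_symDualLift (f : L →ₗ[k] SymmetricAlgebra k L) (a : SymmetricAlgebra k L) :
    (symDualLift k L f a).fst = a := by
  have : (TrivSqZeroExt.fstHom k (SymmetricAlgebra k L) (SymmetricAlgebra k L)).comp
      (symDualLift k L f) = AlgHom.id k _ := by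
    apply SymmetricAlgebra.algHom_ext
    ext x
    simp [symDualLift]
  exact congrArg (fun g => g a) this

/-- The extension of linear maps `L → Sym L` to derivations of the symmetric algebra. -/
noncomputable def symDerivExt : DerivExt k L (SymmetricAlgebra k L) where
  j := SymmetricAlgebra.ι k L
  lift f := Derivation.mk'
    ((TrivSqZeroExt.sndHom (SymmetricAlgebra k L) (SymmetricAlgebra k L)).restrictScalars k ∘ₗ
      (symDualLift k L f).toLinearMap)
    (fun a b => by
      simp only [LinearMap.comp_apply, LinearMap.restrictScalars_apply, AlgHom.toLinearMap_apply,
        map_mul, TrivSqZeroExt.sndHom_apply, TrivSqZeroExt.snd_mul, fst_symDualLift,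
        op_smul_eq_smul])
  adjoin := by
    rw [eq_top_iff]
    rintro a -
    induction a using SymmetricAlgebra.induction with
    | algebraMap r => exact Subalgebra.algebraMap_mem _ r
    | ι x => exact Algebra.subset_adjoin ⟨x, rfl⟩
    | mul a b ha hb => exact mul_mem ha hb
    | add a b ha hb => exact add_mem ha hb
  lift_j f x := by simp [symDualLift]

end sym

/-- The Poisson bracket on the symmetric algebra of a Lie algebra `L` extending the bracket
of `L`. -/
noncomputable def symBracket (k L : Type*) [Field k] [CharZero k] [LieRing L] [LieAlgebra k L] :
    PoissonBracket k (SymmetricAlgebra k L) := (symDerivExt k L).poissonBracket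

theorem symBracket_ι (k L : Type*) [Field k] [CharZero k] [LieRing L] [LieAlgebra k L] (x y : L) :
    (symBracket k L).br (SymmetricAlgebra.ι k L x) (SymmetricAlgebra.ι k L y) =
      SymmetricAlgebra.ι k L ⁅x, y⁆ :=
  (symDerivExt k L).poissonBracket_j x y

/-! ### Vertex operator algebras -/

/-- A vertex operator algebra over `k`: `prod n u v` is `u₍ₙ₎v`, `wt r` is the space of vectors of
weight `r`, `vac` is the vacuum vector and `conf` is the conformal vector.  The sums in the
Borcherds identity have finitely many nonzero terms by `wt_bounded` and `prod_mem`. -/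
structure VertexOperatorAlgebra (k V : Type*) [Field k] [AddCommGroup V] [Module k V] where
  wt : ℤ → Submodule k V
  isInternal : DirectSum.IsInternal wt
  wt_bounded : ∃ m : ℕ, ∀ r : ℤ, r < -(m : ℤ) → wt r = ⊥
  prod : ℤ → V →ₗ[k] V →ₗ[k] V
  prod_mem : ∀ {r s : ℤ} (n : ℤ) {u v : V}, u ∈ wt r → v ∈ wt s → prod n u v ∈ wt (r + s - n - 1)
  borcherds : ∀ (u v w : V) (p q r : ℤ),
    ∑ᶠ i : ℕ, Ring.choose p i • prod (p + q - i) (prod (r + i) u v) w =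
    ∑ᶠ i : ℕ, ((-1 : ℤ) ^ i * Ring.choose r i) •
      (prod (p + r - i) u (prod (q + i) v w) -
        (r.negOnePow : ℤ) • prod (q + r - i) v (prod (p + i) u w))
  vac : V
  vac_mem : vac ∈ wt 0
  prod_neg_one_vac : ∀ u, prod (-1) u vac = u
  prod_vac : ∀ n : ℤ, 0 ≤ n → ∀ u, prod n u vac = 0
  conf : V
  conf_mem : conf ∈ wt 2
  conf_conf : ∀ n : ℤ, 4 ≤ n ∨ n = 2 → prod n conf conf = 0
  conf_one_conf : prod 1 conf conf = (2 : k) • conf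
  conf_three_conf : ∃ c : k, prod 3 conf conf = c • vac
  mem_wt_iff : ∀ (r : ℤ) (v : V), v ∈ wt r ↔ prod 1 conf v = (r : k) • v
  translation : ∀ u, prod (-2) u vac = prod 0 conf u

namespace VertexOperatorAlgebra

variable {k V : Type*} [Field k] [AddCommGroup V] [Module k V] (X : VertexOperatorAlgebra k V)

theorem iSup_wt : ⨆ r, X.wt r = ⊤ := X.isInternal.submodule_iSup_eq_top

/-- Functions vanishing for large arguments. -/
def eventuallyZero (k V : Type*) [Field k] [AddCommGroup V] [Module k V] :
    Submodule k (ℤ → V) where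
  carrier := {f | ∃ N : ℕ, ∀ n : ℤ, (N : ℤ) ≤ n → f n = 0}
  add_mem' := by
    rintro f g ⟨N, hN⟩ ⟨M, hM⟩
    exact ⟨max N M, fun n hn => by
      rw [Pi.add_apply, hN n (by omega), hM n (by omega), add_zero]⟩
  zero_mem' := ⟨0, fun _ _ => rfl⟩
  smul_mem' := by
    rintro r f ⟨N, hN⟩
    exact ⟨N, fun n hn => by rw [Pi.smul_apply, hN n hn, smul_zero]⟩

theorem trunc (u v : V) : ∃ N : ℕ, ∀ n : ℤ, (N : ℤ) ≤ n → X.prod n u v = 0 := by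
  let B : V →ₗ[k] V →ₗ[k] (ℤ → V) := LinearMap.mk₂ k (fun u v n => X.prod n u v)
    (by intros; ext; simp) (by intros; ext; simp) (by intros; ext; simp) (by intros; ext; simp)
  obtain ⟨m, hm⟩ := X.wt_bounded
  refine bilin_mem_of_iSup X.wt X.wt B (eventuallyZero k V) ?_ u (X.iSup_wt ▸ Submodule.mem_top)
    v (X.iSup_wt ▸ Submodule.mem_top)
  intro r s u hu v hv
  refine ⟨(r + s + m).toNat, fun n hn => ?_⟩
  have := X.prod_mem n hu hv
  rw [hm _ (by omega)] at this
  exact (Submodule.mem_bot k).1 this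

/-- The Borcherds identity with explicit finite sums. -/
theorem borcherds_sum (u v w : V) (p q r : ℤ) : ∃ N : ℕ, ∀ M : ℕ, N ≤ M →
    ∑ i ∈ Finset.range M, Ring.choose p i • X.prod (p + q - i) (X.prod (r + i) u v) w =
    ∑ i ∈ Finset.range M, ((-1 : ℤ) ^ i * Ring.choose r i) •
      (X.prod (p + r - i) u (X.prod (q + i) v w) -
        (r.negOnePow : ℤ) • X.prod (q + r - i) v (X.prod (p + i) u w)) := by
  obtain ⟨N₁, h₁⟩ := X.trunc u v
  obtain ⟨N₂, h₂⟩ := X.trunc v w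
  obtain ⟨N₃, h₃⟩ := X.trunc u w
  refine ⟨(N₁ - r).toNat + (N₂ - q).toNat + (N₃ - p).toNat, fun M hM => ?_⟩
  have h := X.borcherds u v w p q r
  rw [finsum_eq_sum_of_support_subset (s := Finset.range M),
    finsum_eq_sum_of_support_subset (s := Finset.range M)] at h
  · exact h
  · intro i hi
    by_contra h'
    simp only [Finset.coe_range, Set.mem_Iio, not_lt] at h'
    apply hi
    change _ • _ = (0 : V)
    rw [h₂ (q + i) (by omega), h₃ (p + i) (by omega)]
    simp
  · intro i hi
    by_contra h'
    simp only [Finset.coe_range, Set.mem_Iio, not_lt] at h'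
    apply hi
    change _ • _ = (0 : V)
    rw [h₁ (r + i) (by omega)]
    simp

theorem sum_choose_zero (M : ℕ) (hM : 1 ≤ M) (f : ℕ → V) :
    ∑ i ∈ Finset.range M, Ring.choose (0 : ℤ) i • f i = f 0 := by
  rw [Finset.sum_eq_single_of_mem 0 (by simp; omega)]
  · simp
  · intro i _ hi
    obtain ⟨j, rfl⟩ := Nat.exists_eq_succ_of_ne_zero hi
    rw [Ring.choose_zero_succ, zero_smul]

/-- The iterate formula. -/
theorem iterate (u v w : V) (q r : ℤ) : ∃ N : ℕ, ∀ M : ℕ, N ≤ M →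
    X.prod q (X.prod r u v) w =
    ∑ i ∈ Finset.range M, ((-1 : ℤ) ^ i * Ring.choose r i) •
      (X.prod (r - i) u (X.prod (q + i) v w) -
        (r.negOnePow : ℤ) • X.prod (q + r - i) v (X.prod i u w)) := by
  obtain ⟨N, hN⟩ := X.borcherds_sum u v w 0 q r
  refine ⟨max N 1, fun M hM => ?_⟩
  have := hN M (by omega)
  rw [sum_choose_zero M (by omega)] at this
  simpa using this

/-- The commutator formula. -/
theorem comm_formula (u v w : V) (p q : ℤ) : ∃ N : ℕ, ∀ M : ℕ, N ≤ M →
    ∑ i ∈ Finset.range M, Ring.choose p i • X.prod (p + q - i) (X.prod i u v) w =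
    X.prod p u (X.prod q v w) - X.prod q v (X.prod p u w) := by
  obtain ⟨N, hN⟩ := X.borcherds_sum u v w p q 0
  refine ⟨max N 1, fun M hM => ?_⟩
  have := hN M (by omega)
  simp only [mul_comm _ (Ring.choose (0 : ℤ) _), mul_smul] at this
  rw [sum_choose_zero M (by omega)] at this
  simpa using this

/-- Skew symmetry. -/
theorem skew_formula (u v : V) (r : ℤ) : ∃ N : ℕ, ∀ M : ℕ, N ≤ M →
    X.prod r v u = - ((r.negOnePow : ℤ) • ∑ i ∈ Finset.range M,
      (-1 : ℤ) ^ i • X.prod (-1 - i) (X.prod (r + i) u v) X.vac) := by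
  obtain ⟨N, hN⟩ := X.borcherds_sum u v X.vac (-1) 0 r
  refine ⟨max N 1, fun M hM => ?_⟩
  have h := hN M (by omega)
  rw [Finset.sum_congr rfl (g := fun i : ℕ => (-1 : ℤ) ^ i •
    X.prod (-1 - i) (X.prod (r + i) u v) X.vac)] at h
  · rw [h, Finset.sum_eq_single_of_mem 0 (by simp; omega)]
    · have : (r.negOnePow : ℤ) * (r.negOnePow : ℤ) = 1 := by
        rw [← Units.val_mul, ← Int.negOnePow_add, Int.negOnePow_even _ ⟨r, rfl⟩, Units.val_one]
      simp [X.prod_vac, X.prod_neg_one_vac, smul_smul, this]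
    · intro i _ hi
      rw [X.prod_vac _ (by omega), X.prod_vac (-1 + i) (by omega)]
      simp
  · intro i _
    have h1 : Ring.choose (-1 : ℤ) i = (-1 : ℤ) ^ i := by
      rw [Ring.choose_neg]
      have : (1 : ℤ) + i - 1 = ((i : ℕ) : ℤ) := by ring
      rw [this, Ring.choose_natCast]
      simp [Int.coe_negOnePow_natCast, Units.smul_def]
    rw [h1, add_zero]

theorem vac_neg_one (u : V) : X.prod (-1) X.vac u = u := by
  obtain ⟨N, hN⟩ := X.skew_formula u X.vac (-1)
  have h := hN (max N 1) (by omega)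
  rw [Finset.sum_eq_single_of_mem 0 (by simp)] at h
  · simpa [X.prod_neg_one_vac] using h
  · intro i _ hi
    rw [X.prod_vac (-1 + i) (by omega)]
    simp

theorem vac_nonneg (n : ℤ) (hn : 0 ≤ n) (u : V) : X.prod n X.vac u = 0 := by
  obtain ⟨N, hN⟩ := X.skew_formula u X.vac n
  rw [hN N le_rfl, Finset.sum_eq_zero, smul_zero, neg_zero]
  intro i _
  rw [X.prod_vac (n + i) (by omega)]
  simp

theorem vac_two_vac : X.prod (-2) X.vac X.vac = 0 := by
  obtain ⟨N, hN⟩ := X.iterate X.vac X.vac X.vac (-2) (-1)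
  have h := hN (max N 2) (by omega)
  have h1 : ∀ i : ℕ, Ring.choose (-1 : ℤ) i = (-1 : ℤ) ^ i := fun i => by
    rw [Ring.choose_neg]
    have : (1 : ℤ) + i - 1 = ((i : ℕ) : ℤ) := by ring
    rw [this, Ring.choose_natCast]
    simp [Int.coe_negOnePow_natCast, Units.smul_def]
  obtain ⟨L, hL⟩ := Nat.exists_eq_add_of_le (le_max_right N 2)
  rw [hL, Finset.sum_range_add] at h
  rw [Finset.sum_eq_zero (s := Finset.range L)] at h
  · simp [Finset.sum_range_succ, X.vac_neg_one, X.vac_nonneg] at h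
    exact h
  · intro i _
    rw [X.vac_nonneg (-2 + (2 + i : ℕ)) (by push_cast; omega), X.vac_nonneg (2 + i : ℕ) (by omega)]
    simp

/-- `D(u₍ᵣ₎1) = -r u₍ᵣ₋₁₎1`. -/
theorem D_prod_vac (u : V) (r : ℤ) :
    X.prod (-2) (X.prod r u X.vac) X.vac = (-r) • X.prod (r - 1) u X.vac := by
  obtain ⟨N, hN⟩ := X.iterate u X.vac X.vac (-2) r
  rw [hN (max N 2) (by omega), Finset.sum_eq_single_of_mem 1 (by simp)]
  · simp [X.prod_vac, X.vac_neg_one]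
  · intro i _ hi
    rw [X.prod_vac i (by omega)]
    rcases Nat.lt_or_ge i 2 with h | h
    · have : i = 0 := by omega
      subst this
      simp [X.vac_two_vac]
    · rw [X.vac_nonneg (-2 + i) (by omega)]
      simp

theorem vac_vac [CharZero k] (i : ℕ) : X.prod (-2 - i) X.vac X.vac = 0 := by
  induction i with
  | zero => simpa using X.vac_two_vac
  | succ i ih =>
    have h := X.D_prod_vac X.vac (-2 - i)
    rw [ih, map_zero, LinearMap.zero_apply] at h
    have h2 : ((i : k) + 2) • X.prod (-2 - (i + 1 : ℕ)) X.vac X.vac = 0 := by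
      rw [← Int.cast_smul_eq_zsmul k] at h
      push_cast at h ⊢
      rw [show (-2 - (i + 1) : ℤ) = -2 - i - 1 by ring, show (i : k) + 2 = -(-2 - i) by ring]
      exact h.symm
    refine (smul_eq_zero.1 h2).resolve_left ?_
    exact_mod_cast (by omega : i + 2 ≠ 0)

theorem vac_prod [CharZero k] (n : ℤ) (hn : n ≠ -1) (u : V) : X.prod n X.vac u = 0 := by
  rcases le_or_gt 0 n with h | h
  · exact X.vac_nonneg n h u
  · obtain ⟨N, hN⟩ := X.comm_formula X.vac u X.vac n (-1)
    have h1 := hN N le_rfl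
    rw [Finset.sum_eq_zero] at h1
    · rw [X.prod_neg_one_vac] at h1
      have h2 : X.prod n X.vac X.vac = 0 := by
        have := X.vac_vac (-2 - n).toNat
        rwa [show -2 - (((-2 - n).toNat : ℕ) : ℤ) = n by omega] at this
      rw [h2, map_zero, sub_zero] at h1
      exact h1.symm
    · intro i _
      rw [X.vac_nonneg i (by omega)]
      simp

/-- `(Du)₍ₙ₎ = -n u₍ₙ₋₁₎` for `n ≥ 0`. -/
theorem D_prod [CharZero k] (u w : V) (n : ℕ) :
    X.prod n (X.prod (-2) u X.vac) w = (-n : ℤ) • X.prod (n - 1) u w := by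
  obtain ⟨N, hN⟩ := X.iterate u X.vac w n (-2)
  rw [hN (max N (n + 1)) (by omega)]
  rcases Nat.eq_zero_or_pos n with h | h
  · subst h
    rw [Finset.sum_eq_zero]
    · simp
    · intro i _
      rw [X.vac_prod (_ + i) (by omega), X.vac_prod _ (by omega)]
      simp
  · rw [Finset.sum_eq_single_of_mem (n - 1) (by simp)]
    · rw [X.vac_prod (_ + _) (by omega),
        show (n : ℤ) + -2 - (n - 1 : ℕ) = -1 by omega, X.vac_neg_one,
        show ((n - 1 : ℕ) : ℤ) = (n : ℤ) - 1 by omega]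
      have h1 : Ring.choose (-2 : ℤ) (n - 1) = (-1 : ℤ) ^ (n - 1) * n := by
        rw [Ring.choose_neg]
        have : (2 : ℤ) + (n - 1 : ℕ) - 1 = ((n : ℕ) : ℤ) := by omega
        rw [this, Ring.choose_natCast, Nat.choose_symm_of_eq_add (b := 1) (by omega)]
        simp [Int.coe_negOnePow_natCast, Units.smul_def]
      rw [h1, ← mul_assoc, ← mul_pow]
      simp [Int.negOnePow_even (-2) (by decide)]
    · intro i _ hi
      rw [X.vac_prod (_ + i) (by omega), X.vac_prod _ (by omega)]
      simp

end VertexOperatorAlgebra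

/-! ### Zhu's Poisson algebra -/

/-- A commutative Poisson algebra `P = ⨁ P[r]` with `P[r] · P[s] ⊆ P[r+s]` and
`{P[r], P[s]} ⊆ P[r+s-1]`. -/
structure GradedPoissonAlgebra (k P : Type*) [Field k] [CommRing P] [Algebra k P] extends
    PoissonBracket k P where
  wt : ℤ → Submodule k P
  isInternal : DirectSum.IsInternal wt
  one_mem : (1 : P) ∈ wt 0
  mul_mem : ∀ {r s : ℤ} {x y : P}, x ∈ wt r → y ∈ wt s → x * y ∈ wt (r + s)
  br_mem : ∀ {r s : ℤ} {x y : P}, x ∈ wt r → y ∈ wt s → br x y ∈ wt (r + s - 1)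

/-- The image of a grading in the quotient by a homogeneous subspace is a grading. -/
theorem isInternal_map_mkQ {k V : Type*} [Field k] [AddCommGroup V] [Module k V]
    (F : ℤ → Submodule k V) (hF : DirectSum.IsInternal F) (C : Submodule k V)
    (hC : C ≤ ⨆ r, C ⊓ F r) : DirectSum.IsInternal fun r => (F r).map C.mkQ := by
  rw [DirectSum.isInternal_submodule_iff_iSupIndep_and_iSup_eq_top]
  have htop := hF.submodule_iSup_eq_top
  have hind := hF.submodule_iSupIndep
  refine ⟨?_, by rw [← Submodule.map_iSup, htop, Submodule.map_top, Submodule.range_mkQ]⟩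
  rw [iSupIndep_def]
  intro r
  rw [Submodule.disjoint_def]
  rintro _ ⟨v, hv, rfl⟩ hx
  have e : (⨆ (j : ℤ) (_ : j ≠ r), (F j).map C.mkQ) = (⨆ (j : ℤ) (_ : j ≠ r), F j).map C.mkQ := by
    simp_rw [Submodule.map_iSup]
  rw [e] at hx
  obtain ⟨w, hw, hwv⟩ := hx
  have hd : w - v ∈ C := (Submodule.Quotient.eq C).1 hwv
  have h2 : C ≤ (C ⊓ F r) ⊔ ⨆ (j : ℤ) (_ : j ≠ r), C ⊓ F j := by
    refine hC.trans (iSup_le fun j => ?_)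
    by_cases h : j = r
    · subst h; exact le_sup_left
    · exact le_sup_of_le_right (le_iSup₂_of_le (f := fun j (_ : j ≠ r) => C ⊓ F j) j h le_rfl)
  obtain ⟨a, ha, b, hb, hab⟩ := Submodule.mem_sup.1 (h2 hd)
  have hb' : b ∈ ⨆ (j : ℤ) (_ : j ≠ r), F j :=
    (iSup₂_mono fun j _ => inf_le_right : (⨆ (j : ℤ) (_ : j ≠ r), C ⊓ F j) ≤ _) hb
  have h0 := (Submodule.disjoint_def.1 (hind r)) (v + a) (add_mem hv ha.2) (by
    have : v + a = w - b := by
      rw [eq_sub_iff_add_eq, add_assoc, hab]; abel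
    rw [this]
    exact sub_mem hw hb')
  have : v = -a := eq_neg_of_add_eq_zero_left h0
  change C.mkQ v = 0
  rw [this, Submodule.mkQ_apply, Submodule.Quotient.mk_eq_zero]
  exact neg_mem ha.1

namespace VertexOperatorAlgebra

variable {k V : Type*} [Field k] [AddCommGroup V] [Module k V] (X : VertexOperatorAlgebra k V)

/-- The span `C₂(V)` of the elements `u₍ₙ₎v` with `n ≤ -2`. -/
def C2 : Submodule k V :=
  Submodule.span k {w | ∃ n : ℤ, n ≤ -2 ∧ ∃ u v : V, w = X.prod n u v}

variable {X} in
theorem prod_mem_C2 {n : ℤ} (hn : n ≤ -2) (u v : V) : X.prod n u v ∈ X.C2 :=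
  Submodule.subset_span ⟨n, hn, u, v, rfl⟩

theorem C2_le : X.C2 ≤ ⨆ r, X.C2 ⊓ X.wt r := by
  refine Submodule.span_le.2 ?_
  rintro _ ⟨n, hn, u, v, rfl⟩
  refine bilin_mem_of_iSup X.wt X.wt (X.prod n) _ ?_ u (X.iSup_wt ▸ Submodule.mem_top)
    v (X.iSup_wt ▸ Submodule.mem_top)
  intro r s a ha b hb
  exact le_iSup (fun r => X.C2 ⊓ X.wt r) (r + s - n - 1)
    ⟨prod_mem_C2 hn a b, X.prod_mem n ha hb⟩

theorem skew_mod (u v : V) : X.prod (-1) v u - X.prod (-1) u v ∈ X.C2 := by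
  obtain ⟨N, hN⟩ := X.skew_formula u v (-1)
  rw [hN (N + 1) (by omega), Finset.sum_range_succ']
  simp only [Int.negOnePow_neg, Int.negOnePow_one, Units.val_neg, Units.val_one, neg_smul,
    one_smul, neg_neg, Nat.cast_zero, sub_zero, add_zero, pow_zero, X.prod_neg_one_vac]
  rw [add_sub_cancel_right]
  exact Submodule.sum_mem _ fun i _ => zsmul_mem (prod_mem_C2 (by push_cast; omega) _ _) _

theorem skew_mod_zero (u v : V) : X.prod 0 v u + X.prod 0 u v ∈ X.C2 := by
  obtain ⟨N, hN⟩ := X.skew_formula u v 0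
  rw [hN (N + 1) (by omega), Finset.sum_range_succ']
  simp only [Int.negOnePow_zero, Units.val_one, one_smul, Nat.cast_zero, sub_zero, add_zero,
    pow_zero, X.prod_neg_one_vac, neg_add]
  rw [neg_add_cancel_right]
  exact neg_mem (Submodule.sum_mem _ fun i _ =>
    zsmul_mem (prod_mem_C2 (by push_cast; omega) _ _) _)

theorem C2_prod (q : ℤ) (hq : q ≤ 0) {a : V} (ha : a ∈ X.C2) (w : V) : X.prod q a w ∈ X.C2 := by
  have : X.C2 ≤ X.C2.comap ((X.prod q).flip w) := by
    refine Submodule.span_le.2 ?_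
    rintro _ ⟨n, hn, u, v, rfl⟩
    obtain ⟨N, hN⟩ := X.iterate u v w q n
    change X.prod q (X.prod n u v) w ∈ X.C2
    rw [hN N le_rfl]
    exact Submodule.sum_mem _ fun i _ => zsmul_mem (sub_mem (prod_mem_C2 (by omega) _ _)
      (zsmul_mem (prod_mem_C2 (by omega) _ _) _)) _
  exact this ha

theorem prod_C2 {a : V} (ha : a ∈ X.C2) (w : V) : X.prod (-1) w a ∈ X.C2 := by
  have := add_mem (X.skew_mod a w) (X.C2_prod (-1) (by omega) ha w)
  rwa [sub_add_cancel] at this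

theorem prod_zero_C2 {a : V} (ha : a ∈ X.C2) (w : V) : X.prod 0 w a ∈ X.C2 := by
  have := sub_mem (X.skew_mod_zero a w) (X.C2_prod 0 le_rfl ha w)
  rwa [add_sub_cancel_right] at this

theorem assoc_mod (u v w : V) :
    X.prod (-1) (X.prod (-1) u v) w - X.prod (-1) u (X.prod (-1) v w) ∈ X.C2 := by
  obtain ⟨N, hN⟩ := X.iterate u v w (-1) (-1)
  rw [hN (N + 1) (by omega), Finset.sum_range_succ']
  simp only [pow_zero, Ring.choose_zero_right, mul_one, one_smul, Nat.cast_zero, sub_zero,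
    add_zero]
  rw [add_sub_assoc, sub_sub_cancel_left]
  refine add_mem (Submodule.sum_mem _ fun i _ => zsmul_mem (sub_mem
    (prod_mem_C2 (by push_cast; omega) _ _) (zsmul_mem (prod_mem_C2 (by push_cast; omega) _ _) _))
    _) (neg_mem (zsmul_mem (prod_mem_C2 (by omega) _ _) _))

theorem comm_zero (u v w : V) (q : ℤ) :
    X.prod 0 u (X.prod q v w) = X.prod q (X.prod 0 u v) w + X.prod q v (X.prod 0 u w) := by
  obtain ⟨N, hN⟩ := X.comm_formula u v w 0 q
  have h := hN (max N 1) (by omega)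
  rw [sum_choose_zero _ (by omega)] at h
  simp only [Nat.cast_zero, zero_add, sub_zero] at h
  rw [h, sub_add_cancel]

/-- The bilinear operation on `V / C₂(V)` induced by a product. -/
def quotProd (q : ℤ) (h₁ : ∀ a ∈ X.C2, ∀ w, X.prod q a w ∈ X.C2)
    (h₂ : ∀ a ∈ X.C2, ∀ w, X.prod q w a ∈ X.C2) :
    (V ⧸ X.C2) →ₗ[k] (V ⧸ X.C2) →ₗ[k] (V ⧸ X.C2) :=
  X.C2.liftQ
    { toFun := fun u => X.C2.liftQ (X.C2.mkQ ∘ₗ X.prod q u) (fun a ha => by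
        simpa using h₂ a ha u)
      map_add' := fun u v => by
        ext w; simp
      map_smul' := fun r u => by
        ext w; simp }
    (fun a ha => by
      rw [LinearMap.mem_ker]
      ext w
      simpa using h₁ a ha w)

theorem quotProd_mk (q : ℤ) (h₁ : ∀ a ∈ X.C2, ∀ w, X.prod q a w ∈ X.C2)
    (h₂ : ∀ a ∈ X.C2, ∀ w, X.prod q w a ∈ X.C2) (u v : V) :
    X.quotProd q h₁ h₂ (X.C2.mkQ u) (X.C2.mkQ v) = X.C2.mkQ (X.prod q u v) := rfl

/-- The space `V / C₂(V)`. -/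
def Zhu : Type _ := V ⧸ X.C2

namespace Zhu

instance : AddCommGroup X.Zhu := inferInstanceAs (AddCommGroup (V ⧸ X.C2))

instance : Module k X.Zhu := inferInstanceAs (Module k (V ⧸ X.C2))

/-- The class of a vector. -/
def mk : V →ₗ[k] X.Zhu := X.C2.mkQ

theorem mk_surjective : Function.Surjective (mk X) := Submodule.mkQ_surjective _

variable {X} in
theorem mk_eq {u v : V} (h : u - v ∈ X.C2) : mk X u = mk X v :=
  (Submodule.Quotient.eq _).2 h

/-- The product `u · v = u₍₋₁₎v`. -/
def mulHom : X.Zhu →ₗ[k] X.Zhu →ₗ[k] X.Zhu :=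
  X.quotProd (-1) (fun _ ha w => X.C2_prod (-1) (by omega) ha w) (fun _ ha w => X.prod_C2 ha w)

/-- The bracket `{u, v} = u₍₀₎v`. -/
def brHom : X.Zhu →ₗ[k] X.Zhu →ₗ[k] X.Zhu :=
  X.quotProd 0 (fun _ ha w => X.C2_prod 0 le_rfl ha w) (fun _ ha w => X.prod_zero_C2 ha w)

theorem mulHom_mk (u v : V) : mulHom X (mk X u) (mk X v) = mk X (X.prod (-1) u v) := rfl

theorem brHom_mk (u v : V) : brHom X (mk X u) (mk X v) = mk X (X.prod 0 u v) := rfl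

instance : CommRing X.Zhu where
  __ := (inferInstance : AddCommGroup X.Zhu)
  mul x y := mulHom X x y
  one := mk X X.vac
  left_distrib x y z := map_add (mulHom X x) y z
  right_distrib x y z := by
    change mulHom X (x + y) z = mulHom X x z + mulHom X y z
    rw [map_add, LinearMap.add_apply]
  zero_mul x := by
    change mulHom X 0 x = 0
    rw [map_zero, LinearMap.zero_apply]
  mul_zero x := map_zero (mulHom X x)
  one_mul x := by
    obtain ⟨u, rfl⟩ := mk_surjective X x
    change mulHom X (mk X X.vac) (mk X u) = mk X u
    rw [mulHom_mk, X.vac_neg_one]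
  mul_one x := by
    obtain ⟨u, rfl⟩ := mk_surjective X x
    change mulHom X (mk X u) (mk X X.vac) = mk X u
    rw [mulHom_mk, X.prod_neg_one_vac]
  mul_assoc x y z := by
    obtain ⟨u, rfl⟩ := mk_surjective X x
    obtain ⟨v, rfl⟩ := mk_surjective X y
    obtain ⟨w, rfl⟩ := mk_surjective X z
    exact mk_eq (X.assoc_mod u v w)
  mul_comm x y := by
    obtain ⟨u, rfl⟩ := mk_surjective X x
    obtain ⟨v, rfl⟩ := mk_surjective X y
    exact mk_eq (X.skew_mod v u)

theorem mk_mul (u v : V) : mk X u * mk X v = mk X (X.prod (-1) u v) := rfl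

theorem one_def : (1 : X.Zhu) = mk X X.vac := rfl

instance : Algebra k X.Zhu := Algebra.ofModule
  (fun r x y => by
    change mulHom X (r • x) y = r • mulHom X x y
    rw [map_smul, LinearMap.smul_apply])
  (fun r x y => map_smul (mulHom X x) r y)

end Zhu

/-- Zhu's Poisson algebra `V / C₂(V)`, graded by the images of the weight spaces of `V`. -/
def zhu [CharZero k] : GradedPoissonAlgebra k X.Zhu where
  br := Zhu.brHom X
  br_self x := by
    obtain ⟨u, rfl⟩ := Zhu.mk_surjective X x
    rw [Zhu.brHom_mk]
    have h := X.skew_mod_zero u u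
    rw [← two_smul k] at h
    have h2 := Submodule.smul_mem X.C2 (2⁻¹ : k) h
    rw [smul_smul, inv_mul_cancel₀ two_ne_zero, one_smul] at h2
    exact (Submodule.Quotient.mk_eq_zero _).2 h2
  jacobi x y z := by
    obtain ⟨u, rfl⟩ := Zhu.mk_surjective X x
    obtain ⟨v, rfl⟩ := Zhu.mk_surjective X y
    obtain ⟨w, rfl⟩ := Zhu.mk_surjective X z
    simp only [Zhu.brHom_mk, X.comm_zero u v w 0, map_add]
  leibniz x y z := by
    obtain ⟨u, rfl⟩ := Zhu.mk_surjective X x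
    obtain ⟨v, rfl⟩ := Zhu.mk_surjective X y
    obtain ⟨w, rfl⟩ := Zhu.mk_surjective X z
    simp only [Zhu.brHom_mk, Zhu.mk_mul, X.comm_zero u v w (-1), map_add]
  wt r := (X.wt r).map (Zhu.mk X)
  isInternal := isInternal_map_mkQ X.wt X.isInternal X.C2 X.C2_le
  one_mem := ⟨X.vac, X.vac_mem, rfl⟩
  mul_mem := by
    rintro r s _ _ ⟨u, hu, rfl⟩ ⟨v, hv, rfl⟩
    have := X.prod_mem (-1) hu hv
    rw [show r + s - (-1) - 1 = r + s by ring] at this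
    exact ⟨_, this, rfl⟩
  br_mem := by
    rintro r s _ _ ⟨u, hu, rfl⟩ ⟨v, hv, rfl⟩
    have := X.prod_mem 0 hu hv
    rw [sub_zero] at this
    exact ⟨_, this, rfl⟩

end VertexOperatorAlgebra

/-! ### The current Lie algebra -/

/-- A double sum over a rectangle rearranged by Vandermonde's identity. -/
theorem sum_choose_add {M : Type*} [AddCommGroup M] (a b : ℤ) (x : ℕ → M) (N P Q : ℕ)
    (hP : N ≤ P) (hQ : N ≤ Q) (hx : ∀ s, N ≤ s → x s = 0) :
    ∑ i ∈ Finset.range P, ∑ j ∈ Finset.range Q, (Ring.choose a i * Ring.choose b j) • x (i + j) =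
    ∑ s ∈ Finset.range N, Ring.choose (a + b) s • x s := by
  rw [← Finset.sum_product']
  have h : ∀ y ∈ Finset.range P ×ˢ Finset.range Q,
      y.1 + y.2 ∈ Finset.range (P + Q) := by
    intro y hy
    simp only [Finset.mem_product, Finset.mem_range] at hy ⊢
    omega
  rw [← Finset.sum_fiberwise_of_maps_to h]
  have h2 : Finset.range N ⊆ Finset.range (P + Q) := fun s hs => by
    simp only [Finset.mem_range] at hs ⊢; omega
  rw [← Finset.sum_subset h2 (fun s _ hs => ?_)]
  · refine Finset.sum_congr rfl fun s hs => ?_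
    simp only [Finset.mem_range] at hs
    rw [Ring.add_choose_eq s (Commute.all a b), Finset.sum_smul]
    have e : (Finset.range P ×ˢ Finset.range Q).filter (fun y => y.1 + y.2 = s) =
        Finset.HasAntidiagonal.antidiagonal s := by
      ext y
      simp only [Finset.mem_filter, Finset.mem_product, Finset.mem_range, Finset.HasAntidiagonal.mem_antidiagonal]
      omega
    rw [e]
    refine Finset.sum_congr rfl fun y hy => ?_
    rw [Finset.HasAntidiagonal.mem_antidiagonal.1 hy]
  · simp only [Finset.mem_range, not_lt] at hs
    refine Finset.sum_eq_zero fun y hy => ?_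
    rw [(Finset.mem_filter.1 hy).2, hx s hs, smul_zero]

theorem choose_neg_one_pow (r : ℤ) (n : ℕ) :
    Ring.choose (-r) n = (-1) ^ n * Ring.choose (r + n - 1) n := by
  rw [Ring.choose_neg, Units.smul_def, Int.coe_negOnePow_natCast, smul_eq_mul]

theorem succ_mul_choose (a : ℤ) (i : ℕ) :
    ((i : ℤ) + 1) * Ring.choose a (i + 1) = a * Ring.choose (a - 1) i := by
  have := Ring.choose_smul_choose a (show 1 ≤ i + 1 by omega)
  simpa using this

/-- The alternating Vandermonde identity. -/
theorem sum_antidiagonal_choose (m n : ℤ) (s : ℕ) :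
    ∑ y ∈ Finset.HasAntidiagonal.antidiagonal s, (-1) ^ y.1 * Ring.choose n y.1 * Ring.choose (m + n - y.1) y.2 =
    Ring.choose m s := by
  have h : ∀ y ∈ Finset.HasAntidiagonal.antidiagonal s,
      (-1) ^ y.1 * Ring.choose n y.1 * Ring.choose (m + n - y.1) y.2 =
      (-1) ^ s * (Ring.choose n y.1 * Ring.choose (s - 1 - m - n) y.2) := by
    intro y hy
    have hs := Finset.HasAntidiagonal.mem_antidiagonal.1 hy
    have e : (m + n - y.1 : ℤ) = -(y.1 - m - n) := by ring
    rw [e, choose_neg_one_pow, show ((y.1 : ℤ) - m - n + y.2 - 1) = s - 1 - m - n by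
      rw [← hs]; push_cast; ring, ← hs, pow_add]
    ring
  rw [Finset.sum_congr rfl h, ← Finset.mul_sum, ← Ring.add_choose_eq s (Commute.all _ _)]
  have := choose_neg_one_pow (-m) s
  rw [neg_neg] at this
  rw [this]
  congr 2
  ring

namespace VertexOperatorAlgebra

variable {k V : Type*} [Field k] [AddCommGroup V] [Module k V] (X : VertexOperatorAlgebra k V)

theorem trunc_trunc_right (a b c : V) : ∃ N : ℕ, ∀ (i : ℤ) (j : ℕ), (N : ℤ) ≤ i →
    X.prod i a (X.prod j b c) = 0 := by
  obtain ⟨N, hN⟩ := X.trunc b c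
  choose f hf using fun j : ℕ => X.trunc a (X.prod j b c)
  refine ⟨∑ j ∈ Finset.range N, f j, fun i j hi => ?_⟩
  by_cases h : j < N
  · have := Finset.single_le_sum (f := f) (fun _ _ => Nat.zero_le _) (Finset.mem_range.2 h)
    exact hf j i (by omega)
  · rw [hN j (by omega), map_zero]

theorem trunc_trunc_left (a b c : V) : ∃ N : ℕ, ∀ (i : ℤ) (j : ℕ), (N : ℤ) ≤ i →
    X.prod i (X.prod j a b) c = 0 := by
  obtain ⟨N, hN⟩ := X.trunc a b
  choose f hf using fun j : ℕ => X.trunc (X.prod j a b) c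
  refine ⟨∑ j ∈ Finset.range N, f j, fun i j hi => ?_⟩
  by_cases h : j < N
  · have := Finset.single_le_sum (f := f) (fun _ _ => Nat.zero_le _) (Finset.mem_range.2 h)
    exact hf j i (by omega)
  · rw [hN j (by omega), map_zero, LinearMap.zero_apply]

/-- The products `u₍ᵢ₎v`, `i = 0, 1, 2, …`. -/
noncomputable def modes : V →ₗ[k] V →ₗ[k] (ℕ →₀ V) :=
  LinearMap.mk₂ k (fun u v => Finsupp.ofSupportFinite (fun i : ℕ => X.prod i u v) (by
      obtain ⟨N, hN⟩ := X.trunc u v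
      refine (Finset.range N).finite_toSet.subset fun i hi => ?_
      by_contra h
      simp only [Finset.coe_range, Set.mem_Iio, not_lt] at h
      exact hi (hN i (by omega))))
    (fun a b c => Finsupp.ext fun i => by
      change X.prod i (a + b) c = X.prod i a c + X.prod i b c
      rw [map_add, LinearMap.add_apply])
    (fun r a b => Finsupp.ext fun i => by
      change X.prod i (r • a) b = r • X.prod i a b
      rw [map_smul, LinearMap.smul_apply])
    (fun a b c => Finsupp.ext fun i => map_add (X.prod i a) b c)
    (fun r a b => Finsupp.ext fun i => map_smul (X.prod i a) r b)

theorem modes_apply (u v : V) (i : ℕ) : X.modes u v i = X.prod i u v := rfl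

/-- The bracket `[u ⊗ tᵐ, v ⊗ tⁿ] = ∑ᵢ binom(m, i) (u₍ᵢ₎v) ⊗ tᵐ⁺ⁿ⁻ⁱ` on the space `V[t, t⁻¹]`,
realised as `ℤ →₀ V`. -/
noncomputable def loopBracket : (ℤ →₀ V) →ₗ[k] (ℤ →₀ V) →ₗ[k] (ℤ →₀ V) :=
  Finsupp.lsum k fun m => LinearMap.flip <| Finsupp.lsum k fun n => LinearMap.flip <|
    X.modes.compr₂ <| Finsupp.lsum k fun i : ℕ => Ring.choose m i • Finsupp.lsingle (m + n - i)

/-- The map `∂(u ⊗ tⁿ) = Du ⊗ tⁿ + n u ⊗ tⁿ⁻¹`, where `Du = u₍₋₂₎1`. -/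
noncomputable def del : (ℤ →₀ V) →ₗ[k] (ℤ →₀ V) :=
  Finsupp.lsum k fun n =>
    Finsupp.lsingle n ∘ₗ (X.prod (-2)).flip X.vac + n • Finsupp.lsingle (n - 1)

theorem loopBracket_single (u v : V) (m n : ℤ) (N : ℕ)
    (hN : ∀ i : ℕ, N ≤ i → X.prod i u v = 0) :
    X.loopBracket (Finsupp.single m u) (Finsupp.single n v) = ∑ i ∈ Finset.range N,
      Ring.choose m i • Finsupp.single (m + n - i) (X.prod i u v) := by
  have : X.loopBracket (Finsupp.single m u) (Finsupp.single n v) =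
      (X.modes u v).sum fun i w => Ring.choose m i • Finsupp.single (m + n - i) w := by
    simp [loopBracket, -Finsupp.smul_single]
    rfl
  rw [this]
  refine Finsupp.sum_of_support_subset _ (fun i hi => ?_) _ (by simp)
  by_contra h
  simp only [Finset.mem_range, not_lt] at h
  exact Finsupp.mem_support_iff.1 hi (hN i h)

theorem del_single (n : ℤ) (u : V) : X.del (Finsupp.single n u) =
    Finsupp.single n (X.prod (-2) u X.vac) + n • Finsupp.single (n - 1) u := by
  simp [del]

/-- `w₍₋₁₋ᵢ₎1 ⊗ tᵃ ≡ (-1)ⁱ binom(a, i) w ⊗ tᵃ⁻ⁱ`. -/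
theorem single_prod_vac [CharZero k] (w : V) (a : ℤ) (i : ℕ) :
    Finsupp.single a (X.prod (-1 - i) w X.vac) -
      ((-1) ^ i * Ring.choose a i) • Finsupp.single (a - i) w ∈ LinearMap.range X.del := by
  induction i generalizing a with
  | zero => simp [X.prod_neg_one_vac]
  | succ i ih =>
    have h1 : X.del (Finsupp.single a (X.prod (-1 - i) w X.vac)) ∈ LinearMap.range X.del := ⟨_, rfl⟩
    rw [X.del_single, X.D_prod_vac] at h1
    have h2 := sub_mem h1 (zsmul_mem (ih (a - 1)) a)
    have h3 : (((i : k) + 1)⁻¹) • (((i : k) + 1) •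
        (Finsupp.single a (X.prod (-1 - (i + 1 : ℕ)) w X.vac) -
        ((-1) ^ (i + 1) * Ring.choose a (i + 1)) • Finsupp.single (a - (i + 1 : ℕ)) w)) ∈
        LinearMap.range X.del := by
      refine Submodule.smul_mem _ _ ?_
      convert h2 using 1
      have e : ((i : k) + 1) = (((i : ℤ) + 1 : ℤ) : k) := by push_cast; rfl
      rw [e, Int.cast_smul_eq_zsmul, smul_sub, smul_sub, smul_smul, smul_smul,
        show ((i : ℤ) + 1) * ((-1) ^ (i + 1) * Ring.choose a (i + 1)) =
          -(a * ((-1) ^ i * Ring.choose (a - 1) i)) by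
        rw [mul_left_comm, succ_mul_choose]; ring]
      rw [show a - ((i + 1 : ℕ) : ℤ) = a - 1 - i by push_cast; ring,
        show (-1 - ((i + 1 : ℕ) : ℤ)) = -1 - i - 1 by push_cast; ring]
      rw [show (-(-1 - i : ℤ)) = (i : ℤ) + 1 by ring, neg_smul, ← Finsupp.smul_single]
      abel
    rwa [smul_smul, inv_mul_cancel₀ (by exact_mod_cast Nat.succ_ne_zero i), one_smul] at h3

theorem loopBracket_skew [CharZero k] (x y : ℤ →₀ V) :
    X.loopBracket x y + X.loopBracket y x ∈ LinearMap.range X.del := by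
  induction x using Finsupp.induction_linear with
  | zero => simp
  | add x x' hx hx' =>
    rw [map_add, map_add, LinearMap.add_apply, add_add_add_comm]
    exact add_mem hx hx'
  | single m u =>
    induction y using Finsupp.induction_linear with
    | zero => simp
    | add x x' hx hx' =>
      rw [map_add, map_add, LinearMap.add_apply, add_add_add_comm]
      exact add_mem hx hx'
    | single n v =>
      obtain ⟨N₁, h₁⟩ := X.trunc u v
      obtain ⟨N₂, h₂⟩ := X.trunc v u
      have hs : ∀ j : ℕ, ∃ N : ℕ, ∀ M : ℕ, N ≤ M →
          X.prod j v u = - (((-1 : ℤ) ^ j) • ∑ i ∈ Finset.range M,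
          (-1 : ℤ) ^ i • X.prod (-1 - i) (X.prod (j + i) u v) X.vac) := by
        intro j
        obtain ⟨N, hN⟩ := X.skew_formula u v j
        exact ⟨N, fun M hM => by rw [hN M hM, Int.coe_negOnePow_natCast]⟩
      choose S hS using hs
      obtain ⟨M, hM⟩ : ∃ M, ∀ j, j < N₁ + N₂ → S j ≤ M :=
        ⟨∑ j ∈ Finset.range (N₁ + N₂), S j, fun j hj =>
          Finset.single_le_sum (f := S) (fun _ _ => Nat.zero_le _) (Finset.mem_range.2 hj)⟩
      set K := M + N₁ + N₂ with hK
      rw [X.loopBracket_single u v m n K (fun i hi => h₁ i (by omega)),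
        X.loopBracket_single v u n m (N₁ + N₂) (fun i hi => h₂ i (by omega))]
      -- rewrite the second sum
      set x : ℕ → (ℤ →₀ V) := fun s => Finsupp.single (m + n - s) (X.prod s u v) with hxdef
      have hx0 : ∀ s, K ≤ s → x s = 0 := fun s hs => by
        simp only [hxdef]; rw [h₁ s (by omega), Finsupp.single_zero]
      have key : ∑ j ∈ Finset.range (N₁ + N₂),
          Ring.choose n j • Finsupp.single (n + m - j) (X.prod j v u) +
          ∑ j ∈ Finset.range (N₁ + N₂), ∑ i ∈ Finset.range K,
            ((-1) ^ j * Ring.choose n j * Ring.choose (m + n - j) i) • x (j + i) ∈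
          LinearMap.range X.del := by
        rw [← Finset.sum_add_distrib]
        refine Submodule.sum_mem _ fun j hj => ?_
        have e1 : X.prod j v u = - (((-1 : ℤ) ^ j) • ∑ i ∈ Finset.range K,
          (-1 : ℤ) ^ i • X.prod (-1 - i) (X.prod (j + i) u v) X.vac) :=
          hS j K (by have := hM j (Finset.mem_range.1 hj); omega)
        have e2 : Ring.choose n j • Finsupp.single (n + m - j) (X.prod j v u) =
            - ∑ i ∈ Finset.range K, ((-1) ^ j * Ring.choose n j * (-1) ^ i) •
              Finsupp.single (m + n - j) (X.prod (-1 - i) (X.prod (j + i) u v) X.vac) := by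
          rw [e1, ← Finsupp.lsingle_apply (R := ℤ), map_neg, map_zsmul, map_sum, smul_neg,
            smul_smul, Finset.smul_sum, add_comm n m]
          congr 1
          refine Finset.sum_congr rfl fun i _ => ?_
          rw [map_zsmul, smul_smul, Finsupp.lsingle_apply]
          congr 1
          ring
        rw [e2, neg_add_eq_sub, ← Finset.sum_sub_distrib]
        refine Submodule.sum_mem _ fun i _ => ?_
        have h := zsmul_mem (X.single_prod_vac (X.prod (j + i) u v) (m + n - j) i)
          (-((-1) ^ j * Ring.choose n j * (-1) ^ i))
        convert h using 1
        rw [smul_sub, neg_smul, neg_smul, smul_smul,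
          show (-1) ^ j * Ring.choose n j * (-1) ^ i * ((-1) ^ i * Ring.choose (m + n - ↑j) i) =
          ((-1) ^ i * (-1) ^ i) * ((-1) ^ j * Ring.choose n j * Ring.choose (m + n - ↑j) i) by ring,
          ← mul_pow, neg_one_mul, neg_neg, one_pow, one_mul]
        simp only [hxdef]
        push_cast
        rw [show m + n - ((j : ℤ) + i) = m + n - j - i by ring]
        abel
      have e3 : ∑ j ∈ Finset.range (N₁ + N₂), ∑ i ∈ Finset.range K,
            ((-1) ^ j * Ring.choose n j * Ring.choose (m + n - j) i) • x (j + i) =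
          ∑ s ∈ Finset.range K, Ring.choose m s • x s := by
        have : ∀ j ∈ Finset.range K, j ∉ Finset.range (N₁ + N₂) → ∑ i ∈ Finset.range K,
            ((-1) ^ j * Ring.choose n j * Ring.choose (m + n - j) i) • x (j + i) = 0 := by
          intro j _ hj
          simp only [Finset.mem_range, not_lt] at hj
          refine Finset.sum_eq_zero fun i _ => ?_
          simp only [hxdef]
          rw [h₁ (j + i : ℕ) (by push_cast; omega), Finsupp.single_zero, smul_zero]
        rw [Finset.sum_subset (s₂ := Finset.range K) (fun j hj => by
          simp only [Finset.mem_range] at hj ⊢; omega) this, ← Finset.sum_product']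
        have h : ∀ y ∈ Finset.range K ×ˢ Finset.range K,
            y.1 + y.2 ∈ Finset.range (2 * K) := by
          intro y hy
          simp only [Finset.mem_product, Finset.mem_range] at hy ⊢
          omega
        rw [← Finset.sum_fiberwise_of_maps_to h]
        rw [← Finset.sum_subset (s₁ := Finset.range K) (fun s hs => by
          simp only [Finset.mem_range] at hs ⊢; omega) (fun s _ hs => ?_)]
        · refine Finset.sum_congr rfl fun s hs => ?_
          simp only [Finset.mem_range] at hs
          rw [← sum_antidiagonal_choose m n s, Finset.sum_smul]
          have e : (Finset.range K ×ˢ Finset.range K).filter (fun y => y.1 + y.2 = s) =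
              Finset.HasAntidiagonal.antidiagonal s := by
            ext y
            simp only [Finset.mem_filter, Finset.mem_product, Finset.mem_range,
              Finset.HasAntidiagonal.mem_antidiagonal]
            omega
          rw [e]
          refine Finset.sum_congr rfl fun y hy => ?_
          rw [Finset.HasAntidiagonal.mem_antidiagonal.1 hy]
        · simp only [Finset.mem_range, not_lt] at hs
          refine Finset.sum_eq_zero fun y hy => ?_
          rw [(Finset.mem_filter.1 hy).2, hx0 s hs, smul_zero]
      rw [e3, add_comm] at key
      exact key

theorem loopBracket_del_left [CharZero k] (x y : ℤ →₀ V) : X.loopBracket (X.del x) y = 0 := by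
  induction x using Finsupp.induction_linear with
  | zero => simp
  | add x x' hx hx' => rw [map_add, map_add, LinearMap.add_apply, hx, hx', add_zero]
  | single m u =>
    induction y using Finsupp.induction_linear with
    | zero => simp
    | add x x' hx hx' => rw [map_add, hx, hx', add_zero]
    | single n v =>
      obtain ⟨N, hN⟩ := X.trunc u v
      have hD : ∀ i : ℕ, N + 1 ≤ i → X.prod i (X.prod (-2) u X.vac) v = 0 := fun i hi => by
        rw [X.D_prod, hN _ (by omega), smul_zero]
      rw [X.del_single, map_add, map_zsmul, LinearMap.add_apply, LinearMap.smul_apply,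
        X.loopBracket_single _ v m n (N + 1) hD,
        X.loopBracket_single u v (m - 1) n N (fun i hi => hN i (by omega)),
        Finset.sum_range_succ', Finset.smul_sum, add_assoc, add_comm, add_assoc,
        ← Finset.sum_add_distrib, Finset.sum_eq_zero, add_zero, X.D_prod]
      · simp
      · intro i _
        rw [X.D_prod, show m - 1 + n - i = m + n - (i + 1 : ℕ) by push_cast; ring, smul_smul,
          ← succ_mul_choose, ← Finsupp.lsingle_apply (R := ℤ), ← Finsupp.lsingle_apply (R := ℤ),
          map_zsmul, smul_smul]
        push_cast
        rw [add_sub_cancel_right, ← add_smul]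
        ring_nf
        simp

theorem loopBracket_del_right [CharZero k] (x y : ℤ →₀ V) :
    X.loopBracket x (X.del y) ∈ LinearMap.range X.del := by
  have := X.loopBracket_skew x (X.del y)
  rwa [X.loopBracket_del_left, add_zero] at this

theorem loopBracket_jacobi (x y z : ℤ →₀ V) : X.loopBracket x (X.loopBracket y z) =
    X.loopBracket (X.loopBracket x y) z + X.loopBracket y (X.loopBracket x z) := by
  induction x using Finsupp.induction_linear with
  | zero => simp
  | add x x' hx hx' =>
    simp only [map_add, LinearMap.add_apply, hx, hx']
    abel
  | single m u =>
  induction y using Finsupp.induction_linear with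
  | zero => simp
  | add x x' hx hx' =>
    simp only [map_add, LinearMap.add_apply, hx, hx']
    abel
  | single n v =>
  induction z using Finsupp.induction_linear with
  | zero => simp
  | add x x' hx hx' =>
    simp only [map_add, hx, hx']
    abel
  | single p w =>
  obtain ⟨N, hN⟩ := X.trunc u v
  obtain ⟨N₁, h₁⟩ := X.trunc v w
  obtain ⟨N₂, h₂⟩ := X.trunc u w
  obtain ⟨R, hR⟩ := X.trunc_trunc_left u v w
  obtain ⟨R₁, hR₁⟩ := X.trunc_trunc_right u v w
  obtain ⟨R₂, hR₂⟩ := X.trunc_trunc_right v u w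
  set K := N + R + N₁ + N₂ + R₁ + R₂ with hK
  rw [← sub_eq_iff_eq_add]
  have e1 : X.loopBracket (Finsupp.single m u) (X.loopBracket (Finsupp.single n v)
      (Finsupp.single p w)) = ∑ i ∈ Finset.range K, ∑ j ∈ Finset.range K,
      (Ring.choose m i * Ring.choose n j) •
        Finsupp.single (m + n + p - i - j) (X.prod i u (X.prod j v w)) := by
    rw [X.loopBracket_single v w n p K (fun i hi => h₁ i (by omega)), map_sum, Finset.sum_comm]
    refine Finset.sum_congr rfl fun j _ => ?_
    rw [map_zsmul, X.loopBracket_single _ _ _ _ K (fun i hi => hR₁ i j (by omega)),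
      Finset.smul_sum]
    refine Finset.sum_congr rfl fun i _ => ?_
    rw [smul_smul, mul_comm, show m + (n + p - j) - i = m + n + p - i - j by ring]
  have e2 : X.loopBracket (Finsupp.single n v) (X.loopBracket (Finsupp.single m u)
      (Finsupp.single p w)) = ∑ i ∈ Finset.range K, ∑ j ∈ Finset.range K,
      (Ring.choose m i * Ring.choose n j) •
        Finsupp.single (m + n + p - i - j) (X.prod j v (X.prod i u w)) := by
    rw [X.loopBracket_single u w m p K (fun i hi => h₂ i (by omega)), map_sum]
    refine Finset.sum_congr rfl fun j _ => ?_
    rw [map_zsmul, X.loopBracket_single _ _ _ _ K (fun i hi => hR₂ i j (by omega)),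
      Finset.smul_sum]
    refine Finset.sum_congr rfl fun i _ => ?_
    rw [smul_smul, show n + (m + p - j) - i = m + n + p - j - i by ring]
  have e3 : X.loopBracket (X.loopBracket (Finsupp.single m u) (Finsupp.single n v))
      (Finsupp.single p w) = ∑ l ∈ Finset.range N, ∑ s ∈ Finset.range R,
      Ring.choose m l • Ring.choose (m - l + n) s •
        Finsupp.single (m + n + p - l - s) (X.prod s (X.prod l u v) w) := by
    rw [X.loopBracket_single u v m n N (fun i hi => hN i (by omega)), map_sum,
      LinearMap.sum_apply]
    refine Finset.sum_congr rfl fun l _ => ?_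
    rw [map_zsmul, LinearMap.smul_apply,
      X.loopBracket_single _ _ _ _ R (fun i hi => hR i l (by omega)), Finset.smul_sum]
    refine Finset.sum_congr rfl fun s _ => ?_
    rw [show m + n - l + p - s = m + n + p - l - s by ring, show m + n - l = m - l + n by ring]
  have e4 : ∀ i j : ℕ, X.prod i u (X.prod j v w) - X.prod j v (X.prod i u w) =
      ∑ l ∈ Finset.range N, Ring.choose (i : ℤ) l • X.prod (i + j - l) (X.prod l u v) w := by
    intro i j
    obtain ⟨L, hL⟩ := X.comm_formula u v w i j
    rw [← hL (max L N) (by omega)]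
    refine (Finset.sum_subset (fun l hl => ?_) fun l _ hl => ?_).symm
    · simp only [Finset.mem_range] at hl ⊢; omega
    · simp only [Finset.mem_range, not_lt] at hl
      rw [hN l (by omega)]
      simp
  rw [e1, e2, e3, ← Finset.sum_sub_distrib]
  have e5 : ∀ i ∈ Finset.range K, (∑ j ∈ Finset.range K, (Ring.choose m i * Ring.choose n j) •
        Finsupp.single (m + n + p - i - j) (X.prod i u (X.prod j v w))) -
      (∑ j ∈ Finset.range K, (Ring.choose m i * Ring.choose n j) •
        Finsupp.single (m + n + p - i - j) (X.prod j v (X.prod i u w))) =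
      ∑ l ∈ Finset.range N, ∑ j ∈ Finset.range K,
        (Ring.choose m i * Ring.choose n j * Ring.choose (i : ℤ) l) •
        Finsupp.single (m + n + p - i - j) (X.prod (i + j - l) (X.prod l u v) w) := by
    intro i _
    rw [← Finset.sum_sub_distrib, Finset.sum_comm]
    refine Finset.sum_congr rfl fun j _ => ?_
    rw [← smul_sub, ← Finsupp.single_sub, e4, ← Finsupp.lsingle_apply (R := ℤ), map_sum,
      Finset.smul_sum]
    refine Finset.sum_congr rfl fun l _ => ?_
    rw [map_zsmul, smul_smul, Finsupp.lsingle_apply]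
  rw [Finset.sum_congr rfl e5, Finset.sum_comm]
  refine Finset.sum_congr rfl fun l hl => ?_
  have hl' : l < N := Finset.mem_range.1 hl
  obtain ⟨Q, hQ⟩ : ∃ Q, K = l + Q := ⟨K - l, by omega⟩
  have e6 : ∑ s ∈ Finset.range R, Ring.choose m l • Ring.choose (m - l + n) s •
        (Finsupp.single (m + n + p - l - s) (X.prod s (X.prod l u v) w) : ℤ →₀ V) =
      ∑ i ∈ Finset.range Q, ∑ j ∈ Finset.range K, Ring.choose m l •
        (Ring.choose (m - l) i * Ring.choose n j) •
        Finsupp.single (m + n + p - l - (i + j : ℕ)) (X.prod (i + j : ℕ) (X.prod l u v) w) := by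
    simp only [← Finset.smul_sum]
    congr 1
    exact (sum_choose_add (m - l) n (fun s : ℕ =>
      (Finsupp.single (m + n + p - l - s) (X.prod s (X.prod l u v) w) : ℤ →₀ V)) R Q K
      (by omega) (by omega) (fun s hs => by rw [hR s l (by omega), Finsupp.single_zero])).symm
  rw [e6]
  conv_lhs => rw [hQ, Finset.sum_range_add]
  rw [Finset.sum_eq_zero, zero_add, ← hQ]
  · refine Finset.sum_congr rfl fun i _ => Finset.sum_congr rfl fun j _ => ?_
    have h := Ring.choose_smul_choose m (show l ≤ l + i by omega)
    rw [Nat.add_sub_cancel_left, nsmul_eq_mul] at h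
    rw [Ring.choose_natCast, smul_smul, mul_right_comm, mul_comm (Ring.choose m (l + i)), h,
      mul_assoc]
    push_cast
    rw [show m + n + p - ((l : ℤ) + i) - j = m + n + p - l - (i + j) by ring,
      show (l : ℤ) + i + j - l = i + j by ring]
  · intro i hi
    refine Finset.sum_eq_zero fun j _ => ?_
    rw [Ring.choose_natCast, Nat.choose_eq_zero_of_lt (Finset.mem_range.1 hi)]
    simp

/-- The current Lie algebra `V[t, t⁻¹] / ∂ V[t, t⁻¹]`. -/
def CurrentLie : Type _ := (ℤ →₀ V) ⧸ LinearMap.range X.del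

namespace CurrentLie

noncomputable instance : AddCommGroup X.CurrentLie :=
  inferInstanceAs (AddCommGroup ((ℤ →₀ V) ⧸ LinearMap.range X.del))

noncomputable instance : Module k X.CurrentLie :=
  inferInstanceAs (Module k ((ℤ →₀ V) ⧸ LinearMap.range X.del))

/-- The class of an element of `V[t, t⁻¹]`. -/
noncomputable def mk : (ℤ →₀ V) →ₗ[k] X.CurrentLie := (LinearMap.range X.del).mkQ

theorem mk_surjective : Function.Surjective (mk X) := Submodule.mkQ_surjective _

variable {X} in
theorem mk_eq_zero {x : ℤ →₀ V} (h : x ∈ LinearMap.range X.del) : mk X x = 0 :=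
  (Submodule.Quotient.mk_eq_zero _).2 h

variable [CharZero k]

/-- The bracket of the current Lie algebra. -/
noncomputable def bracket : X.CurrentLie →ₗ[k] X.CurrentLie →ₗ[k] X.CurrentLie :=
  (LinearMap.range X.del).liftQ
    { toFun := fun x => (LinearMap.range X.del).liftQ (mk X ∘ₗ X.loopBracket x) (by
        rintro _ ⟨y, rfl⟩
        exact mk_eq_zero (X.loopBracket_del_right x y))
      map_add' := fun x y => by
        apply Submodule.linearMap_qext
        apply LinearMap.ext
        intro z
        change mk X (X.loopBracket (x + y) z) = mk X (X.loopBracket x z) + mk X (X.loopBracket y z)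
        rw [map_add, LinearMap.add_apply, map_add]
      map_smul' := fun r x => by
        apply Submodule.linearMap_qext
        apply LinearMap.ext
        intro z
        change mk X (X.loopBracket (r • x) z) = r • mk X (X.loopBracket x z)
        rw [map_smul, LinearMap.smul_apply, map_smul] }
    (by
      rintro _ ⟨y, rfl⟩
      rw [LinearMap.mem_ker]
      apply Submodule.linearMap_qext
      apply LinearMap.ext
      intro z
      change mk X (X.loopBracket (X.del y) z) = 0
      rw [X.loopBracket_del_left, map_zero])

theorem bracket_mk (x y : ℤ →₀ V) :
    bracket X (mk X x) (mk X y) = mk X (X.loopBracket x y) := rfl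

noncomputable instance : LieRing X.CurrentLie where
  bracket x y := bracket X x y
  add_lie x y z := by
    change bracket X (x + y) z = bracket X x z + bracket X y z
    rw [map_add, LinearMap.add_apply]
  lie_add x y z := map_add (bracket X x) y z
  lie_self x := by
    obtain ⟨x, rfl⟩ := mk_surjective X x
    change bracket X (mk X x) (mk X x) = 0
    rw [bracket_mk]
    have h := X.loopBracket_skew x x
    rw [← two_smul k] at h
    have h2 := Submodule.smul_mem _ (2⁻¹ : k) h
    rw [smul_smul, inv_mul_cancel₀ two_ne_zero, one_smul] at h2
    exact mk_eq_zero h2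
  leibniz_lie x y z := by
    obtain ⟨x, rfl⟩ := mk_surjective X x
    obtain ⟨y, rfl⟩ := mk_surjective X y
    obtain ⟨z, rfl⟩ := mk_surjective X z
    exact (congrArg (mk X) (X.loopBracket_jacobi x y z)).trans (map_add (mk X) _ _)

theorem lie_mk (x y : ℤ →₀ V) : ⁅mk X x, mk X y⁆ = mk X (X.loopBracket x y) := rfl

noncomputable instance : LieAlgebra k X.CurrentLie where
  lie_smul r x y := map_smul (bracket X x) r y

end CurrentLie

end VertexOperatorAlgebra

namespace DegreewiseTop

variable {k A : Type*} [Field k] [Ring A] [Algebra k A] (T : DegreewiseTop k A)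

/-- The partial sums of a series whose terms converge to zero form a Cauchy sequence. -/
theorem partialSum_mem_cauchySeq {d : ℤ} {c : A} (hc : c ∈ T.deg d) {a : ℕ → A}
    (ha : ∀ i, a i ∈ T.deg d) (ha' : ∀ n, ∃ M, ∀ i, M ≤ i → a i ∈ T.nhd d n) :
    (fun N => c + ∑ i ∈ Finset.range N, a i) ∈ T.cauchySeq d := by
  refine ⟨fun N => add_mem hc (sum_mem fun i _ => ha i), fun n => ?_⟩
  obtain ⟨M, hM⟩ := ha' n
  have h : ∀ i, M ≤ i → (∑ l ∈ Finset.range i, a l) - ∑ l ∈ Finset.range M, a l ∈ T.nhd d n := by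
    intro i hi
    rw [← Finset.sum_Ico_eq_sub _ hi]
    exact sum_mem fun l hl => hM l (Finset.mem_Ico.1 hl).1
  refine ⟨M, fun i hi j hj => ?_⟩
  have := sub_mem (h i hi) (h j hj)
  rw [sub_sub_sub_cancel_right] at this
  rwa [add_sub_add_left_eq_sub]

end DegreewiseTop

namespace VertexOperatorAlgebra

variable {k V : Type*} [Field k] [AddCommGroup V] [Module k V]
  (X : VertexOperatorAlgebra k V)

/-! ### The algebra `U(𝔤) / (J₀(1) - 1)` -/

namespace CurrentLie

/-- The element `Jₙ(u) = u ⊗ tⁿ⁺ʳ⁻¹`, for `u` of weight `r`. -/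
noncomputable def J (r n : ℤ) : V →ₗ[k] X.CurrentLie := mk X ∘ₗ Finsupp.lsingle (n + r - 1)

/-- The space `𝔤(d)` spanned by the elements `J₋d(u)`. -/
noncomputable def deg (d : ℤ) : Submodule k X.CurrentLie := ⨆ r, (X.wt r).map (J X r (-d))

/-- The space `G_p 𝔤` spanned by the elements `Jₙ(u)` with `u` of weight at most `p`. -/
noncomputable def fil (p : ℤ) : Submodule k X.CurrentLie :=
  ⨆ (r : ℤ) (_ : r ≤ p) (n : ℤ), (X.wt r).map (J X r n)

variable {X} in
theorem J_mem_deg {r : ℤ} {u : V} (hu : u ∈ X.wt r) (n : ℤ) : J X r n u ∈ deg X (-n) :=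
  le_iSup (fun r => (X.wt r).map (J X r (- -n))) r ⟨u, hu, by rw [neg_neg]⟩

variable {X} in
theorem J_mem_fil {r p : ℤ} (h : r ≤ p) {u : V} (hu : u ∈ X.wt r) (n : ℤ) :
    J X r n u ∈ fil X p :=
  Submodule.mem_iSup_of_mem r (Submodule.mem_iSup_of_mem h (Submodule.mem_iSup_of_mem n
    ⟨u, hu, rfl⟩))

theorem fil_mono : Monotone (fil X) := fun _ _ h =>
  iSup_le fun r => iSup_le fun hr => iSup_le fun n => by
    rintro _ ⟨u, hu, rfl⟩
    exact J_mem_fil (hr.trans h) hu n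

theorem iSup_deg : ⨆ d, deg X d = ⊤ := by
  rw [eq_top_iff]
  rintro x -
  obtain ⟨x, rfl⟩ := mk_surjective X x
  induction x using Finsupp.induction_linear with
  | zero => simp
  | add x y hx hy => rw [map_add]; exact add_mem hx hy
  | single n u =>
    have h : (⨆ r, X.wt r) ≤ (⨆ d, deg X d).comap (mk X ∘ₗ Finsupp.lsingle n) := by
      refine iSup_le fun r v hv => ?_
      have := J_mem_deg hv (n - r + 1)
      rw [J, show n - r + 1 + r - 1 = n by ring] at this
      exact Submodule.mem_iSup_of_mem _ this
    exact h (X.iSup_wt ▸ Submodule.mem_top)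

variable [CharZero k]

theorem lie_mem_fil {p q : ℤ} {x y : X.CurrentLie} (hx : x ∈ fil X p) (hy : y ∈ fil X q) :
    ⁅x, y⁆ ∈ fil X (p + q - 1) := by
  have h1 : ∀ r ≤ p, ∀ m, ∀ u ∈ X.wt r, ∀ s ≤ q, ∀ n, ∀ v ∈ X.wt s,
      bracket X (J X r m u) (J X s n v) ∈ fil X (p + q - 1) := by
    intro r hr m u hu s hs n v hv
    obtain ⟨N, hN⟩ := X.trunc u v
    change mk X (X.loopBracket (Finsupp.single _ u) (Finsupp.single _ v)) ∈ _
    rw [X.loopBracket_single u v _ _ N (fun i hi => hN i (by omega)), map_sum]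
    refine sum_mem fun i _ => ?_
    rw [map_zsmul]
    refine zsmul_mem ?_ _
    have h := J_mem_fil (show r + s - i - 1 ≤ p + q - 1 by omega) (X.prod_mem i hu hv)
      (m + r - 1 + (n + s - 1) - i - (r + s - i - 1) + 1)
    rwa [J, show m + r - 1 + (n + s - 1) - (i : ℤ) - (r + s - i - 1) + 1 + (r + s - i - 1) - 1 =
      m + r - 1 + (n + s - 1) - i by ring] at h
  have h2 : fil X p ≤ (fil X (p + q - 1)).comap ((bracket X).flip y) :=
    iSup_le fun r => iSup_le fun hr => iSup_le fun m => by
      rintro _ ⟨u, hu, rfl⟩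
      have h3 : fil X q ≤ (fil X (p + q - 1)).comap (bracket X (J X r m u)) :=
        iSup_le fun s => iSup_le fun hs => iSup_le fun n => by
          rintro _ ⟨v, hv, rfl⟩
          exact h1 r hr m u hu s hs n v hv
      exact h3 hy
  exact h2 hx

end CurrentLie

variable [CharZero k]

/-- The relation `J₀(1) = 1`. -/
inductive UEARel : UniversalEnvelopingAlgebra k X.CurrentLie →
    UniversalEnvelopingAlgebra k X.CurrentLie → Prop
  | vac : UEARel (UniversalEnvelopingAlgebra.ι k (CurrentLie.J X 0 0 X.vac)) 1

/-- The quotient of the universal enveloping algebra of the current Lie algebra by the two-sided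
ideal generated by `J₀(1) - 1`. -/
abbrev UEA := RingQuot X.UEARel

namespace UEA

attribute [local instance] LieRing.ofAssociativeRing

/-- The canonical map from the current Lie algebra. -/
noncomputable def ι : X.CurrentLie →ₗ[k] X.UEA :=
  (RingQuot.mkAlgHom k X.UEARel).toLinearMap ∘ₗ
    (UniversalEnvelopingAlgebra.ι k : X.CurrentLie →ₗ⁅k⁆ _).toLinearMap

theorem ι_lie (x y : X.CurrentLie) : ι X ⁅x, y⁆ = ι X x * ι X y - ι X y * ι X x := by
  change RingQuot.mkAlgHom k X.UEARel (UniversalEnvelopingAlgebra.ι k ⁅x, y⁆) = _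
  rw [LieHom.map_lie, LieRing.of_associative_ring_bracket, map_sub, map_mul, map_mul]
  rfl

theorem ι_vac : ι X (CurrentLie.J X 0 0 X.vac) = 1 :=
  (RingQuot.mkAlgHom_rel k (UEARel.vac (X := X))).trans (map_one _)

theorem adjoin_ι : Algebra.adjoin k (Set.range (ι X)) = ⊤ := by
  set S := Algebra.adjoin k (Set.range (ι X)) with hS
  let ι' : X.CurrentLie →ₗ⁅k⁆ S :=
    { toFun := fun x => ⟨ι X x, Algebra.subset_adjoin ⟨x, rfl⟩⟩
      map_add' := fun x y => Subtype.ext (map_add (ι X) x y)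
      map_smul' := fun r x => Subtype.ext (map_smul (ι X) r x)
      map_lie' := fun {x y} => Subtype.ext (ι_lie X x y) }
  have h : S.val.comp (UniversalEnvelopingAlgebra.lift k ι') = RingQuot.mkAlgHom k X.UEARel := by
    apply UniversalEnvelopingAlgebra.hom_ext
    ext x
    change ((UniversalEnvelopingAlgebra.lift k ι' (UniversalEnvelopingAlgebra.ι k x) : S) :
      X.UEA) = _
    rw [UniversalEnvelopingAlgebra.lift_ι_apply]
    rfl
  rw [eq_top_iff]
  rintro x -
  obtain ⟨y, rfl⟩ := RingQuot.mkAlgHom_surjective k X.UEARel x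
  rw [← h]
  exact (UniversalEnvelopingAlgebra.lift k ι' y).2

/-- The degreewise topological algebra `U(𝔤) / (J₀(1) - 1)`: the space of degree `d` is spanned by
the products of elements of `𝔤(d₁), …, 𝔤(dₗ)` with `d₁ + ⋯ + dₗ = d`, and the topology is the
standard one. -/
noncomputable def top : DegreewiseTop k X.UEA :=
  DegreewiseTop.standard (wordSpan (CurrentLie.deg X) (ι X))
    (iSup_wordSpan _ _ (CurrentLie.iSup_deg X) (adjoin_ι X)) (one_mem_wordSpan _ _)
    (mul_mem_wordSpan _ _)

/-- The subspace `G_p`: the sum of the products `G_{p₁} 𝔤 ⋯ G_{pₗ} 𝔤` with `l ≥ 0` and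
`p₁ + ⋯ + pₗ = p`. -/
noncomputable def fil (p : ℤ) : Submodule k X.UEA := wordSpan (CurrentLie.fil X) (ι X) p

theorem fil_mono : Monotone (fil X) := by
  intro p q h
  refine Submodule.span_le.2 ?_
  rintro _ ⟨l, hl, hp, rfl⟩
  rcases l with _ | ⟨y, l⟩
  · simp only [List.map_nil, List.sum_nil] at hp
    simp only [List.map_nil, List.prod_nil]
    rw [← ι_vac X]
    exact mem_wordSpan _ _ (CurrentLie.J_mem_fil (by omega) X.vac_mem 0)
  · refine Submodule.subset_span ⟨(y.1 + (q - p), y.2) :: l, ?_, ?_, by simp⟩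
    · intro z hz
      rcases List.mem_cons.1 hz with rfl | hz
      · exact CurrentLie.fil_mono X (by omega : y.1 ≤ _) (hl y List.mem_cons_self)
      · exact hl z (List.mem_cons_of_mem _ hz)
    · simp only [List.map_cons, List.sum_cons] at hp ⊢
      omega

theorem comm_mem_fil {p q : ℤ} {a b : X.UEA} (ha : a ∈ fil X p) (hb : b ∈ fil X q) :
    a * b - b * a ∈ fil X (p + q - 1) := by
  rw [← PoissonBracket.commutator_apply (k := k)]
  refine bracket_mem_wordSpan _ _ (PoissonBracket.commutator k X.UEA) (-1) ?_ ha hb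
  intro p q x hx y hy
  rw [PoissonBracket.commutator_apply, ← ι_lie]
  exact mem_wordSpan _ _ (CurrentLie.lie_mem_fil X hx hy)

/-- The image of `Jₙ(u)`, for `u` of weight `r`. -/
noncomputable def J (r n : ℤ) : V →ₗ[k] X.UEA := ι X ∘ₗ CurrentLie.J X r n

variable {X} in
theorem J_mem {r : ℤ} {u : V} (hu : u ∈ X.wt r) (n : ℤ) : J X r n u ∈ (top X).deg (-n) :=
  mem_wordSpan _ _ (CurrentLie.J_mem_deg hu n)

variable {X} in
theorem J_mul_J_mem {r s : ℤ} {u v : V} (hu : u ∈ X.wt r) (hv : v ∈ X.wt s) {m n d : ℤ} {l : ℕ}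
    (hd : -m - n = d) (hl : l + 1 ≤ n) : J X r m u * J X s n v ∈ (top X).nhd d l := by
  subst hd
  refine Submodule.mem_iSup_of_mem (-n) (Submodule.mem_iSup_of_mem (by omega) ?_)
  refine Submodule.mul_mem_mul ?_ (J_mem hv n)
  rw [sub_neg_eq_add, sub_add_cancel]
  exact J_mem hu m

/-! ### The current algebra -/

/-- The `i`-th term of the difference of the infinite sums in `B_{l,m,n}(u, v)`. -/
noncomputable def borcherdsTerm (r s l m n : ℤ) (u v : V) (i : ℕ) : X.UEA :=
  -(((-1 : ℤ) ^ i * Ring.choose n i) • (J X r (l + n - i) u * J X s (m + i) v)) +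
    (n.negOnePow : ℤ) • ((-1 : ℤ) ^ i * Ring.choose n i) •
      (J X s (m + n - i) v * J X r (l + i) u)

/-- The finite sum `∑ᵢ binom(l + r - 1, i) J_{l+m+n}(u₍ₙ₊ᵢ₎v)` in `B_{l,m,n}(u, v)`. -/
noncomputable def borcherdsConst (r s l m n : ℤ) (u v : V) : X.UEA :=
  ∑ᶠ i : ℕ, Ring.choose (l + r - 1) i •
    J X (r + s - (n + i) - 1) (l + m + n) (X.prod (n + i) u v)

theorem borcherds_mem_cauchySeq {r s : ℤ} {u v : V} (hu : u ∈ X.wt r) (hv : v ∈ X.wt s)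
    (l m n : ℤ) : (fun N => borcherdsConst X r s l m n u v +
      ∑ i ∈ Finset.range N, borcherdsTerm X r s l m n u v i) ∈
      (top X).cauchySeq (-(l + m + n)) := by
  refine (top X).partialSum_mem_cauchySeq ?_ (fun i => ?_) (fun N => ?_)
  · exact finsum_induction (· ∈ (top X).deg (-(l + m + n))) (zero_mem _)
      (fun _ _ => add_mem) (fun i => zsmul_mem (J_mem (X.prod_mem _ hu hv) _) _)
  · refine add_mem (neg_mem (zsmul_mem ?_ _)) (zsmul_mem (zsmul_mem ?_ _) _)
    · have := (top X).mul_mem (J_mem hu (l + n - i)) (J_mem hv (m + i))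
      rwa [show -(l + n - (i : ℤ)) + -(m + i) = -(l + m + n) by ring] at this
    · have := (top X).mul_mem (J_mem hv (m + n - i)) (J_mem hu (l + i))
      rwa [show -(m + n - (i : ℤ)) + -(l + i) = -(l + m + n) by ring] at this
  · refine ⟨(N + 1 - m).toNat + (N + 1 - l).toNat, fun i hi => ?_⟩
    exact add_mem (neg_mem (zsmul_mem (J_mul_J_mem hu hv (by ring) (by omega)) _))
      (zsmul_mem (zsmul_mem (J_mul_J_mem hv hu (by ring) (by omega)) _) _)

/-- The element `B_{l,m,n}(u, v)` of the completion, for `u` of weight `r` and `v` of weight `s`: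
the sum
`∑ᵢ binom(l + r - 1, i) J_{l+m+n}(u₍ₙ₊ᵢ₎v) - ∑ᵢ (-1)ⁱ binom(n, i) J_{l+n-i}(u) J_{m+i}(v)`
`+ (-1)ⁿ ∑ᵢ (-1)ⁱ binom(n, i) J_{m+n-i}(v) J_{l+i}(u)`. -/
noncomputable def borcherdsElt {r s : ℤ} {u v : V} (hu : u ∈ X.wt r) (hv : v ∈ X.wt s)
    (l m n : ℤ) : (top X).Completion :=
  (top X).limit _ (borcherds_mem_cauchySeq X hu hv l m n)

/-- The elements `B_{l,m,n}(u, v)` of degree `d = -l - m - n`. -/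
def borcherdsSet (d : ℤ) : Set (top X).Completion :=
  {x | ∃ (r s : ℤ) (u v : V) (hu : u ∈ X.wt r) (hv : v ∈ X.wt s) (l m n : ℤ),
    d = -(l + m + n) ∧ x = borcherdsElt X hu hv l m n}

end UEA

/-- The current algebra of a vertex operator algebra: the quotient of the degreewise completion of
`U(𝔤) / (J₀(1) - 1)` by the degreewise closure of the ideal generated by the elements
`B_{l,m,n}(u, v)`. -/
def CurrentAlgebra : Type _ :=
  (UEA.top X).Completion ⧸ (UEA.top X).completion.closedIdeal (UEA.borcherdsSet X)

noncomputable instance : Ring X.CurrentAlgebra :=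
  Ideal.Quotient.ring ((UEA.top X).completion.closedIdeal (UEA.borcherdsSet X))

noncomputable instance : Algebra k X.CurrentAlgebra :=
  Ideal.Quotient.algebra k (I := (UEA.top X).completion.closedIdeal (UEA.borcherdsSet X))

/-- The quotient map onto the current algebra. -/
noncomputable def toCurrentAlgebra : (UEA.top X).Completion →ₐ[k] X.CurrentAlgebra :=
  Ideal.Quotient.mkₐ k ((UEA.top X).completion.closedIdeal (UEA.borcherdsSet X))

/-- The filtration of the current algebra induced by the subspaces `G_p` of
`U(𝔤) / (J₀(1) - 1)`, via their closures in the completion. -/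
noncomputable def currentFiltration : TopFiltration k X.CurrentAlgebra :=
  ((UEA.top X).completionFiltration (UEA.fil X) (UEA.fil_mono X) (one_mem_wordSpan _ _)
    (mul_mem_wordSpan _ _) (UEA.comm_mem_fil X)).map
      X.toCurrentAlgebra

/-- The degreewise topological Poisson algebra `gr U(V)`. -/
noncomputable def grCurrent : DegreewisePoisson k X.currentFiltration.Gr := X.currentFiltration.gr

/-- The degreewise completion of `gr U(V)`. -/
noncomputable def completedGr : DegreewisePoisson k X.grCurrent.Completion :=
  X.grCurrent.completion

end VertexOperatorAlgebra

namespace DegreewiseTop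

variable {k A : Type*} [Field k] [Ring A] [Algebra k A] (T : DegreewiseTop k A)

theorem mem_nullSeq {d : ℤ} {a : ℕ → A} (ha : ∀ i, a i ∈ T.deg d)
    (h : ∀ n, ∃ M, ∀ i, M ≤ i → a i ∈ T.nhd d n) : a ∈ T.nullSeq d := by
  have hc : a ∈ T.cauchySeq d := ⟨ha, fun n => by
    obtain ⟨M, hM⟩ := h n
    exact ⟨M, fun i hi j hj => sub_mem (hM i hi) (hM j hj)⟩⟩
  simp only [nullSeq, Submodule.mem_iInf]
  exact fun n => ⟨hc, h n⟩

/-- The sums over intervals exhausting `ℤ` of a family of elements converging to zero. -/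
theorem intervalSum_mem_cauchySeq {d : ℤ} {c : A} (hc : c ∈ T.deg d) {f : ℤ → A}
    (hf : ∀ j, f j ∈ T.deg d) (hf' : ∀ n, ∃ M : ℕ, ∀ j : ℤ, M ≤ |j| → f j ∈ T.nhd d n) :
    (fun N : ℕ => c - ∑ j ∈ Finset.Icc (-(N : ℤ)) N, f j) ∈ T.cauchySeq d := by
  refine ⟨fun N => sub_mem hc (sum_mem fun i _ => hf i), fun n => ?_⟩
  obtain ⟨M, hM⟩ := hf' n
  have h : ∀ i, M ≤ i → (∑ l ∈ Finset.Icc (-(i : ℤ)) i, f l) -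
      ∑ l ∈ Finset.Icc (-(M : ℤ)) M, f l ∈ T.nhd d n := by
    intro i hi
    rw [← Finset.sum_sdiff (Finset.Icc_subset_Icc (by omega : -(i : ℤ) ≤ -M)
      (by omega : (M : ℤ) ≤ i)), add_sub_cancel_right]
    refine sum_mem fun l hl => hM l ?_
    simp only [Finset.mem_sdiff, Finset.mem_Icc] at hl
    rw [le_abs]
    omega
  refine ⟨M, fun i hi j hj => ?_⟩
  have := sub_mem (h j hj) (h i hi)
  rw [sub_sub_sub_cancel_right] at this
  rwa [sub_sub_sub_cancel_left]

theorem intervalSum_shift {d : ℤ} {f : ℤ → A} (hf : ∀ j, f j ∈ T.deg d)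
    (hf' : ∀ n, ∃ M : ℕ, ∀ j : ℤ, M ≤ |j| → f j ∈ T.nhd d n) (a : ℤ) :
    (fun N : ℕ => ∑ j ∈ Finset.Icc (-(N : ℤ)) N, f j - ∑ j ∈ Finset.Icc (-(N : ℤ)) N, f (j + a)) ∈
      T.nullSeq d := by
  refine T.mem_nullSeq (fun N => sub_mem (sum_mem fun i _ => hf i) (sum_mem fun i _ => hf _))
    fun n => ?_
  obtain ⟨M, hM⟩ := hf' n
  refine ⟨M + a.natAbs, fun N hN => ?_⟩
  have e : ∑ j ∈ Finset.Icc (-(N : ℤ)) N, f (j + a) =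
      ∑ j ∈ Finset.Icc (-(N : ℤ) + a) (N + a), f j := by
    rw [← Finset.map_add_right_Icc, Finset.sum_map]
    rfl
  rw [e, ← Finset.sum_sdiff_sub_sum_sdiff]
  refine sub_mem (sum_mem fun l hl => hM l ?_) (sum_mem fun l hl => hM l ?_)
  · simp only [Finset.mem_sdiff, Finset.mem_Icc] at hl
    rw [le_abs]
    omega
  · simp only [Finset.mem_sdiff, Finset.mem_Icc] at hl
    rw [le_abs]
    omega

theorem limit_eq_add {d : ℤ} {a b c : ℕ → A} (ha : a ∈ T.cauchySeq d) (hb : b ∈ T.cauchySeq d)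
    (hc : c ∈ T.cauchySeq d) (h : a - (b + c) ∈ T.nullSeq d) :
    T.limit a ha = T.limit b hb + T.limit c hc := by
  refine (Ideal.Quotient.eq (I := T.nullIdeal)).2 ?_
  exact le_iSup T.nullSeq d h

theorem mul_mem_closure {J J' : Submodule k A} {d e : ℤ} {a x : A} (ha : a ∈ T.deg e)
    (hJ : ∀ y ∈ J, a * y ∈ J') (hx : x ∈ T.closure J d) : a * x ∈ T.closure J' (e + d) :=
  ⟨T.mul_mem ha hx.1, fun n => by
    obtain ⟨y, hy, h⟩ := hx.2 n
    exact ⟨a * y, hJ y hy, by simpa [mul_sub] using T.mul_nhd ha h⟩⟩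

theorem closure_mul_mem {J J' : Submodule k A} {d e : ℤ} {a x : A} (ha : a ∈ T.deg e)
    (hJ : ∀ y ∈ J, y * a ∈ J') (hx : x ∈ T.closure J d) : x * a ∈ T.closure J' (d + e) :=
  ⟨T.mul_mem hx.1 ha, fun n => by
    obtain ⟨y, hy, h⟩ := hx.2 (n + e).toNat
    exact ⟨y * a, hJ y hy, by simpa [sub_mul] using T.nhd_mul (n := n) (by omega) h ha⟩⟩

theorem mem_closure_of_approx {J : Submodule k A} {d : ℤ} {x : A} (hx : x ∈ T.deg d)
    (h : ∀ n, ∃ y ∈ T.closure J d, x - y ∈ T.nhd d n) : x ∈ T.closure J d :=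
  ⟨hx, fun n => by
    obtain ⟨y, hy, h1⟩ := h n
    obtain ⟨z, hz, h2⟩ := hy.2 n
    exact ⟨z, hz, by simpa using add_mem h1 h2⟩⟩

end DegreewiseTop

namespace DegreewisePoisson

variable {k A : Type*} [Field k] [Ring A] [Algebra k A]

/-- A graded Poisson algebra with the standard degreewise topology. -/
def standard (B : PoissonBracket k A) (mul_comm : ∀ a b : A, a * b = b * a)
    (deg : ℤ → Submodule k A) (iSup_deg : ⨆ d, deg d = ⊤) (one_mem : (1 : A) ∈ deg 0)
    (mul_mem : ∀ {d e : ℤ} {a b : A}, a ∈ deg d → b ∈ deg e → a * b ∈ deg (d + e))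
    (br_mem : ∀ {d e : ℤ} {a b : A}, a ∈ deg d → b ∈ deg e → B.br a b ∈ deg (d + e)) :
    DegreewisePoisson k A where
  __ := DegreewiseTop.standard deg iSup_deg one_mem mul_mem
  __ := B
  mul_comm := mul_comm
  br_mem := br_mem
  br_nhd {d e m n a b} h h' ha hb := by
    have : (⨆ (j : ℤ) (_ : j ≤ -(m : ℤ) - 1), deg (e - j) * deg j) ≤
        (⨆ (j : ℤ) (_ : j ≤ -(n : ℤ) - 1), deg (d + e - j) * deg j).comap (B.br a) := by
      refine iSup₂_le fun j hj => Submodule.mul_le.2 fun x hx y hy => ?_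
      have h1 : B.br a x ∈ deg (d + e - j) := by
        have := br_mem ha hx
        rwa [← add_sub_assoc] at this
      have h2 : x ∈ deg (d + e - (d + j)) := by
        rwa [show d + e - (d + j) = e - j by ring]
      have h3 := br_mem ha hy
      rw [Submodule.mem_comap, B.leibniz]
      exact add_mem
        (Submodule.mem_iSup_of_mem j (Submodule.mem_iSup_of_mem (by omega)
          (Submodule.mul_mem_mul h1 hy)))
        (Submodule.mem_iSup_of_mem (d + j) (Submodule.mem_iSup_of_mem (by omega)
          (Submodule.mul_mem_mul h2 h3)))
    exact this hb

variable (P : DegreewisePoisson k A)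

/-- A criterion for a closed ideal to be stable under the bracket. -/
theorem br_mem_closedIdeal (S : ℤ → Set A) (hdeg : ∀ e, ∀ s ∈ S e, s ∈ P.deg e)
    (h : ∀ d e, ∀ a ∈ P.deg d, ∀ s ∈ S e, P.br a s ∈ P.closure (P.genIdeal S (d + e)) (d + e))
    (a b : A) (hb : b ∈ P.closedIdeal S) : P.br a b ∈ P.closedIdeal S := by
  have h1 : ∀ d e, ∀ a ∈ P.deg d, ∀ b ∈ P.genIdeal S e,
      P.br a b ∈ P.closure (P.genIdeal S (d + e)) (d + e) := by
    intro d e a ha b hb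
    have hS : P.genIdeal S e ≤ (P.closure (P.genIdeal S (d + e)) (d + e)).comap (P.br a) := by
      refine Submodule.span_le.2 ?_
      rintro _ ⟨i, j, l, rfl, x, hx, s, hs, y, hy, rfl⟩
      have hmem : ∀ f g, ∀ x ∈ P.deg f, ∀ y ∈ P.deg g, f + j + g = d + (i + j + l) →
          x * s * y ∈ P.closure (P.genIdeal S (d + (i + j + l))) (d + (i + j + l)) := by
        intro f g x hx y hy hfg
        refine ⟨?_, fun n => ⟨_, Submodule.subset_span ⟨f, j, g, hfg, x, hx, s, hs, y, hy, rfl⟩,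
          by simp⟩⟩
        rw [← hfg]
        exact P.mul_mem (P.mul_mem hx (hdeg j s hs)) hy
      change P.br a (x * s * y) ∈ P.closure (P.genIdeal S (d + (i + j + l))) (d + (i + j + l))
      rw [P.leibniz, P.leibniz, add_mul]
      refine add_mem (add_mem ?_ ?_) ?_
      · exact hmem (d + i) l _ (P.br_mem ha hx) y hy (by ring)
      · have h2 := P.mul_mem_closure (J' := P.genIdeal S (i + (d + j))) hx
          (fun z hz => P.mul_mem_genIdeal S hx hz) (h d j a ha s hs)
        have h3 := P.closure_mul_mem (J' := P.genIdeal S (i + (d + j) + l)) hy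
          (fun z hz => P.genIdeal_mul_mem S hy hz) h2
        rwa [show i + (d + j) + l = d + (i + j + l) by ring] at h3
      · exact hmem i (d + l) x hx _ (P.br_mem ha hy) (by ring)
    exact hS hb
  refine bilin_mem_of_iSup P.deg (fun d => P.closure (P.genIdeal S d) d) P.br
    (⨆ d, P.closure (P.genIdeal S d) d) (fun d e a ha b hb => ?_) a
    (P.iSup_deg ▸ Submodule.mem_top) b hb
  refine le_iSup (fun d => P.closure (P.genIdeal S d) d) (d + e) ?_
  refine P.mem_closure_of_approx (P.br_mem ha hb.1) fun n => ?_
  obtain ⟨y, hy, h2⟩ := hb.2 (max n (n + d).toNat)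
  refine ⟨P.br a y, h1 d e a ha y hy, ?_⟩
  rw [← map_sub]
  exact P.br_nhd (by omega) (by omega) ha h2

end DegreewisePoisson

/-! ### Poisson current algebras -/

namespace GradedPoissonAlgebra

variable {k P : Type*} [Field k] [CommRing P] [Algebra k P] (Q : GradedPoissonAlgebra k P)

theorem iSup_wt : ⨆ r, Q.wt r = ⊤ := Q.isInternal.submodule_iSup_eq_top

/-- The bracket `[x ⊗ tᵐ, y ⊗ tⁿ] = {x, y} ⊗ tᵐ⁺ⁿ` on `P[t, t⁻¹]`, realised as `ℤ →₀ P`. -/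
noncomputable def loopBracket : (ℤ →₀ P) →ₗ[k] (ℤ →₀ P) →ₗ[k] (ℤ →₀ P) :=
  Finsupp.lsum k fun m => LinearMap.flip <| Finsupp.lsum k fun n => LinearMap.flip <|
    Q.br.compr₂ <| Finsupp.lsingle (m + n)

theorem loopBracket_single (x y : P) (m n : ℤ) :
    Q.loopBracket (Finsupp.single m x) (Finsupp.single n y) =
      Finsupp.single (m + n) (Q.br x y) := by
  simp [loopBracket]

theorem loopBracket_skew (x y : ℤ →₀ P) : Q.loopBracket x y = - Q.loopBracket y x := by
  induction x using Finsupp.induction_linear with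
  | zero => simp
  | add x x' hx hx' => rw [map_add, map_add, LinearMap.add_apply, hx, hx', neg_add]
  | single m u =>
    induction y using Finsupp.induction_linear with
    | zero => simp
    | add x x' hx hx' => rw [map_add, map_add, LinearMap.add_apply, hx, hx', neg_add]
    | single n v =>
      rw [Q.loopBracket_single, Q.loopBracket_single, Q.skew, Finsupp.single_neg, add_comm]

theorem loopBracket_jacobi (x y z : ℤ →₀ P) : Q.loopBracket x (Q.loopBracket y z) =
    Q.loopBracket (Q.loopBracket x y) z + Q.loopBracket y (Q.loopBracket x z) := by
  induction x using Finsupp.induction_linear with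
  | zero => simp
  | add x x' hx hx' =>
    simp only [map_add, LinearMap.add_apply, hx, hx']
    abel
  | single m u =>
  induction y using Finsupp.induction_linear with
  | zero => simp
  | add x x' hx hx' =>
    simp only [map_add, LinearMap.add_apply, hx, hx']
    abel
  | single n v =>
  induction z using Finsupp.induction_linear with
  | zero => simp
  | add x x' hx hx' =>
    simp only [map_add, hx, hx']
    abel
  | single p w =>
  simp only [Q.loopBracket_single]
  rw [Q.jacobi, Finsupp.single_add, add_assoc, add_left_comm n m p]

/-- The span of the elements `1 ⊗ tⁿ` with `n ≠ -1`. -/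
noncomputable def units : Submodule k (ℤ →₀ P) :=
  Submodule.span k {x | ∃ n : ℤ, n ≠ -1 ∧ x = Finsupp.single n 1}

theorem loopBracket_one (x : ℤ →₀ P) (n : ℤ) : Q.loopBracket x (Finsupp.single n 1) = 0 := by
  induction x using Finsupp.induction_linear with
  | zero => simp
  | add x x' hx hx' => rw [map_add, LinearMap.add_apply, hx, hx', add_zero]
  | single m u => rw [Q.loopBracket_single, Q.br_one, Finsupp.single_zero]

theorem loopBracket_units (x y : ℤ →₀ P) (hy : y ∈ units (k := k) (P := P)) :
    Q.loopBracket x y = 0 := by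
  have : units (k := k) (P := P) ≤ LinearMap.ker (Q.loopBracket x) := by
    refine Submodule.span_le.2 ?_
    rintro _ ⟨n, _, rfl⟩
    exact Q.loopBracket_one x n
  exact this hy

/-- The quotient `𝔮` of the loop Lie algebra `P[t, t⁻¹]` by the span of the elements `1 ⊗ tⁿ`
with `n ≠ -1`. -/
def LoopLie (_ : GradedPoissonAlgebra k P) : Type _ := (ℤ →₀ P) ⧸ units (k := k) (P := P)

namespace LoopLie

noncomputable instance : AddCommGroup Q.LoopLie :=
  inferInstanceAs (AddCommGroup ((ℤ →₀ P) ⧸ units (k := k) (P := P)))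

noncomputable instance : Module k Q.LoopLie :=
  inferInstanceAs (Module k ((ℤ →₀ P) ⧸ units (k := k) (P := P)))

/-- The class of an element of `P[t, t⁻¹]`. -/
noncomputable def mk : (ℤ →₀ P) →ₗ[k] Q.LoopLie := (units (k := k) (P := P)).mkQ

theorem mk_surjective : Function.Surjective (mk Q) := Submodule.mkQ_surjective _

/-- The bracket of `𝔮`. -/
noncomputable def bracket : Q.LoopLie →ₗ[k] Q.LoopLie →ₗ[k] Q.LoopLie :=
  (units (k := k) (P := P)).liftQ
    { toFun := fun x => (units (k := k) (P := P)).liftQ (mk Q ∘ₗ Q.loopBracket x) (by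
        intro y hy
        rw [LinearMap.mem_ker, LinearMap.comp_apply, Q.loopBracket_units x y hy, map_zero])
      map_add' := fun x y => by
        apply Submodule.linearMap_qext
        apply LinearMap.ext
        intro z
        change mk Q (Q.loopBracket (x + y) z) = mk Q (Q.loopBracket x z) + mk Q (Q.loopBracket y z)
        rw [map_add, LinearMap.add_apply, map_add]
      map_smul' := fun r x => by
        apply Submodule.linearMap_qext
        apply LinearMap.ext
        intro z
        change mk Q (Q.loopBracket (r • x) z) = r • mk Q (Q.loopBracket x z)
        rw [map_smul, LinearMap.smul_apply, map_smul] }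
    (by
      intro y hy
      rw [LinearMap.mem_ker]
      apply Submodule.linearMap_qext
      apply LinearMap.ext
      intro z
      change mk Q (Q.loopBracket y z) = 0
      rw [Q.loopBracket_skew, Q.loopBracket_units z y hy, neg_zero, map_zero])

theorem bracket_mk (x y : ℤ →₀ P) :
    bracket Q (mk Q x) (mk Q y) = mk Q (Q.loopBracket x y) := rfl

/-- The element `x ⊗ tⁿ⁺ʳ⁻¹`, for `x` of weight `r`. -/
noncomputable def psi (r n : ℤ) : P →ₗ[k] Q.LoopLie := mk Q ∘ₗ Finsupp.lsingle (n + r - 1)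

/-- The space of degree `d`, spanned by the elements `x ⊗ tʳ⁻¹⁻ᵈ` with `x` of weight `r`. -/
noncomputable def deg (d : ℤ) : Submodule k Q.LoopLie := ⨆ r, (Q.wt r).map (psi Q r (-d))

variable {Q} in
theorem psi_mem_deg {r : ℤ} {x : P} (hx : x ∈ Q.wt r) (n : ℤ) : psi Q r n x ∈ deg Q (-n) :=
  le_iSup (fun r => (Q.wt r).map (psi Q r (- -n))) r ⟨x, hx, by rw [neg_neg]⟩

theorem iSup_deg : ⨆ d, deg Q d = ⊤ := by
  rw [eq_top_iff]
  rintro x -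
  obtain ⟨x, rfl⟩ := mk_surjective Q x
  induction x using Finsupp.induction_linear with
  | zero => simp
  | add x y hx hy => rw [map_add]; exact add_mem hx hy
  | single n u =>
    have h : (⨆ r, Q.wt r) ≤ (⨆ d, deg Q d).comap (mk Q ∘ₗ Finsupp.lsingle n) := by
      refine iSup_le fun r v hv => ?_
      have := psi_mem_deg hv (n - r + 1)
      rw [psi, show n - r + 1 + r - 1 = n by ring] at this
      exact Submodule.mem_iSup_of_mem _ this
    exact h (Q.iSup_wt ▸ Submodule.mem_top)

theorem bracket_psi (r s m n : ℤ) (x y : P) :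
    bracket Q (psi Q r m x) (psi Q s n y) = psi Q (r + s - 1) (m + n) (Q.br x y) := by
  change mk Q (Q.loopBracket (Finsupp.single _ x) (Finsupp.single _ y)) = mk Q (Finsupp.single _ _)
  rw [Q.loopBracket_single, show m + r - 1 + (n + s - 1) = m + n + (r + s - 1) - 1 by ring]

variable [CharZero k]

noncomputable instance : LieRing Q.LoopLie where
  bracket x y := bracket Q x y
  add_lie x y z := by
    change bracket Q (x + y) z = bracket Q x z + bracket Q y z
    rw [map_add, LinearMap.add_apply]
  lie_add x y z := map_add (bracket Q x) y z
  lie_self x := by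
    obtain ⟨x, rfl⟩ := mk_surjective Q x
    change bracket Q (mk Q x) (mk Q x) = 0
    rw [bracket_mk]
    have h := Q.loopBracket_skew x x
    rw [eq_neg_iff_add_eq_zero, ← two_smul k] at h
    rw [(smul_eq_zero.1 h).resolve_left two_ne_zero, map_zero]
  leibniz_lie x y z := by
    obtain ⟨x, rfl⟩ := mk_surjective Q x
    obtain ⟨y, rfl⟩ := mk_surjective Q y
    obtain ⟨z, rfl⟩ := mk_surjective Q z
    exact (congrArg (mk Q) (Q.loopBracket_jacobi x y z)).trans (map_add (mk Q) _ _)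

noncomputable instance : LieAlgebra k Q.LoopLie where
  lie_smul r x y := map_smul (bracket Q x) r y

theorem lie_def (x y : Q.LoopLie) : ⁅x, y⁆ = bracket Q x y := rfl

theorem lie_mem_deg {d e : ℤ} {x y : Q.LoopLie} (hx : x ∈ deg Q d) (hy : y ∈ deg Q e) :
    ⁅x, y⁆ ∈ deg Q (d + e) := by
  refine bilin_mem_of_iSup (fun r => (Q.wt r).map (psi Q r (-d)))
    (fun r => (Q.wt r).map (psi Q r (-e))) (bracket Q) (deg Q (d + e)) ?_ x hx y hy
  rintro r s _ ⟨x, hx, rfl⟩ _ ⟨y, hy, rfl⟩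
  rw [bracket_psi, show -d + -e = -(d + e) by ring]
  exact le_iSup (fun r => (Q.wt r).map (psi Q r (-(d + e)))) _ ⟨_, Q.br_mem hx hy, rfl⟩

end LoopLie

variable [CharZero k]

/-- The ideal of the symmetric algebra on `𝔮` generated by `1 ⊗ t⁻¹ - 1`. -/
noncomputable def unitIdeal : Ideal (SymmetricAlgebra k Q.LoopLie) :=
  Ideal.span {SymmetricAlgebra.ι k Q.LoopLie (LoopLie.psi Q 0 0 1) - 1}

theorem symBracket_unit (a : SymmetricAlgebra k Q.LoopLie) :
    (symBracket k Q.LoopLie).br a (SymmetricAlgebra.ι k Q.LoopLie (LoopLie.psi Q 0 0 1)) = 0 := by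
  have ha : a ∈ Algebra.adjoin k (Set.range (SymmetricAlgebra.ι k Q.LoopLie)) :=
    (symDerivExt k Q.LoopLie).adjoin ▸ Algebra.mem_top
  induction ha using Algebra.adjoin_induction with
  | mem x h =>
    obtain ⟨x, rfl⟩ := h
    obtain ⟨x, rfl⟩ := LoopLie.mk_surjective Q x
    rw [symBracket_ι]
    change SymmetricAlgebra.ι k Q.LoopLie (LoopLie.mk Q (Q.loopBracket x (Finsupp.single _ 1))) = 0
    rw [Q.loopBracket_one, map_zero, map_zero]
  | algebraMap r =>
    rw [Algebra.algebraMap_eq_smul_one, map_smul, LinearMap.smul_apply, PoissonBracket.skew,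
      PoissonBracket.br_one, neg_zero, smul_zero]
  | add x y _ _ hx hy => rw [map_add, LinearMap.add_apply, hx, hy, add_zero]
  | mul x y _ _ hx hy => rw [PoissonBracket.leibniz', hx, hy, zero_mul, mul_zero, add_zero]

theorem br_mem_unitIdeal (a b : SymmetricAlgebra k Q.LoopLie) (hb : b ∈ Q.unitIdeal) :
    (symBracket k Q.LoopLie).br a b ∈ Q.unitIdeal := by
  obtain ⟨c, rfl⟩ := Ideal.mem_span_singleton'.1 hb
  rw [PoissonBracket.leibniz, map_sub, Q.symBracket_unit, PoissonBracket.br_one, sub_zero, mul_zero,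
    add_zero]
  exact Ideal.mul_mem_left _ _ (Ideal.subset_span rfl)

/-- The quotient `𝕊` of the symmetric algebra on `𝔮` by the ideal generated by `1 ⊗ t⁻¹ - 1`. -/
def LoopSym : Type _ := SymmetricAlgebra k Q.LoopLie ⧸ Q.unitIdeal

namespace LoopSym

noncomputable instance : CommRing Q.LoopSym := Ideal.Quotient.commRing Q.unitIdeal

noncomputable instance : Algebra k Q.LoopSym := Ideal.Quotient.algebra k (I := Q.unitIdeal)

/-- The quotient map from the symmetric algebra. -/
noncomputable def mk : SymmetricAlgebra k Q.LoopLie →ₐ[k] Q.LoopSym :=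
  Ideal.Quotient.mkₐ k Q.unitIdeal

/-- The canonical map `𝔮 → 𝕊`. -/
noncomputable def ι : Q.LoopLie →ₗ[k] Q.LoopSym :=
  (mk Q).toLinearMap ∘ₗ SymmetricAlgebra.ι k Q.LoopLie

theorem adjoin_ι : Algebra.adjoin k (Set.range (ι Q)) = ⊤ := by
  have : Set.range (ι Q) = mk Q '' Set.range (SymmetricAlgebra.ι k Q.LoopLie) := by
    rw [← Set.range_comp]; rfl
  rw [this, ← AlgHom.map_adjoin, show Algebra.adjoin k (Set.range (SymmetricAlgebra.ι k Q.LoopLie))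
    = ⊤ from (symDerivExt k Q.LoopLie).adjoin, Algebra.map_top, AlgHom.range_eq_top]
  exact Ideal.Quotient.mk_surjective

/-- The Poisson bracket of `𝕊`. -/
noncomputable def poissonBracket : PoissonBracket k Q.LoopSym :=
  (symBracket k Q.LoopLie).quot Q.unitIdeal Q.br_mem_unitIdeal

theorem br_ι (x y : Q.LoopLie) : (poissonBracket Q).br (ι Q x) (ι Q y) = ι Q ⁅x, y⁆ :=
  congrArg (mk Q) (symBracket_ι k Q.LoopLie x y)

/-- The degreewise topological Poisson algebra `𝕊` with the standard degreewise topology. -/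
noncomputable def poisson : DegreewisePoisson k Q.LoopSym :=
  DegreewisePoisson.standard (poissonBracket Q) mul_comm (wordSpan (LoopLie.deg Q) (ι Q))
    (iSup_wordSpan _ _ (LoopLie.iSup_deg Q) (adjoin_ι Q)) (one_mem_wordSpan _ _)
    (mul_mem_wordSpan _ _)
    (fun {d e a b} ha hb => by
      have := bracket_mem_wordSpan (LoopLie.deg Q) (ι Q) (poissonBracket Q) 0 (fun p q x hx y hy => by
        rw [br_ι, add_zero]
        exact mem_wordSpan _ _ (LoopLie.lie_mem_deg Q hx hy)) ha hb
      rwa [add_zero] at this)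

/-- The element `Ψ̃ₙ(x) = x ⊗ tⁿ⁺ʳ⁻¹`, for `x` of weight `r`. -/
noncomputable def psi (r n : ℤ) : P →ₗ[k] Q.LoopSym := ι Q ∘ₗ LoopLie.psi Q r n

variable {Q} in
theorem psi_mem {r : ℤ} {x : P} (hx : x ∈ Q.wt r) (n : ℤ) : psi Q r n x ∈ (poisson Q).deg (-n) :=
  mem_wordSpan _ _ (LoopLie.psi_mem_deg hx n)

theorem br_psi (r s m n : ℤ) (x y : P) :
    (poisson Q).br (psi Q r m x) (psi Q s n y) = psi Q (r + s - 1) (m + n) (Q.br x y) :=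
  (br_ι Q _ _).trans (congrArg (ι Q) (LoopLie.bracket_psi Q r s m n x y))

variable {Q} in
theorem psi_mul_mem {r s : ℤ} {x y : P} (hx : x ∈ Q.wt r) (hy : y ∈ Q.wt s) (m j : ℤ) :
    psi Q r (m - j) x * psi Q s j y ∈ (poisson Q).deg (-m) := by
  have := (poisson Q).mul_mem (psi_mem hx (m - j)) (psi_mem hy j)
  rwa [show -(m - j) + -j = -m by ring] at this

variable {Q} in
theorem psi_mul_mem_nhd_aux {r s : ℤ} {x y : P} (hx : x ∈ Q.wt r) (hy : y ∈ Q.wt s) {m j : ℤ}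
    {n : ℕ} (h : n + 1 ≤ j) : psi Q r (m - j) x * psi Q s j y ∈ (poisson Q).nhd (-m) n := by
  refine Submodule.mem_iSup_of_mem (-j) (Submodule.mem_iSup_of_mem (by omega) ?_)
  refine Submodule.mul_mem_mul ?_ (psi_mem hy j)
  rw [show -m - -j = -(m - j) by ring]
  exact psi_mem hx _

variable {Q} in
theorem psi_mul_mem_nhd {r s : ℤ} {x y : P} (hx : x ∈ Q.wt r) (hy : y ∈ Q.wt s) (m : ℤ) (n : ℕ) :
    ∃ M : ℕ, ∀ j : ℤ, M ≤ |j| → psi Q r (m - j) x * psi Q s j y ∈ (poisson Q).nhd (-m) n := by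
  refine ⟨n + 1 + m.natAbs, fun j hj => ?_⟩
  rcases le_abs.1 hj with h | h
  · exact psi_mul_mem_nhd_aux hx hy (by omega)
  · have := psi_mul_mem_nhd_aux hy hx (m := m) (j := m - j) (n := n) (by omega)
    rw [sub_sub_cancel] at this
    rwa [mul_comm]

/-- The partial sums of `Ψ̃ₘ(xy) - ∑ⱼ Ψ̃ₘ₋ⱼ(x) Ψ̃ⱼ(y)`, for `x` of weight `r` and `y` of
weight `s`. -/
noncomputable def relSeq (r s m : ℤ) (x y : P) (N : ℕ) : Q.LoopSym :=
  psi Q (r + s) m (x * y) - ∑ j ∈ Finset.Icc (-(N : ℤ)) N, psi Q r (m - j) x * psi Q s j y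

variable {Q} in
theorem relSeq_mem {r s : ℤ} {x y : P} (hx : x ∈ Q.wt r) (hy : y ∈ Q.wt s) (m : ℤ) :
    relSeq Q r s m x y ∈ (poisson Q).cauchySeq (-m) :=
  (poisson Q).intervalSum_mem_cauchySeq (psi_mem (Q.mul_mem hx hy) m) (psi_mul_mem hx hy m)
    (psi_mul_mem_nhd hx hy m)

/-- The element `D_m(x, y) = Ψ̃ₘ(xy) - ∑ⱼ Ψ̃ₘ₋ⱼ(x) Ψ̃ⱼ(y)` of the completion, for homogeneous
`x` and `y`. -/
noncomputable def relElt {r s : ℤ} {x y : P} (hx : x ∈ Q.wt r) (hy : y ∈ Q.wt s) (m : ℤ) :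
    (poisson Q).Completion := (poisson Q).limit _ (relSeq_mem hx hy m)

/-- The elements `D_m(x, y)` of degree `d = -m`. -/
def relSet (d : ℤ) : Set (poisson Q).Completion :=
  {a | ∃ (r s : ℤ) (x y : P) (hx : x ∈ Q.wt r) (hy : y ∈ Q.wt s) (m : ℤ),
    d = -m ∧ a = relElt Q hx hy m}

theorem relSet_deg (d : ℤ) : ∀ a ∈ relSet Q d, a ∈ (poisson Q).completion.deg d := by
  rintro _ ⟨r, s, x, y, hx, hy, m, rfl, rfl⟩
  exact (poisson Q).limit_mem _

theorem br_relSeq (q r s n m : ℤ) {z x y : P} (hz : z ∈ Q.wt q) (hx : x ∈ Q.wt r)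
    (hy : y ∈ Q.wt s) :
    (poisson Q).pi.br (fun _ => psi Q q n z) (relSeq Q r s m x y) -
      (relSeq Q (q + r - 1) s (n + m) (Q.br z x) y +
        relSeq Q r (q + s - 1) (n + m) x (Q.br z y)) ∈ (poisson Q).nullSeq (-(n + m)) := by
  have h := (poisson Q).intervalSum_shift (psi_mul_mem hx (Q.br_mem hz hy) (n + m))
    (psi_mul_mem_nhd hx (Q.br_mem hz hy) (n + m)) n
  convert h using 1
  ext N
  change (poisson Q).br (psi Q q n z) (relSeq Q r s m x y N) -
      (relSeq Q (q + r - 1) s (n + m) (Q.br z x) y N +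
        relSeq Q r (q + s - 1) (n + m) x (Q.br z y) N) = _
  have e : ∀ j : ℤ, (poisson Q).br (psi Q q n z) (psi Q r (m - j) x * psi Q s j y) =
      psi Q (q + r - 1) (n + m - j) (Q.br z x) * psi Q s j y +
      psi Q r (n + m - (j + n)) x * psi Q (q + s - 1) (j + n) (Q.br z y) := by
    intro j
    rw [PoissonBracket.leibniz, br_psi, br_psi, ← add_sub_assoc, add_comm n j,
      show n + m - (j + n) = m - j by ring]
  simp only [relSeq]
  rw [map_sub, map_sum, Finset.sum_congr rfl (fun j _ => e j), Finset.sum_add_distrib, br_psi,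
    Q.leibniz, map_add, show q + r - 1 + s = q + (r + s) - 1 by ring,
    show r + (q + s - 1) = q + (r + s) - 1 by ring]
  abel

theorem br_psi_relElt (q r s n m : ℤ) {z x y : P} (hz : z ∈ Q.wt q) (hx : x ∈ Q.wt r)
    (hy : y ∈ Q.wt s) :
    (poisson Q).completion.br ((poisson Q).of (psi Q q n z)) (relElt Q hx hy m) =
      relElt Q (Q.br_mem hz hx) hy (n + m) + relElt Q hx (Q.br_mem hz hy) (n + m) := by
  have hc := (poisson Q).br_mem_cauchySeq ((poisson Q).const_mem_cauchySeq (psi_mem hz n))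
    (relSeq_mem hx hy m)
  rw [← neg_add] at hc
  exact (poisson Q).limit_eq_add hc (relSeq_mem (Q.br_mem hz hx) hy (n + m))
    (relSeq_mem hx (Q.br_mem hz hy) (n + m)) (br_relSeq Q q r s n m hz hx hy)

/-- The space of degree `d` of the closed ideal generated by the elements `D_m(x, y)`. -/
noncomputable abbrev relClosure (d : ℤ) : Submodule k (poisson Q).Completion :=
  (poisson Q).completion.closure ((poisson Q).completion.genIdeal (relSet Q) d) d

theorem mem_relClosure {d : ℤ} {a : (poisson Q).Completion} (ha : a ∈ relSet Q d) :
    a ∈ relClosure Q d :=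
  ⟨relSet_deg Q d a ha, fun n => ⟨a, (poisson Q).completion.mem_genIdeal _ ha, by simp⟩⟩

theorem br_word_mem (e : ℤ) (s : (poisson Q).Completion) (hs : s ∈ relSet Q e)
    (l : List (ℤ × Q.LoopLie)) (hl : ∀ y ∈ l, y.2 ∈ LoopLie.deg Q y.1) :
    (poisson Q).completion.br ((poisson Q).of (l.map fun y => ι Q y.2).prod) s ∈
      relClosure Q ((l.map Prod.fst).sum + e) := by
  induction l with
  | nil =>
    change (poisson Q).completion.br ((poisson Q).of 1) s ∈ relClosure Q _
    rw [map_one, PoissonBracket.skew, PoissonBracket.br_one, neg_zero]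
    exact zero_mem _
  | cons y l ih =>
    have hl' : ∀ y ∈ l, y.2 ∈ LoopLie.deg Q y.1 := fun z hz => hl z (List.mem_cons_of_mem _ hz)
    have hy : y.2 ∈ LoopLie.deg Q y.1 := hl y List.mem_cons_self
    have h1 : ∀ d, LoopLie.deg Q d ≤ (relClosure Q (d + e)).comap
        ((poisson Q).completion.br.flip s ∘ₗ (poisson Q).of.toLinearMap ∘ₗ ι Q) := by
      intro d
      refine iSup_le fun q => ?_
      rintro _ ⟨z, hz, rfl⟩
      obtain ⟨r, t, x, y, hx, hy, m, rfl, rfl⟩ := hs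
      change (poisson Q).completion.br ((poisson Q).of (psi Q q (-d) z)) (relElt Q hx hy m) ∈
        relClosure Q (d + -m)
      rw [br_psi_relElt Q q r t (-d) m hz hx hy]
      exact add_mem (mem_relClosure Q ⟨_, _, _, _, Q.br_mem hz hx, hy, _, by ring, rfl⟩)
        (mem_relClosure Q ⟨_, _, _, _, hx, Q.br_mem hz hy, _, by ring, rfl⟩)
    change (poisson Q).completion.br ((poisson Q).of (ι Q y.2 * (l.map fun y => ι Q y.2).prod)) s ∈
      relClosure Q (y.1 + (l.map Prod.fst).sum + e)
    rw [map_mul, PoissonBracket.leibniz']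
    have hw : (l.map fun y => ι Q y.2).prod ∈ (poisson Q).deg (l.map Prod.fst).sum :=
      Submodule.subset_span ⟨l, hl', rfl, rfl⟩
    have hy' : ι Q y.2 ∈ (poisson Q).deg y.1 := mem_wordSpan _ _ hy
    refine add_mem ?_ ?_
    · have := (poisson Q).completion.closure_mul_mem ((poisson Q).of_mem hw)
        (fun z hz => (poisson Q).completion.genIdeal_mul_mem (relSet Q)
          ((poisson Q).of_mem hw) hz) (h1 _ hy)
      rwa [add_right_comm] at this
    · have := (poisson Q).completion.mul_mem_closure ((poisson Q).of_mem hy')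
        (fun z hz => (poisson Q).completion.mul_mem_genIdeal (relSet Q)
          ((poisson Q).of_mem hy') hz) (ih hl')
      rwa [← add_assoc] at this

/-- The closed ideal generated by the elements `D_m(x, y)` is a Poisson ideal. -/
theorem br_mem_relIdeal (a b : (poisson Q).Completion)
    (hb : b ∈ (poisson Q).completion.closedIdeal (relSet Q)) :
    (poisson Q).completion.br a b ∈ (poisson Q).completion.closedIdeal (relSet Q) := by
  refine (poisson Q).completion.br_mem_closedIdeal (relSet Q) (relSet_deg Q) ?_ a b hb
  intro d e a ha s hs
  have h1 : (poisson Q).deg d ≤ (relClosure Q (d + e)).comap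
      ((poisson Q).completion.br.flip s ∘ₗ (poisson Q).of.toLinearMap) := by
    refine Submodule.span_le.2 ?_
    rintro _ ⟨l, hl, rfl, rfl⟩
    exact br_word_mem Q e s hs l hl
  refine (poisson Q).completion.mem_closure_of_approx
    ((poisson Q).completion.br_mem ha (relSet_deg Q e s hs)) fun n => ?_
  obtain ⟨a', ha', h⟩ := (poisson Q).exists_sub_of_mem ha (max n (n + e).toNat)
  refine ⟨_, h1 ha', ?_⟩
  have := (poisson Q).completion.nhd_br (n := n) (by omega) (by omega) h (relSet_deg Q e s hs)
  rwa [map_sub, LinearMap.sub_apply] at this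

end LoopSym

/-- The Poisson current algebra of a graded Poisson algebra: the quotient of the degreewise
completion of `𝕊` by the degreewise closure of the ideal generated by the elements
`D_m(x, y)`. -/
def PoissonCurrentAlgebra : Type _ :=
  (LoopSym.poisson Q).Completion ⧸
    (LoopSym.poisson Q).completion.closedIdeal (LoopSym.relSet Q)

namespace PoissonCurrentAlgebra

noncomputable instance : Ring Q.PoissonCurrentAlgebra :=
  Ideal.Quotient.ring ((LoopSym.poisson Q).completion.closedIdeal (LoopSym.relSet Q))

noncomputable instance : Algebra k Q.PoissonCurrentAlgebra :=
  Ideal.Quotient.algebra k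
    (I := (LoopSym.poisson Q).completion.closedIdeal (LoopSym.relSet Q))

/-- The degreewise topological Poisson algebra structure. -/
noncomputable def poisson : DegreewisePoisson k Q.PoissonCurrentAlgebra :=
  (LoopSym.poisson Q).completion.quotient
    ((LoopSym.poisson Q).completion.closedIdeal (LoopSym.relSet Q)) (LoopSym.br_mem_relIdeal Q)

end PoissonCurrentAlgebra

end GradedPoissonAlgebra

end CurrentAlg

/-!
For a homogeneous `u ∈ V` of weight `r`, let `σᵣ(Jₙ(u)) ∈ gr U(V)` be the symbol of the image of
`Jₙ(u)` in `U(V)`.  The homomorphism of the theorem is induced by `Ψ̃ₙ(x) ↦ σᵣ(Jₙ(u))`, where `x` is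
the class of `u` in `V / C₂(V)`.

*Existence.* In the relation `B_{1-r,m,n}(u, v) = 0` of `U(V)` the finite sum reduces to the term
`J(u₍ₙ₎v)`. For `n ≤ -2` the infinite sums are limits of elements of `G_{r+s}`, whereas the weight
of `u₍ₙ₎v` exceeds `r + s`; hence `C₂(V)` is killed (`UEA.symbol_J_prod_eq_zero`), and there is a
homomorphism of Poisson algebras `𝕊 → gr U(V)` (`symbolHom`, `symbolHom_br`). For `n = -1` the
symbols of the partial sums of `B_{1-r,m+r,-1}(u, v)` are the images of partial sums of
`Ψ̃ₘ(xy) - ∑ⱼ Ψ̃ₘ₋ⱼ(x) Ψ̃ⱼ(y)`, so that the relations of the Poisson current algebra are killed in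
the completion (`symbolHom_relSeq_mem_nullSeq`). To pass from the generators to the closed ideal,
the completion of `gr U(V)` has to be separated; this requires that the sum of the components
`gr U(V)(d)` be direct, which holds since `d` is the eigenvalue of `[J₀(ω), ·]`
(`iSupIndep_grCurrent_deg`).

*Surjectivity.* A continuous homomorphism which has dense image and is open onto its image induces
a surjection of completions (`DegreewiseTop.IsContHom.completionMap_surjective`). Openness amounts
to the strictness of the weight filtration of `𝒰` for the standard topology: an element of
`G_p ∩ Iₙ(𝒰(d))` is a sum of products of generators of total weight at most `p`, each of which is
in `Iₙ(𝒰(d))` (`UEA.fil_inf_nhd_le`). Sorting the generators into those of nonnegative degree, to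
the left, and those of negative degree, to the right, does not increase weights, and expresses the
element by products `x y` with `x` in the first part and `y` in the second. The products with `y`
of degree at least `-n` need not be in `Iₙ(𝒰(d))` individually, but their sum has to vanish. This
follows from a linear map `𝒰 → 𝒰[T, T⁻¹]` with `x y ↦ x y Tᵉ` for `y` of degree `e`
(`UEA.exists_normalOrdering`). Only the triangular decomposition of `𝒰` is needed for its
construction: for a Lie algebra `L = b ⊕ n`, representations of `n` induce representations of `L`,
here obtained without the Poincaré–Birkhoff–Witt theorem (`exists_inducedRep`).
-/

namespace CurrentAlg

/-! ### Graded vector spaces -/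

section graded

variable {k M : Type*} [Field k] [AddCommGroup M] [Module k M]

/-- Linear maps on the components of a grading glue to a linear map. -/
theorem exists_linearMap_of_isInternal {N : Type*} [AddCommGroup N] [Module k N]
    {F : ℤ → Submodule k M} (hF : DirectSum.IsInternal F) (f : ℤ → M →ₗ[k] N) :
    ∃ g : M →ₗ[k] N, ∀ d, ∀ x ∈ F d, g x = f d x := by
  let e := LinearEquiv.ofBijective (DirectSum.coeLinearMap F) hF
  refine ⟨DirectSum.toModule k ℤ N (fun d => f d ∘ₗ (F d).subtype) ∘ₗ e.symm.toLinearMap,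
    fun d x hx => ?_⟩
  have : e.symm x = DirectSum.lof k ℤ (fun d => F d) d ⟨x, hx⟩ := by
    rw [LinearEquiv.symm_apply_eq]
    exact (DirectSum.coeLinearMap_lof F d ⟨x, hx⟩).symm
  simp [this]

/-- Eigenspaces of an operator are independent; this is how gradings are recognised below. -/
theorem iSupIndep_of_eigen [CharZero k] {F : ℤ → Submodule k M} (D : M →ₗ[k] M)
    (h : ∀ d, ∀ x ∈ F d, D x = (d : k) • x) : iSupIndep F := by
  have h1 := (Module.End.eigenspaces_iSupIndep D).comp
    (f := fun d : ℤ => (d : k)) Int.cast_injective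
  exact h1.mono fun d x hx => Module.End.mem_eigenspace_iff.2 (h d x hx)

/-- For `C_e ⊆ F_e` with the `F_e` independent, `F_d ∩ ∑ C_e = C_d`. -/
theorem mem_of_mem_iSup_of_iSupIndep {ι : Type*} {F C : ι → Submodule k M} (hF : iSupIndep F)
    (hC : ∀ d, C d ≤ F d) {d : ι} {x : M} (hx : x ∈ F d) (hx' : x ∈ ⨆ e, C e) : x ∈ C d := by
  have h1 : (⨆ e, C e) ≤ C d ⊔ ⨆ (e : ι) (_ : e ≠ d), F e := by
    refine iSup_le fun e => ?_
    by_cases h : e = d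
    · subst h; exact le_sup_left
    · exact le_sup_of_le_right (le_iSup₂_of_le (f := fun e (_ : e ≠ d) => F e) e h (hC e))
  obtain ⟨a, ha, b, hb, rfl⟩ := Submodule.mem_sup.1 (h1 hx')
  have hb' : b ∈ F d := by
    have := sub_mem hx (hC d ha)
    rwa [add_sub_cancel_left] at this
  rw [(Submodule.disjoint_def.1 (hF d)) b hb' hb, add_zero]
  exact ha

/-- The images of an independent family in the quotient by a homogeneous subspace are
independent. -/
theorem iSupIndep_map_of_ker {N : Type*} [AddCommGroup N] [Module k N] {F : ℤ → Submodule k M}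
    (hF : iSupIndep F) (f : M →ₗ[k] N) (hC : LinearMap.ker f ≤ ⨆ d, LinearMap.ker f ⊓ F d) :
    iSupIndep fun d => (F d).map f := by
  rw [iSupIndep_def]
  intro d
  rw [Submodule.disjoint_def]
  rintro _ ⟨x, hx, rfl⟩ h
  simp_rw [← Submodule.map_iSup] at h
  obtain ⟨y, hy, hxy⟩ := h
  have h1 : LinearMap.ker f ≤ (LinearMap.ker f ⊓ F d) ⊔ ⨆ (e : ℤ) (_ : e ≠ d), F e := by
    refine hC.trans (iSup_le fun e => ?_)
    by_cases h : e = d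
    · subst h; exact le_sup_left
    · exact le_sup_of_le_right (le_iSup₂_of_le (f := fun e (_ : e ≠ d) => F e) e h inf_le_right)
  have h2 : x - y ∈ LinearMap.ker f := by rw [LinearMap.mem_ker, map_sub, hxy, sub_self]
  obtain ⟨a, ha, b, hb, hab⟩ := Submodule.mem_sup.1 (h1 h2)
  have h3 : x - a ∈ ⨆ (e : ℤ) (_ : e ≠ d), F e := by
    have := add_mem hb hy
    rwa [show x - a = b + y by rw [sub_eq_iff_eq_add, sub_eq_iff_eq_add.1 hab.symm]; abel]
  have h4 := (Submodule.disjoint_def.1 (hF d)) _ (sub_mem hx ha.2) h3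
  rw [sub_eq_zero.1 h4]
  exact ha.1

end graded

/-! ### Degreewise completions -/

namespace DegreewiseTop

section separated

variable {k A : Type*} [Field k] [Ring A] [Algebra k A] (T : DegreewiseTop k A)

theorem iSupIndep_cauchySeq (hT : iSupIndep T.deg) : iSupIndep T.cauchySeq := by
  rw [iSupIndep_def]
  intro d
  rw [Submodule.disjoint_def]
  intro a ha ha'
  have h : (⨆ (e : ℤ) (_ : e ≠ d), T.cauchySeq e) ≤
      Submodule.pi Set.univ fun _ => ⨆ (e : ℤ) (_ : e ≠ d), T.deg e :=
    iSup₂_le fun e he a ha i _ => (le_iSup₂_of_le (f := fun e (_ : e ≠ d) => T.deg e) e he le_rfl)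
      (ha.1 i)
  ext i
  exact (Submodule.disjoint_def.1 (hT d)) _ (ha.1 i) (h ha' i trivial)

theorem nullSeq_le_eventuallySeq (d : ℤ) (n : ℕ) : T.nullSeq d ≤ T.eventuallySeq d n :=
  iInf_le _ n

theorem nullSeq_le_cauchySeq (d : ℤ) : T.nullSeq d ≤ T.cauchySeq d :=
  fun _ ha => (T.nullSeq_le_eventuallySeq d 0 ha).1

theorem mem_nullSeq_of_mem_nullIdeal (hT : iSupIndep T.deg) {d : ℤ} {a : ℕ → A}
    (ha : a ∈ T.cauchySeq d) (h : a ∈ ⨆ e, T.nullSeq e) : a ∈ T.nullSeq d :=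
  mem_of_mem_iSup_of_iSupIndep (T.iSupIndep_cauchySeq hT) T.nullSeq_le_cauchySeq ha h

/-- A Cauchy sequence represents an element of `Iₙ(Â(d))` only if it is eventually in
`Iₙ(A(d))`. -/
theorem mem_eventuallySeq_of_mk_mem (hT : iSupIndep T.deg) {d : ℤ} {n : ℕ} {a : ℕ → A}
    (ha : a ∈ T.cauchySeq d) (h : T.limit a ha ∈ T.completion.nhd d n) :
    a ∈ T.eventuallySeq d n := by
  obtain ⟨⟨b, hb'⟩, hb, h⟩ := h
  have h1 : b - a ∈ ⨆ e, T.nullSeq e := Ideal.Quotient.eq.1 h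
  have h2 := T.mem_nullSeq_of_mem_nullIdeal hT (sub_mem hb.1 ha) h1
  have hb : b ∈ T.eventuallySeq d n := hb
  have := sub_mem hb (T.nullSeq_le_eventuallySeq d n (show b - a ∈ T.nullSeq d from h2))
  rwa [sub_sub_cancel] at this

theorem mem_nhd_of_of_mem (hT : iSupIndep T.deg) {d : ℤ} {n : ℕ} {a : A} (ha : a ∈ T.deg d)
    (h : T.of a ∈ T.completion.nhd d n) : a ∈ T.nhd d n := by
  obtain ⟨_, M, hM⟩ := T.mem_eventuallySeq_of_mk_mem hT (T.const_mem_cauchySeq ha) h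
  exact hM M le_rfl

/-- The completion is separated. -/
theorem eq_zero_of_forall_mem_nhd (hT : iSupIndep T.deg) {d : ℤ} {x : T.Completion}
    (h : ∀ n, x ∈ T.completion.nhd d n) : x = 0 := by
  obtain ⟨⟨a, ha'⟩, ha, rfl⟩ := T.completion.nhd_le d 0 (h 0)
  refine Ideal.Quotient.eq_zero_iff_mem.2 (le_iSup T.nullSeq d ?_)
  change a ∈ T.nullSeq d
  simp only [nullSeq, Submodule.mem_iInf]
  exact fun n => T.mem_eventuallySeq_of_mk_mem hT ha (h n)

theorem limit_sub_of_mem {d : ℤ} {n : ℕ} {a : ℕ → A} (ha : a ∈ T.cauchySeq d) :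
    ∃ M, ∀ i, M ≤ i → T.limit a ha - T.of (a i) ∈ T.completion.nhd d n := by
  obtain ⟨M, hM⟩ := ha.2 n
  refine ⟨M, fun i hi => ⟨⟨a, T.mem_cauchySubalg_of_mem ha⟩ -
    ⟨fun _ => a i, T.const_mem_cauchySubalg _⟩, ?_, rfl⟩⟩
  exact ⟨sub_mem ha (T.const_mem_cauchySeq (ha.1 i)), M, fun j hj => hM j hj i hi⟩

theorem of_mem_nhd {d : ℤ} {n : ℕ} {a : A} (ha : a ∈ T.nhd d n) :
    T.of a ∈ T.completion.nhd d n :=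
  ⟨⟨fun _ => a, T.const_mem_cauchySubalg a⟩,
    ⟨T.const_mem_cauchySeq (T.nhd_le d n ha), 0, fun _ _ => ha⟩, rfl⟩

theorem limit_mem_closure {d : ℤ} {G : Submodule k A} {a : ℕ → A} (ha : a ∈ T.cauchySeq d)
    (hG : ∀ i, a i ∈ G) :
    T.limit a ha ∈ T.completion.closure ((G ⊓ T.deg d).map T.of.toLinearMap) d :=
  ⟨T.limit_mem ha, fun _ =>
    let ⟨M, hM⟩ := T.limit_sub_of_mem ha
    ⟨_, ⟨a M, ⟨hG M, ha.1 M⟩, rfl⟩, hM M le_rfl⟩⟩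

end separated

section map

variable {k A B : Type*} [Field k] [Ring A] [Algebra k A] [Ring B] [Algebra k B]
  (T : DegreewiseTop k A) (T' : DegreewiseTop k B)

/-- Algebra homomorphisms preserving the gradings which are continuous on each homogeneous
subspace. -/
structure IsContHom (f : A →ₐ[k] B) : Prop where
  map_deg : ∀ d, ∀ a ∈ T.deg d, f a ∈ T'.deg d
  continuous : ∀ d n, ∃ m, ∀ a ∈ T.nhd d m, f a ∈ T'.nhd d n

variable {T T'} {f : A →ₐ[k] B}

/-- The homomorphism induced on sequences. -/
def seqMap (f : A →ₐ[k] B) : (ℕ → A) →ₐ[k] (ℕ → B) :=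
  AlgHom.pi fun i => f.comp (Pi.evalAlgHom k (fun _ => A) i)

theorem seqMap_apply (f : A →ₐ[k] B) (a : ℕ → A) (i : ℕ) : seqMap f a i = f (a i) := rfl

theorem IsContHom.seqMap_mem_cauchySeq (hf : IsContHom T T' f) {d : ℤ} {a : ℕ → A}
    (ha : a ∈ T.cauchySeq d) : seqMap f a ∈ T'.cauchySeq d := by
  refine ⟨fun i => hf.map_deg d _ (ha.1 i), fun n => ?_⟩
  obtain ⟨m, hm⟩ := hf.continuous d n
  obtain ⟨M, hM⟩ := ha.2 m
  refine ⟨M, fun i hi j hj => ?_⟩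
  rw [seqMap_apply, seqMap_apply, ← map_sub]
  exact hm _ (hM i hi j hj)

theorem IsContHom.seqMap_mem_eventuallySeq (hf : IsContHom T T' f) {d : ℤ} {m n : ℕ}
    (h : ∀ a ∈ T.nhd d m, f a ∈ T'.nhd d n) {a : ℕ → A} (ha : a ∈ T.eventuallySeq d m) :
    seqMap f a ∈ T'.eventuallySeq d n := by
  obtain ⟨ha, M, hM⟩ := ha
  exact ⟨hf.seqMap_mem_cauchySeq ha, M, fun i hi => h _ (hM i hi)⟩

theorem IsContHom.seqMap_mem_nullSeq (hf : IsContHom T T' f) {d : ℤ} {a : ℕ → A}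
    (ha : a ∈ T.nullSeq d) : seqMap f a ∈ T'.nullSeq d := by
  simp only [nullSeq, Submodule.mem_iInf]
  intro n
  obtain ⟨m, hm⟩ := hf.continuous d n
  exact hf.seqMap_mem_eventuallySeq hm (T.nullSeq_le_eventuallySeq d m ha)

theorem IsContHom.seqMap_mem_cauchySubalg (hf : IsContHom T T' f) (a : T.cauchySubalg) :
    seqMap f a ∈ T'.cauchySubalg := by
  have : (⨆ d, T.cauchySeq d) ≤
      (Subalgebra.toSubmodule T'.cauchySubalg).comap (seqMap f).toLinearMap :=
    iSup_le fun d a ha => T'.mem_cauchySubalg_of_mem (hf.seqMap_mem_cauchySeq ha)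
  exact this a.2

/-- The homomorphism induced on finite sums of homogeneous Cauchy sequences. -/
def IsContHom.cauchyMap (hf : IsContHom T T' f) : T.cauchySubalg →ₐ[k] T'.cauchySubalg :=
  ((seqMap f).comp T.cauchySubalg.val).codRestrict T'.cauchySubalg hf.seqMap_mem_cauchySubalg

theorem IsContHom.cauchyMap_mem_nullIdeal (hf : IsContHom T T' f) (a : T.cauchySubalg)
    (ha : a ∈ T.nullIdeal) : hf.cauchyMap a ∈ T'.nullIdeal := by
  have : (⨆ d, T.nullSeq d) ≤ (⨆ d, T'.nullSeq d).comap (seqMap f).toLinearMap :=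
    iSup_le fun d a ha => le_iSup T'.nullSeq d (hf.seqMap_mem_nullSeq ha)
  exact this ha

/-- The homomorphism induced on degreewise completions. -/
def IsContHom.completionMap (hf : IsContHom T T' f) : T.Completion →ₐ[k] T'.Completion :=
  Ideal.Quotient.liftₐ T.nullIdeal ((Ideal.Quotient.mkₐ k T'.nullIdeal).comp hf.cauchyMap)
    fun a ha => Ideal.Quotient.eq_zero_iff_mem.2 (hf.cauchyMap_mem_nullIdeal a ha)

theorem IsContHom.completionMap_mk (hf : IsContHom T T' f) (a : T.cauchySubalg) :
    hf.completionMap (Ideal.Quotient.mk T.nullIdeal a) =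
      Ideal.Quotient.mk T'.nullIdeal (hf.cauchyMap a) := rfl

theorem IsContHom.completionMap_limit (hf : IsContHom T T' f) {d : ℤ} {a : ℕ → A}
    (ha : a ∈ T.cauchySeq d) : hf.completionMap (T.limit a ha) =
      T'.limit (seqMap f a) (hf.seqMap_mem_cauchySeq ha) := rfl

theorem IsContHom.completionMap_mem_nhd (hf : IsContHom T T' f) {d : ℤ} {m n : ℕ}
    (h : ∀ a ∈ T.nhd d m, f a ∈ T'.nhd d n) :
    ∀ x ∈ T.completion.nhd d m, hf.completionMap x ∈ T'.completion.nhd d n := by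
  rintro _ ⟨a, ha, rfl⟩
  exact ⟨hf.cauchyMap a, hf.seqMap_mem_eventuallySeq h ha, rfl⟩

/-- The induced homomorphism of completions is again graded and continuous. -/
theorem IsContHom.completion (hf : IsContHom T T' f) :
    IsContHom T.completion T'.completion hf.completionMap where
  map_deg := by
    rintro d _ ⟨a, ha, rfl⟩
    exact ⟨hf.cauchyMap a, hf.seqMap_mem_cauchySeq ha, rfl⟩
  continuous d n := (hf.continuous d n).imp fun _ hm => hf.completionMap_mem_nhd hm

/-- A continuous homomorphism with dense image which is open onto its image induces a surjection
of completions: a Cauchy sequence in the target is lifted by successive approximation. -/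
theorem IsContHom.completionMap_surjective (hf : IsContHom T T' f)
    (hdense : ∀ d n, ∀ b ∈ T'.deg d, ∃ a ∈ T.deg d, b - f a ∈ T'.nhd d n)
    (hopen : ∀ d m n, ∀ b ∈ T'.nhd d n, ∃ a ∈ T.nhd d n, b - f a ∈ T'.nhd d m) :
    Function.Surjective hf.completionMap := by
  have key : ∀ d, ∀ b ∈ T'.cauchySeq d, ∃ a ∈ T.cauchySeq d, seqMap f a - b ∈ T'.nullSeq d := by
    intro d b hb
    choose M hM using hb.2
    -- an increasing modulus of convergence
    let N : ℕ → ℕ := fun n => ∑ i ∈ Finset.range (n + 1), M i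
    have hMN : ∀ n, M n ≤ N n := fun n =>
      Finset.single_le_sum (f := M) (fun _ _ => Nat.zero_le _) (Finset.mem_range.2 (by omega))
    have hN : ∀ m n, m ≤ n → N m ≤ N n := fun m n h =>
      Finset.sum_le_sum_of_subset (Finset.range_subset_range.2 (by omega))
    have hb' : ∀ n, b (N (n + 1)) - b (N n) ∈ T'.nhd d n := fun n =>
      hM n _ ((hMN n).trans (hN _ _ (by omega))) _ (hMN n)
    have step : ∀ (n : ℕ) (x : {x // x ∈ T.deg d ∧ b (N n) - f x ∈ T'.nhd d n}),
        ∃ y : {x // x ∈ T.deg d ∧ b (N (n + 1)) - f x ∈ T'.nhd d (n + 1)},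
          (y : A) - x ∈ T.nhd d n := by
      rintro n ⟨x, hx, hx'⟩
      obtain ⟨a, ha, ha'⟩ := hopen d (n + 1) n _ (add_mem (hb' n) hx')
      refine ⟨⟨x + a, add_mem hx (T.nhd_le d n ha), ?_⟩, by simpa using ha⟩
      rwa [sub_add_sub_cancel, sub_sub, ← map_add] at ha'
    obtain ⟨a₀, ha₀, ha₀'⟩ := hdense d 0 (b (N 0)) (hb.1 _)
    choose s hs using step
    let c : (n : ℕ) → {x // x ∈ T.deg d ∧ b (N n) - f x ∈ T'.nhd d n} := fun n =>
      Nat.rec ⟨a₀, ha₀, ha₀'⟩ (fun n x => s n x) n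
    have hc : ∀ n, (c (n + 1)).1 - (c n).1 ∈ T.nhd d n := fun n => hs n (c n)
    have hc' : ∀ n i, n ≤ i → (c i).1 - (c n).1 ∈ T.nhd d n := by
      intro n i hi
      induction i, hi using Nat.le_induction with
      | base => simp
      | succ i hi ih =>
        have := add_mem (T.nhd_anti d hi (hc i)) ih
        rwa [sub_add_sub_cancel] at this
    have hcs : (fun i => (c i).1) ∈ T.cauchySeq d := by
      refine ⟨fun i => (c i).2.1, fun n => ⟨n, fun i hi j hj => ?_⟩⟩
      have := sub_mem (hc' n i hi) (hc' n j hj)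
      rwa [sub_sub_sub_cancel_right] at this
    refine ⟨_, hcs, T'.mem_nullSeq (fun i => sub_mem (hf.map_deg d _ (c i).2.1) (hb.1 i))
      fun n => ⟨max n (M n), fun i hi => ?_⟩⟩
    have h1 := T'.nhd_anti d (show n ≤ i by omega) (c i).2.2
    have h2 := hM n (N i) ((hMN n).trans (hN _ _ (by omega))) i (by omega)
    have := sub_mem h2 h1
    rwa [sub_sub_sub_cancel_left] at this
  have h : (⨆ d, T'.cauchySeq d) ≤ ((⨆ d, T.cauchySeq d).map (seqMap f).toLinearMap) ⊔
      ⨆ d, T'.nullSeq d := by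
    refine iSup_le fun d b hb => ?_
    obtain ⟨a, ha, hab⟩ := key d b hb
    refine Submodule.mem_sup.2 ⟨_, ⟨a, le_iSup T.cauchySeq d ha, rfl⟩, -(seqMap f a - b),
      neg_mem (le_iSup T'.nullSeq d hab), ?_⟩
    simp
  intro y
  obtain ⟨⟨b, hb⟩, rfl⟩ := Ideal.Quotient.mk_surjective y
  obtain ⟨_, ⟨a, ha, rfl⟩, c, hc, hab⟩ := Submodule.mem_sup.1 (h hb)
  refine ⟨Ideal.Quotient.mk T.nullIdeal ⟨a, ha⟩, ?_⟩
  rw [hf.completionMap_mk, Ideal.Quotient.eq]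
  change seqMap f a - b ∈ ⨆ d, T'.nullSeq d
  rw [← hab]
  simpa using hc

/-- A continuous homomorphism to a separated algebra which kills the generators of a closed
ideal kills the ideal. -/
theorem IsContHom.eq_zero_of_mem_closedIdeal (hf : IsContHom T T' f)
    (hsep : ∀ d, ∀ b : B, (∀ n, b ∈ T'.nhd d n) → b = 0) (S : ℤ → Set A)
    (hS : ∀ d, ∀ s ∈ S d, f s = 0) : ∀ a ∈ T.closedIdeal S, f a = 0 := by
  have h : (⨆ d, T.closure (T.genIdeal S d) d) ≤ LinearMap.ker f.toLinearMap := by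
    refine iSup_le fun d x hx => ?_
    refine hsep d _ fun n => ?_
    obtain ⟨m, hm⟩ := hf.continuous d n
    obtain ⟨y, hy, hxy⟩ := hx.2 m
    have hg : T.genIdeal S d ≤ LinearMap.ker f.toLinearMap := by
      refine Submodule.span_le.2 ?_
      rintro _ ⟨i, j, l, -, a, -, s, hs, b, -, rfl⟩
      simp [hS j s hs]
    have h1 : f y = 0 := hg hy
    have h2 := hm _ hxy
    rwa [map_sub, h1, sub_zero] at h2
  exact fun a ha => h ha

end map

end DegreewiseTop

/-! ### Poisson homomorphisms -/

/-- An algebra homomorphism compatible with the brackets on generators is compatible with the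
brackets. -/
theorem PoissonBracket.map_br_of_adjoin {k A A' L : Type*} [Field k] [Ring A] [Algebra k A]
    [Ring A'] [Algebra k A'] (B : PoissonBracket k A) (B' : PoissonBracket k A') (f : A →ₐ[k] A')
    (j : L → A) (hj : Algebra.adjoin k (Set.range j) = ⊤)
    (h : ∀ x y, f (B.br (j x) (j y)) = B'.br (f (j x)) (f (j y))) (a b : A) :
    f (B.br a b) = B'.br (f a) (f b) := by
  have hmem : ∀ a, a ∈ Algebra.adjoin k (Set.range j) := fun a => hj ▸ Algebra.mem_top
  have h1 : ∀ x b, f (B.br (j x) b) = B'.br (f (j x)) (f b) := by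
    intro x b
    induction hmem b using Algebra.adjoin_induction with
    | mem y hy => obtain ⟨y, rfl⟩ := hy; exact h x y
    | algebraMap r => simp [Algebra.algebraMap_eq_smul_one, PoissonBracket.br_one]
    | add y z _ _ hy hz => simp only [map_add, hy, hz]
    | mul y z _ _ hy hz => simp only [PoissonBracket.leibniz, map_mul, map_add, hy, hz]
  induction hmem a using Algebra.adjoin_induction with
  | mem y hy => obtain ⟨y, rfl⟩ := hy; exact h1 y b
  | algebraMap r =>
    rw [B.skew, B'.skew]
    simp [Algebra.algebraMap_eq_smul_one, PoissonBracket.br_one]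
  | add y z _ _ hy hz => simp only [map_add, LinearMap.add_apply, hy, hz]
  | mul y z _ _ hy hz => simp only [PoissonBracket.leibniz', map_mul, map_add, hy, hz]

theorem DegreewisePoisson.completionMap_br {k A A' : Type*} [Field k] [Ring A] [Algebra k A]
    [Ring A'] [Algebra k A'] (P : DegreewisePoisson k A) (P' : DegreewisePoisson k A')
    {f : A →ₐ[k] A'} (hf : DegreewiseTop.IsContHom P.toDegreewiseTop P'.toDegreewiseTop f)
    (hbr : ∀ a b, f (P.br a b) = P'.br (f a) (f b)) (x y : P.Completion) :
    hf.completionMap (P.completion.br x y) =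
      P'.completion.br (hf.completionMap x) (hf.completionMap y) := by
  obtain ⟨a, rfl⟩ := Ideal.Quotient.mk_surjective x
  obtain ⟨b, rfl⟩ := Ideal.Quotient.mk_surjective y
  refine congrArg (Ideal.Quotient.mk P'.nullIdeal) (Subtype.ext (funext fun i => ?_))
  exact hbr _ _

/-! ### Triangular decomposition -/

section triangular

open TensorProduct

attribute [local instance] LieRing.ofAssociativeRing

variable {k : Type*} [Field k]

/-- The relation `c = 1` in the universal enveloping algebra. -/
inductive CentralRel {b : Type*} [LieRing b] [LieAlgebra k b] (c : b) :
    UniversalEnvelopingAlgebra k b → UniversalEnvelopingAlgebra k b → Prop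
  | intro : CentralRel c (UniversalEnvelopingAlgebra.ι k c) 1

/-- The quotient of the universal enveloping algebra of `b` by the relation `c = 1`. -/
abbrev CentralQuot (k : Type*) [Field k] {b : Type*} [LieRing b] [LieAlgebra k b] (c : b) :=
  RingQuot (CentralRel (k := k) c)

namespace CentralQuot

variable {b : Type*} [LieRing b] [LieAlgebra k b] {c : b}

/-- The canonical map from the Lie algebra. -/
noncomputable def ι (k : Type*) [Field k] {b : Type*} [LieRing b] [LieAlgebra k b] (c : b) :
    b →ₗ[k] CentralQuot k c :=
  (RingQuot.mkAlgHom k (CentralRel (k := k) c)).toLinearMap ∘ₗ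
    (UniversalEnvelopingAlgebra.ι k : b →ₗ⁅k⁆ _).toLinearMap

theorem ι_lie (x y : b) : ι k c ⁅x, y⁆ = ι k c x * ι k c y - ι k c y * ι k c x := by
  change RingQuot.mkAlgHom k (CentralRel c) (UniversalEnvelopingAlgebra.ι k ⁅x, y⁆) = _
  rw [LieHom.map_lie, LieRing.of_associative_ring_bracket, map_sub, map_mul, map_mul]
  rfl

theorem ι_central : ι k c c = 1 :=
  (RingQuot.mkAlgHom_rel k (CentralRel.intro (c := c))).trans (map_one _)

/-- The universal property. -/
theorem exists_lift {A : Type*} [Ring A] [Algebra k A] (α : b →ₗ[k] A)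
    (hα : ∀ x y, α ⁅x, y⁆ = α x * α y - α y * α x) (hc : α c = 1) :
    ∃ f : CentralQuot k c →ₐ[k] A, ∀ x, f (ι k c x) = α x := by
  let α' : b →ₗ⁅k⁆ A := { α with map_lie' := fun {x y} => hα x y }
  refine ⟨RingQuot.liftAlgHom k ⟨UniversalEnvelopingAlgebra.lift k α', ?_⟩, fun x => ?_⟩
  · rintro _ _ ⟨⟩
    rw [UniversalEnvelopingAlgebra.lift_ι_apply, map_one]
    exact hc
  · change RingQuot.liftAlgHom k _ (RingQuot.mkAlgHom k _ _) = _
    rw [RingQuot.liftAlgHom_mkAlgHom_apply]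
    exact UniversalEnvelopingAlgebra.lift_ι_apply k α' x

theorem adjoin_ι : Algebra.adjoin k (Set.range (ι k c)) = ⊤ := by
  set S := Algebra.adjoin k (Set.range (ι k c)) with hS
  let ι' : b →ₗ⁅k⁆ S :=
    { toFun := fun x => ⟨ι k c x, Algebra.subset_adjoin ⟨x, rfl⟩⟩
      map_add' := fun x y => Subtype.ext (map_add (ι k c) x y)
      map_smul' := fun r x => Subtype.ext (map_smul (ι k c) r x)
      map_lie' := fun {x y} => Subtype.ext (ι_lie x y) }
  have h : S.val.comp (UniversalEnvelopingAlgebra.lift k ι') =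
      RingQuot.mkAlgHom k (CentralRel c) := by
    apply UniversalEnvelopingAlgebra.hom_ext
    ext x
    change ((UniversalEnvelopingAlgebra.lift k ι' (UniversalEnvelopingAlgebra.ι k x) : S) :
      CentralQuot k c) = _
    rw [UniversalEnvelopingAlgebra.lift_ι_apply]
    rfl
  rw [eq_top_iff]
  rintro x -
  obtain ⟨y, rfl⟩ := RingQuot.mkAlgHom_surjective k (CentralRel c) x
  rw [← h]
  exact (UniversalEnvelopingAlgebra.lift k ι' y).2

end CentralQuot

/-- A subspace containing the generators and stable under left multiplication by the generators of
the algebra is everything. -/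
theorem tensor_induction {B E b : Type*} [Ring B] [Algebra k B] [AddCommGroup E] [Module k E]
    (i : b → B) (hi : Algebra.adjoin k (Set.range i) = ⊤) (S : Submodule k (B ⊗[k] E))
    (h1 : ∀ e, (1 : B) ⊗ₜ[k] e ∈ S)
    (h2 : ∀ x, ∀ m ∈ S, (LinearMap.mulLeft k (i x)).rTensor E m ∈ S) (m : B ⊗[k] E) : m ∈ S := by
  have h3 : ∀ a : B, ∀ m ∈ S, (LinearMap.mulLeft k a).rTensor E m ∈ S := by
    intro a
    have ha : a ∈ Algebra.adjoin k (Set.range i) := hi ▸ Algebra.mem_top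
    induction ha using Algebra.adjoin_induction with
    | mem x hx => obtain ⟨x, rfl⟩ := hx; exact h2 x
    | algebraMap r =>
      intro m hm
      have : LinearMap.mulLeft k (algebraMap k B r) = r • LinearMap.id := by
        ext x; simp [Algebra.algebraMap_eq_smul_one]
      rw [this, LinearMap.rTensor_smul, LinearMap.rTensor_id]
      exact S.smul_mem r hm
    | add x y _ _ hx hy =>
      intro m hm
      have : LinearMap.mulLeft k (x + y) = LinearMap.mulLeft k x + LinearMap.mulLeft k y := by
        ext z; simp [add_mul]
      rw [this, LinearMap.rTensor_add]
      exact S.add_mem (hx m hm) (hy m hm)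
    | mul x y _ _ hx hy =>
      intro m hm
      rw [LinearMap.mulLeft_mul, LinearMap.rTensor_comp]
      exact hx _ (hy m hm)
  induction m using TensorProduct.induction_on with
  | zero => exact S.zero_mem
  | tmul a e => simpa using h3 a _ (h1 e)
  | add x y hx hy => exact S.add_mem hx hy

variable {L : Type*} [LieRing L] [LieAlgebra k L]

/-- The representation of `L = b ⊕ n` induced from a representation of `n` on `E`, on the space
`U(b) / (c - 1) ⊗ E`.

The operators `m ↦ ρ(x)m` are found all at once, as a `b`-linear map `m ↦ (x ↦ ρ(x)m)` to the
`b`-module of linear maps on `L`; such a map is determined by its values on `1 ⊗ E`. -/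
theorem exists_inducedRep (b n : LieSubalgebra k L) (hbn : IsCompl b.toSubmodule n.toSubmodule)
    (c : b) (hc : ∀ x : L, ⁅x, (c : L)⁆ = 0) {E : Type*} [AddCommGroup E] [Module k E]
    (ψ : L →ₗ[k] E →ₗ[k] E)
    (hψ : ∀ x ∈ n, ∀ y ∈ n, ∀ e, ψ ⁅x, y⁆ e = ψ x (ψ y e) - ψ y (ψ x e)) :
    ∃ ρ : L →ₗ[k] (CentralQuot k c ⊗[k] E) →ₗ[k] (CentralQuot k c ⊗[k] E),
      (∀ x y m, ρ ⁅x, y⁆ m = ρ x (ρ y m) - ρ y (ρ x m)) ∧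
      (∀ x : b, ∀ m, ρ x m = (LinearMap.mulLeft k (CentralQuot.ι k c x)).rTensor E m) ∧
      ∀ y ∈ n, ∀ e, ρ y (1 ⊗ₜ e) = 1 ⊗ₜ ψ y e := by
  set B := CentralQuot k c
  set M := B ⊗[k] E
  let l : b →ₗ[k] (M →ₗ[k] M) :=
    { toFun := fun x => (LinearMap.mulLeft k (CentralQuot.ι k c x)).rTensor E
      map_add' := fun x y => by
        rw [← LinearMap.rTensor_add]; congr 1; ext z; simp [add_mul]
      map_smul' := fun r x => by
        rw [RingHom.id_apply, ← LinearMap.rTensor_smul]; congr 1; ext z; simp }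
  have l_lie : ∀ x y m, l ⁅x, y⁆ m = l x (l y m) - l y (l x m) := by
    intro x y m
    induction m using TensorProduct.induction_on with
    | zero => simp
    | tmul a e =>
      change (CentralQuot.ι k c ⁅x, y⁆ * a) ⊗ₜ[k] e = (CentralQuot.ι k c x *
        (CentralQuot.ι k c y * a)) ⊗ₜ[k] e -
          (CentralQuot.ι k c y * (CentralQuot.ι k c x * a)) ⊗ₜ[k] e
      rw [← TensorProduct.sub_tmul, CentralQuot.ι_lie, sub_mul, mul_assoc, mul_assoc]
    | add m m' h h' => simp only [map_add, h, h']; abel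
  have l_c : ∀ m, l c m = m := by
    intro m
    change (LinearMap.mulLeft k (CentralQuot.ι k c c)).rTensor E m = m
    rw [CentralQuot.ι_central, LinearMap.mulLeft_one, LinearMap.rTensor_id, LinearMap.id_apply]
  -- the action of `b` on linear maps `L → M`
  let α : b →ₗ[k] Module.End k (L →ₗ[k] M) :=
    LinearMap.mk₂ k (fun x φ => l x ∘ₗ φ - φ ∘ₗ (LieAlgebra.ad k L x : L →ₗ[k] L))
      (fun x y φ => by ext z; simp; abel) (fun r x φ => by ext z; simp [smul_sub])
      (fun x φ φ' => by ext z; simp; abel) (fun r x φ => by ext z; simp [smul_sub])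
  have α_apply : ∀ (x : b) (φ : L →ₗ[k] M) (z : L), α x φ z = l x (φ z) - φ ⁅(x : L), z⁆ :=
    fun _ _ _ => rfl
  have α_lie : ∀ x y : b, α ⁅x, y⁆ = α x * α y - α y * α x := by
    intro x y
    refine LinearMap.ext fun φ => LinearMap.ext fun z => ?_
    simp only [LinearMap.sub_apply, Module.End.mul_apply, α_apply, l_lie, map_sub,
      LieSubalgebra.coe_bracket, lie_lie]
    abel
  have α_c : α c = 1 := by
    refine LinearMap.ext fun φ => LinearMap.ext fun z => ?_
    rw [α_apply, l_c, ← lie_skew, hc, neg_zero, map_zero, sub_zero]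
    rfl
  obtain ⟨Λ, hΛ⟩ := CentralQuot.exists_lift (c := c) (A := Module.End k (L →ₗ[k] M)) α α_lie
    α_c
  let pb : L →ₗ[k] b := b.toSubmodule.projectionOnto n.toSubmodule hbn
  let pn : L →ₗ[k] n := n.toSubmodule.projectionOnto b.toSubmodule hbn.symm
  have hpb : ∀ x : b, pb x = x := fun x => Submodule.projectionOnto_apply_left hbn x
  have hpb' : ∀ x ∈ n, pb x = 0 := fun x hx =>
    (Submodule.projectionOnto_apply_eq_zero_iff hbn).2 hx
  have hpn : ∀ x ∈ n, (pn x : L) = x := fun x hx =>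
    congrArg Subtype.val (Submodule.projectionOnto_apply_left hbn.symm ⟨x, hx⟩)
  have hpn' : ∀ x ∈ b, pn x = 0 := fun x hx =>
    (Submodule.projectionOnto_apply_eq_zero_iff hbn.symm).2 hx
  let φ₀ : E →ₗ[k] (L →ₗ[k] M) :=
    LinearMap.mk₂ k (fun e x => CentralQuot.ι k c (pb x) ⊗ₜ[k] e + (1 : B) ⊗ₜ[k] ψ (pn x) e)
      (fun e e' x => by simp [TensorProduct.tmul_add]; abel)
      (fun r e x => by simp [TensorProduct.tmul_smul])
      (fun e x x' => by simp [TensorProduct.tmul_add, TensorProduct.add_tmul]; abel)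
      (fun r e x => by simp [TensorProduct.tmul_smul, ← TensorProduct.smul_tmul'])
  have φ₀_apply : ∀ e x, φ₀ e x = CentralQuot.ι k c (pb x) ⊗ₜ[k] e + (1 : B) ⊗ₜ[k] ψ (pn x) e :=
    fun _ _ => rfl
  let Θ : M →ₗ[k] (L →ₗ[k] M) :=
    TensorProduct.lift (LinearMap.mk₂ k (fun a e => Λ a (φ₀ e)) (fun a a' e => by simp)
      (fun r a e => by simp) (fun a e e' => by simp) (fun r a e => by simp))
  have Θ_tmul : ∀ a e, Θ (a ⊗ₜ e) = Λ a (φ₀ e) := fun _ _ => rfl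
  have Θ_l : ∀ x m, Θ (l x m) = α x (Θ m) := by
    intro x m
    induction m using TensorProduct.induction_on with
    | zero => simp
    | tmul a e =>
      change Θ ((CentralQuot.ι k c x * a) ⊗ₜ[k] e) = _
      rw [Θ_tmul, Θ_tmul, map_mul, hΛ]
      rfl
    | add m m' h h' => simp only [map_add, h, h']
  let ρ : L →ₗ[k] M →ₗ[k] M := Θ.flip
  have ρ_l : ∀ (x : L) (y : b) (m : M), ρ x (l y m) = l y (ρ x m) + ρ ⁅x, (y : L)⁆ m := by
    intro x y m
    change Θ (l y m) x = l y (Θ m x) + Θ m ⁅x, (y : L)⁆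
    rw [Θ_l, α_apply, ← lie_skew x, map_neg, ← sub_eq_add_neg]
  have ρ_one : ∀ x e, ρ x ((1 : B) ⊗ₜ[k] e) =
      CentralQuot.ι k c (pb x) ⊗ₜ[k] e + (1 : B) ⊗ₜ[k] ψ (pn x) e := by
    intro x e
    change Θ ((1 : B) ⊗ₜ[k] e) x = _
    rw [Θ_tmul, map_one]
    exact φ₀_apply e x
  have ρ_b : ∀ (x : b) m, ρ x m = l x m := by
    intro x m
    have := tensor_induction (CentralQuot.ι k c) CentralQuot.adjoin_ι
      (⨅ x : b, LinearMap.ker (ρ x - l x)) (fun e => ?_) (fun y m hm => ?_) m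
    · rw [Submodule.mem_iInf] at this
      simpa [sub_eq_zero] using this x
    · rw [Submodule.mem_iInf]
      intro x
      rw [LinearMap.mem_ker, LinearMap.sub_apply, ρ_one, hpb, hpn' _ x.2, sub_eq_zero]
      change _ = (CentralQuot.ι k c x * 1) ⊗ₜ[k] e
      simp
    · rw [Submodule.mem_iInf] at hm ⊢
      simp only [LinearMap.mem_ker, LinearMap.sub_apply, sub_eq_zero] at hm ⊢
      intro x
      change ρ x (l y m) = l x (l y m)
      have h := hm ⁅x, y⁆
      rw [LieSubalgebra.coe_bracket] at h
      rw [ρ_l, hm, h, l_lie]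
      abel
  have ρ_n : ∀ y ∈ n, ∀ e, ρ y ((1 : B) ⊗ₜ[k] e) = 1 ⊗ₜ ψ y e := by
    intro y hy e
    rw [ρ_one, hpb' y hy, hpn y hy, map_zero, TensorProduct.zero_tmul, zero_add]
  refine ⟨ρ, fun x y m => ?_, ρ_b, ρ_n⟩
  let C : L → L → M →ₗ[k] M := fun x y => ρ ⁅x, y⁆ - (ρ x ∘ₗ ρ y - ρ y ∘ₗ ρ x)
  have hC : ∀ x y m, C x y m = ρ ⁅x, y⁆ m - (ρ x (ρ y m) - ρ y (ρ x m)) := fun _ _ _ => rfl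
  have := tensor_induction (CentralQuot.ι k c) CentralQuot.adjoin_ι
    (⨅ x : L, ⨅ y : L, LinearMap.ker (C x y)) (fun e => ?_) (fun z m hm => ?_) m
  · simp only [Submodule.mem_iInf] at this
    exact sub_eq_zero.1 (this x y)
  · simp only [Submodule.mem_iInf, LinearMap.mem_ker]
    intro x y
    have hx : x ∈ b.toSubmodule ⊔ n.toSubmodule := hbn.sup_eq_top ▸ Submodule.mem_top
    have hy : y ∈ b.toSubmodule ⊔ n.toSubmodule := hbn.sup_eq_top ▸ Submodule.mem_top
    obtain ⟨x₁, hx₁, x₂, hx₂, rfl⟩ := Submodule.mem_sup.1 hx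
    obtain ⟨y₁, hy₁, y₂, hy₂, rfl⟩ := Submodule.mem_sup.1 hy
    have hl : ∀ x ∈ b, ∀ y m, C x y m = 0 := by
      intro x hx y m
      have h1 := ρ_b ⟨x, hx⟩
      have h2 := ρ_l y ⟨x, hx⟩ m
      simp only at h1 h2
      rw [hC, h1 m, h1 (ρ y m), h2, ← lie_skew, map_neg, LinearMap.neg_apply]
      abel
    have hr : ∀ x, ∀ y ∈ b, ∀ m, C x y m = 0 := by
      intro x y hy m
      have h1 := hl y hy x m
      rw [hC] at h1 ⊢
      rw [← lie_skew, map_neg, LinearMap.neg_apply, ← neg_eq_zero, ← h1]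
      abel
    have hn : C x₂ y₂ (1 ⊗ₜ e) = 0 := by
      rw [hC, ρ_n _ hx₂, ρ_n _ hy₂, ρ_n _ hx₂, ρ_n _ hy₂, ρ_n _ (n.lie_mem hx₂ hy₂),
        hψ _ hx₂ _ hy₂, TensorProduct.tmul_sub, sub_self]
    have e1 : C (x₁ + x₂) (y₁ + y₂) (1 ⊗ₜ e) = C x₁ (y₁ + y₂) (1 ⊗ₜ e) + C x₂ y₁ (1 ⊗ₜ e) +
        C x₂ y₂ (1 ⊗ₜ e) := by
      simp only [hC, add_lie, lie_add, map_add, LinearMap.add_apply]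
      abel
    rw [e1, hl _ hx₁, hr _ _ hy₁, hn, add_zero, add_zero]
  · simp only [Submodule.mem_iInf, LinearMap.mem_ker] at hm ⊢
    intro x y
    change C x y (l z m) = 0
    have e1 : ρ ⁅x, y⁆ m = ρ x (ρ y m) - ρ y (ρ x m) := sub_eq_zero.1 (hm x y)
    have e2 : ρ ⁅x, ⁅y, (z : L)⁆⁆ m = ρ x (ρ ⁅y, (z : L)⁆ m) - ρ ⁅y, (z : L)⁆ (ρ x m) :=
      sub_eq_zero.1 (hm x _)
    have e3 : ρ ⁅⁅x, (z : L)⁆, y⁆ m = ρ ⁅x, (z : L)⁆ (ρ y m) - ρ y (ρ ⁅x, (z : L)⁆ m) :=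
      sub_eq_zero.1 (hm _ y)
    have e4 : ⁅⁅x, y⁆, (z : L)⁆ = ⁅⁅x, (z : L)⁆, y⁆ + ⁅x, ⁅y, (z : L)⁆⁆ := by
      rw [lie_lie x y, lie_lie x z, ← lie_skew (z : L), lie_neg, ← lie_skew y ⁅x, (z : L)⁆,
        lie_lie x z y]
      simp only [← lie_skew y z, lie_neg, neg_neg]
      abel
    rw [hC]
    simp only [ρ_l, map_add, e4, LinearMap.add_apply, e1, e2, e3, map_sub]
    abel

end triangular

/-- If `w` acts on the generators of degree `d` by `d`, it acts on products of generators of total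
degree `d` by `d`. -/
theorem PoissonBracket.br_eq_smul_of_mem_wordSpan {k A L : Type*} [Field k] [Ring A] [Algebra k A]
    [AddCommGroup L] [Module k L] (F : ℤ → Submodule k L) (j : L →ₗ[k] A)
    (B : PoissonBracket k A) (w : A) (h : ∀ d, ∀ x ∈ F d, B.br w (j x) = (d : k) • j x) {d : ℤ}
    {a : A} (ha : a ∈ wordSpan F j d) : B.br w a = (d : k) • a := by
  have : wordSpan F j d ≤ LinearMap.ker (B.br w - (d : k) • (LinearMap.id : A →ₗ[k] A)) := by
    refine Submodule.span_le.2 ?_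
    rintro _ ⟨l, hl, rfl, rfl⟩
    rw [SetLike.mem_coe, LinearMap.mem_ker, LinearMap.sub_apply, LinearMap.smul_apply, sub_eq_zero,
      LinearMap.id_apply]
    clear ha
    induction l with
    | nil => simp [B.br_one]
    | cons y l ih =>
      have hl' : ∀ y ∈ l, y.2 ∈ F y.1 := fun z hz => hl z (List.mem_cons_of_mem _ hz)
      simp only [List.map_cons, List.prod_cons, List.sum_cons, B.leibniz, ih hl',
        h _ _ (hl y List.mem_cons_self)]
      rw [Int.cast_add, add_smul, smul_mul_assoc, mul_smul_comm]
  exact sub_eq_zero.1 (this ha)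

namespace VertexOperatorAlgebra

variable {k V : Type*} [Field k] [AddCommGroup V] [Module k V] (X : VertexOperatorAlgebra k V)
  [CharZero k]

/-! ### The grading of the current Lie algebra -/

namespace CurrentLie

theorem lie_J (r s m n : ℤ) (u v : V) (N : ℕ) (hN : ∀ i : ℕ, N ≤ i → X.prod i u v = 0) :
    ⁅J X r m u, J X s n v⁆ = ∑ i ∈ Finset.range N, Ring.choose (m + r - 1) i •
      J X (r + s - i - 1) (m + n) (X.prod i u v) := by
  change mk X (X.loopBracket (Finsupp.single _ u) (Finsupp.single _ v)) = _
  rw [X.loopBracket_single u v _ _ N hN, map_sum]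
  refine Finset.sum_congr rfl fun i _ => ?_
  rw [map_zsmul, show m + r - 1 + (n + s - 1) - (i : ℤ) = m + n + (r + s - i - 1) - 1 by ring]
  rfl

/-- The element `J₀(ω)` acts on `𝔤(d)` by `d`: the degree is an eigenvalue. -/
theorem lie_conf_J {r : ℤ} {u : V} (hu : u ∈ X.wt r) (n : ℤ) :
    ⁅J X 2 0 X.conf, J X r n u⁆ = ((-n : ℤ) : k) • J X r n u := by
  obtain ⟨N, hN⟩ := X.trunc X.conf u
  have hc : Ring.choose (1 : ℤ) 1 = 1 := Ring.choose_one_right 1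
  rw [lie_J X 2 r 0 n X.conf u (N + 2) (fun i hi => hN i (by omega)), Finset.sum_range_succ',
    Finset.sum_range_succ', Finset.sum_eq_zero (s := Finset.range N)]
  · have h1 : J X (2 + r - (0 : ℕ) - 1) (0 + n) (X.prod (0 : ℕ) X.conf u) =
        -(((n + r : ℤ) : k) • J X r n u) := by
      have h := mk_eq_zero (X := X) ⟨Finsupp.single (n + r) u, rfl⟩
      rw [X.del_single, map_add, ← Int.cast_smul_eq_zsmul k, map_smul, X.translation] at h
      rw [← eq_neg_iff_add_eq_zero] at h
      rw [Nat.cast_zero]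
      refine Eq.trans ?_ h
      rw [J, LinearMap.comp_apply, Finsupp.lsingle_apply,
        show 0 + n + (2 + r - 0 - 1) - 1 = n + r by ring]
    have h2 : J X (2 + r - (0 + 1 : ℕ) - 1) (0 + n) (X.prod (0 + 1 : ℕ) X.conf u) =
        (r : k) • J X r n u := by
      have := (X.mem_wt_iff r u).1 hu
      rw [show ((0 + 1 : ℕ) : ℤ) = 1 by norm_num, this, map_smul,
        show 2 + r - 1 - 1 = r by ring, zero_add]
    rw [h1, h2, show (0 : ℤ) + 2 - 1 = 1 by norm_num]
    simp only [zero_add, hc, Ring.choose_zero_right, one_smul,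
      ← neg_smul, ← add_smul]
    congr 1
    push_cast
    ring
  · intro i _
    have : Ring.choose (0 + 2 - 1 : ℤ) (i + 1 + 1) = 0 := by
      have := Ring.choose_natCast (R := ℤ) 1 (i + 1 + 1)
      rw [Nat.choose_eq_zero_of_lt (by omega)] at this
      simpa using this
    rw [this, zero_smul]

theorem lie_conf {d : ℤ} {x : X.CurrentLie} (hx : x ∈ deg X d) :
    ⁅J X 2 0 X.conf, x⁆ = (d : k) • x := by
  have : deg X d ≤ LinearMap.ker (bracket X (J X 2 0 X.conf) - (d : k) • LinearMap.id) := by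
    refine iSup_le fun r => ?_
    rintro _ ⟨u, hu, rfl⟩
    have := lie_conf_J X hu (-d)
    rw [neg_neg] at this
    exact sub_eq_zero.2 this
  exact sub_eq_zero.1 (this hx)

theorem isInternal_deg : DirectSum.IsInternal (deg X) :=
  (DirectSum.isInternal_submodule_iff_iSupIndep_and_iSup_eq_top _).2
    ⟨iSupIndep_of_eigen (bracket X (J X 2 0 X.conf)) fun _ _ hx => lie_conf X hx, iSup_deg X⟩

theorem lie_mem_deg {d e : ℤ} {x y : X.CurrentLie} (hx : x ∈ deg X d) (hy : y ∈ deg X e) :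
    ⁅x, y⁆ ∈ deg X (d + e) := by
  refine bilin_mem_of_iSup (fun r => (X.wt r).map (J X r (-d)))
    (fun r => (X.wt r).map (J X r (-e))) (bracket X) (deg X (d + e)) ?_ x hx y hy
  rintro r s _ ⟨u, hu, rfl⟩ _ ⟨v, hv, rfl⟩
  obtain ⟨N, hN⟩ := X.trunc u v
  have := lie_J X r s (-d) (-e) u v N (fun i hi => hN i (by omega))
  change ⁅J X r (-d) u, J X s (-e) v⁆ ∈ _
  rw [this]
  refine sum_mem fun i _ => zsmul_mem ?_ _
  have := J_mem_deg (X.prod_mem i hu hv) (-d + -e)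
  rwa [show -(-d + -e) = d + e by ring] at this

/-- The Lie subalgebra of elements with degrees in `S`. -/
noncomputable def degSubalgebra (S : Set ℤ) (hS : ∀ d ∈ S, ∀ e ∈ S, d + e ∈ S) :
    LieSubalgebra k X.CurrentLie where
  __ := ⨆ d : S, deg X d
  lie_mem' {x y} hx hy := bilin_mem_of_iSup (fun d : S => deg X d) (fun d : S => deg X d)
    (bracket X) (⨆ d : S, deg X d) (fun d e _ ha _ hb => Submodule.mem_iSup_of_mem
      (⟨d + e, hS _ d.2 _ e.2⟩ : S) (lie_mem_deg X ha hb)) x hx y hy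

theorem mem_degSubalgebra {S : Set ℤ} {hS : ∀ d ∈ S, ∀ e ∈ S, d + e ∈ S} {d : ℤ} (hd : d ∈ S)
    {x : X.CurrentLie} (hx : x ∈ deg X d) : x ∈ degSubalgebra X S hS :=
  Submodule.mem_iSup_of_mem (p := fun d : S => deg X d) ⟨d, hd⟩ hx

/-- The elements of degree at least `0`. -/
noncomputable abbrev nonneg : LieSubalgebra k X.CurrentLie :=
  degSubalgebra X (Set.Ici 0) fun _ hd _ he => add_nonneg (Set.mem_Ici.1 hd) (Set.mem_Ici.1 he)

/-- The elements of negative degree. -/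
noncomputable abbrev neg : LieSubalgebra k X.CurrentLie :=
  degSubalgebra X (Set.Iio 0) fun _ hd _ he => add_neg (Set.mem_Iio.1 hd) (Set.mem_Iio.1 he)

theorem isCompl_nonneg_neg : IsCompl (nonneg X).toSubmodule (neg X).toSubmodule := by
  change IsCompl (⨆ d : Set.Ici (0 : ℤ), deg X d) (⨆ d : Set.Iio (0 : ℤ), deg X d)
  refine ⟨?_, ?_⟩
  · have := (isInternal_deg X).submodule_iSupIndep.disjoint_biSup_biSup
      (s := Set.Ici 0) (t := Set.Iio 0) (Set.disjoint_left.2 fun d h h' =>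
        not_lt.2 (Set.mem_Ici.1 h) (Set.mem_Iio.1 h'))
    simpa only [iSup_subtype] using this
  · rw [codisjoint_iff, eq_top_iff, ← iSup_deg X]
    refine iSup_le fun d => ?_
    rcases le_or_gt 0 d with h | h
    · exact le_sup_of_le_left (le_iSup (fun d : Set.Ici (0 : ℤ) => deg X d) ⟨d, h⟩)
    · exact le_sup_of_le_right (le_iSup (fun d : Set.Iio (0 : ℤ) => deg X d) ⟨d, h⟩)

theorem lie_vac (x : X.CurrentLie) : ⁅x, J X 0 0 X.vac⁆ = 0 := by
  obtain ⟨x, rfl⟩ := mk_surjective X x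
  change mk X (X.loopBracket x (Finsupp.single _ X.vac)) = 0
  induction x using Finsupp.induction_linear with
  | zero => simp
  | add x y hx hy => rw [map_add, LinearMap.add_apply, map_add, hx, hy, add_zero]
  | single m u =>
    rw [X.loopBracket_single u X.vac m _ 0 (fun i _ => X.prod_vac i (by omega) u)]
    simp

end CurrentLie

namespace UEA

attribute [local instance] LieRing.ofAssociativeRing

theorem comm_conf {d : ℤ} {a : X.UEA} (ha : a ∈ (top X).deg d) :
    J X 2 0 X.conf * a - a * J X 2 0 X.conf = (d : k) • a := by
  rw [← PoissonBracket.commutator_apply (k := k)]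
  refine PoissonBracket.br_eq_smul_of_mem_wordSpan (CurrentLie.deg X) (ι X) _ _ ?_ ha
  intro d x hx
  rw [PoissonBracket.commutator_apply, J, LinearMap.comp_apply, ← ι_lie, CurrentLie.lie_conf X hx,
    map_smul]

theorem iSupIndep_deg : iSupIndep (top X).deg :=
  iSupIndep_of_eigen ((PoissonBracket.commutator k X.UEA).br (J X 2 0 X.conf)) fun d a ha => by
    rw [PoissonBracket.commutator_apply, comm_conf X ha]

/-! ### The normal ordering map -/

/-- The map `𝔤 → 𝒰[T, T⁻¹]` with `x ↦ x Tᵈ` for `x` of degree `d`. -/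
theorem exists_degMap : ∃ δ : X.CurrentLie →ₗ[k] AddMonoidAlgebra X.UEA ℤ,
    (∀ d, ∀ x ∈ CurrentLie.deg X d, δ x = AddMonoidAlgebra.single d (ι X x)) ∧
    ∀ x y, δ ⁅x, y⁆ = δ x * δ y - δ y * δ x := by
  obtain ⟨δ, hδ⟩ := exists_linearMap_of_isInternal (CurrentLie.isInternal_deg X)
    fun d => AddMonoidAlgebra.lsingle (R := k) d ∘ₗ ι X
  refine ⟨δ, hδ, fun x y => ?_⟩
  let B : X.CurrentLie →ₗ[k] X.CurrentLie →ₗ[k] AddMonoidAlgebra X.UEA ℤ :=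
    LinearMap.mk₂ k (fun x y => δ ⁅x, y⁆ - (δ x * δ y - δ y * δ x))
      (fun x x' y => by simp only [add_lie, map_add, add_mul, mul_add]; abel)
      (fun r x y => by simp only [smul_lie, map_smul, smul_mul_assoc, mul_smul_comm, smul_sub])
      (fun x y y' => by simp only [lie_add, map_add, add_mul, mul_add]; abel)
      (fun r x y => by simp only [lie_smul, map_smul, smul_mul_assoc, mul_smul_comm, smul_sub])
  have hB : ∀ x y, B x y = δ ⁅x, y⁆ - (δ x * δ y - δ y * δ x) := fun x y => rfl
  have h := bilin_mem_of_iSup (CurrentLie.deg X) (CurrentLie.deg X) B ⊥ (fun d e x hx y hy => by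
    rw [hB, Submodule.mem_bot, hδ _ _ hx, hδ _ _ hy, hδ _ _ (CurrentLie.lie_mem_deg X hx hy)]
    simp only [LinearMap.comp_apply, AddMonoidAlgebra.lsingle_apply,
      AddMonoidAlgebra.single_mul_single, ι_lie, AddMonoidAlgebra.single_sub, add_comm e d,
      sub_self]) x (CurrentLie.iSup_deg X ▸ Submodule.mem_top) y
      (CurrentLie.iSup_deg X ▸ Submodule.mem_top)
  rw [hB, Submodule.mem_bot, sub_eq_zero] at h
  exact h

open TensorProduct in
/-- The normal ordering map `𝒰 → 𝒰[T, T⁻¹]`: it sends `x y` to `x y Tᵉ` if `x` is a product of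
elements of `𝔤` of nonnegative degrees and `y` is a product of elements of negative degrees with
sum `e`.  It exists by the triangular decomposition of `𝒰`. -/
theorem exists_normalOrdering : ∃ θ : X.UEA →ₗ[k] AddMonoidAlgebra X.UEA ℤ,
    (∀ d, 0 ≤ d → ∀ x ∈ CurrentLie.deg X d, ∀ a,
      θ (ι X x * a) = AddMonoidAlgebra.single 0 (ι X x) * θ a) ∧
    ∀ l : List (ℤ × X.CurrentLie), (∀ y ∈ l, y.1 < 0 ∧ y.2 ∈ CurrentLie.deg X y.1) →
      θ (l.map fun y => ι X y.2).prod =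
        AddMonoidAlgebra.single (l.map Prod.fst).sum (l.map fun y => ι X y.2).prod := by
  obtain ⟨δ, hδ, hδ'⟩ := exists_degMap X
  let E := AddMonoidAlgebra X.UEA ℤ
  have hvac : CurrentLie.J X 0 0 X.vac ∈ CurrentLie.nonneg X :=
    CurrentLie.mem_degSubalgebra X (d := 0) (Set.mem_Ici.2 le_rfl) (by
      simpa using CurrentLie.J_mem_deg X.vac_mem 0)
  let c : CurrentLie.nonneg X := ⟨_, hvac⟩
  obtain ⟨ρ, h1, h2, h3⟩ := exists_inducedRep (CurrentLie.nonneg X) (CurrentLie.neg X)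
    (CurrentLie.isCompl_nonneg_neg X) c (CurrentLie.lie_vac X) (E := E)
    ((LinearMap.mul k E).comp δ) (fun x _ y _ e => by
      simp only [LinearMap.comp_apply, LinearMap.mul_apply', hδ', sub_mul, mul_assoc])
  let ρ' : X.CurrentLie →ₗ⁅k⁆ Module.End k (CentralQuot k c ⊗[k] E) :=
    { ρ with map_lie' := fun {x y} => LinearMap.ext fun m => h1 x y m }
  have hρ' : ∀ x, ρ' x = ρ x := fun _ => rfl
  let R : X.UEA →ₐ[k] Module.End k (CentralQuot k c ⊗[k] E) :=
    RingQuot.liftAlgHom k ⟨UniversalEnvelopingAlgebra.lift k ρ', by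
      rintro _ _ ⟨⟩
      rw [UniversalEnvelopingAlgebra.lift_ι_apply, map_one]
      refine LinearMap.ext fun m => (h2 c m).trans ?_
      rw [CentralQuot.ι_central, LinearMap.mulLeft_one, LinearMap.rTensor_id]
      rfl⟩
  have hR : ∀ x, R (ι X x) = ρ x := by
    intro x
    change RingQuot.liftAlgHom k _ (RingQuot.mkAlgHom k _ _) = _
    rw [RingQuot.liftAlgHom_mkAlgHom_apply]
    exact UniversalEnvelopingAlgebra.lift_ι_apply k ρ' x
  obtain ⟨κ, hκ⟩ := CentralQuot.exists_lift (c := c) (A := E)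
    (AddMonoidAlgebra.lsingle (R := k) 0 ∘ₗ ι X ∘ₗ (CurrentLie.nonneg X).toSubmodule.subtype)
    (fun x y => by
      change AddMonoidAlgebra.single 0 (ι X ⁅(x : X.CurrentLie), (y : X.CurrentLie)⁆) =
        AddMonoidAlgebra.single 0 (ι X x) * AddMonoidAlgebra.single 0 (ι X y) -
        AddMonoidAlgebra.single 0 (ι X y) * AddMonoidAlgebra.single 0 (ι X x)
      rw [ι_lie, AddMonoidAlgebra.single_mul_single, AddMonoidAlgebra.single_mul_single,
        AddMonoidAlgebra.single_sub, add_zero])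
    (by
      change AddMonoidAlgebra.single 0 (ι X (CurrentLie.J X 0 0 X.vac)) = 1
      rw [ι_vac]
      rfl)
  let ev : CentralQuot k c ⊗[k] E →ₗ[k] E :=
    TensorProduct.lift ((LinearMap.mul k E).comp κ.toLinearMap)
  have hev : ∀ a e, ev (a ⊗ₜ e) = κ a * e := fun _ _ => rfl
  have hev' : ∀ (x : CurrentLie.nonneg X) m, ev (ρ x m) =
      AddMonoidAlgebra.single 0 (ι X x) * ev m := by
    intro x m
    rw [h2]
    induction m using TensorProduct.induction_on with
    | zero => simp
    | tmul a e =>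
      rw [LinearMap.rTensor_tmul, LinearMap.mulLeft_apply, hev, hev, map_mul, hκ, mul_assoc]
      rfl
    | add m m' h h' => rw [map_add, map_add, map_add, mul_add, h, h']
  let θ : X.UEA →ₗ[k] E := ev ∘ₗ (LinearMap.applyₗ ((1 : CentralQuot k c) ⊗ₜ[k] (1 : E))) ∘ₗ
    R.toLinearMap
  have hθ : ∀ a, θ a = ev (R a (1 ⊗ₜ 1)) := fun _ => rfl
  refine ⟨θ, fun d hd x hx a => ?_, fun l hl => ?_⟩
  · rw [hθ, map_mul, hR]
    exact hev' ⟨x, CurrentLie.mem_degSubalgebra X (Set.mem_Ici.2 hd) hx⟩ _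
  · have : R (l.map fun y => ι X y.2).prod (1 ⊗ₜ 1) = 1 ⊗ₜ
        AddMonoidAlgebra.single (l.map Prod.fst).sum (l.map fun y => ι X y.2).prod := by
      induction l with
      | nil => simp only [List.map_nil, List.prod_nil, map_one, List.sum_nil]; rfl
      | cons y l ih =>
        obtain ⟨hy, hy'⟩ := hl y List.mem_cons_self
        simp only [List.map_cons, List.prod_cons, List.sum_cons, map_mul, Module.End.mul_apply]
        rw [ih fun z hz => hl z (List.mem_cons_of_mem _ hz), hR,
          h3 _ (CurrentLie.mem_degSubalgebra X (Set.mem_Iio.2 hy) hy')]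
        rw [LinearMap.comp_apply, LinearMap.mul_apply', hδ _ _ hy']
        exact congrArg _ (AddMonoidAlgebra.single_mul_single ..)
    rw [hθ, this, hev, map_one, one_mul]

end UEA

end VertexOperatorAlgebra

namespace VertexOperatorAlgebra

variable {k V : Type*} [Field k] [AddCommGroup V] [Module k V] (X : VertexOperatorAlgebra k V)
  [CharZero k]

namespace UEA

/-! ### Normally ordered products -/

/-- The span of the products `J₋d₁(u₁) ⋯ J₋dₗ(uₗ)` with `dᵢ ∈ S`, `d₁ + ⋯ + dₗ = d` and with
`u₁, …, uₗ` homogeneous of weights of sum at most `p`. -/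
noncomputable def letterSpan (S : Set ℤ) (p d : ℤ) : Submodule k X.UEA :=
  Submodule.span k {a | ∃ l : List (ℤ × ℤ × V), (∀ y ∈ l, y.2.1 ∈ S ∧ y.2.2 ∈ X.wt y.1) ∧
    (l.map fun y => y.1).sum ≤ p ∧ (l.map fun y => y.2.1).sum = d ∧
    a = (l.map fun y => J X y.1 (-y.2.1) y.2.2).prod}

variable {X}

theorem one_mem_letterSpan {S : Set ℤ} : (1 : X.UEA) ∈ letterSpan X S 0 0 :=
  Submodule.subset_span ⟨[], by simp⟩

theorem J_mem_letterSpan {S : Set ℤ} {r e : ℤ} (he : e ∈ S) {u : V} (hu : u ∈ X.wt r) :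
    J X r (-e) u ∈ letterSpan X S r e :=
  Submodule.subset_span ⟨[(r, e, u)], by simpa using ⟨he, hu⟩, by simp, by simp, by simp⟩

theorem letterSpan_mono {S S' : Set ℤ} (hS : S ⊆ S') {p p' : ℤ} (hp : p ≤ p') (d : ℤ) :
    letterSpan X S p d ≤ letterSpan X S' p' d := by
  refine Submodule.span_mono ?_
  rintro _ ⟨l, h1, h2, h3, rfl⟩
  exact ⟨l, fun y hy => ⟨hS (h1 y hy).1, (h1 y hy).2⟩, h2.trans hp, h3, rfl⟩

theorem mul_mem_letterSpan {S : Set ℤ} {p q d e : ℤ} {a b : X.UEA} (ha : a ∈ letterSpan X S p d)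
    (hb : b ∈ letterSpan X S q e) : a * b ∈ letterSpan X S (p + q) (d + e) := by
  have : letterSpan X S p d * letterSpan X S q e ≤ letterSpan X S (p + q) (d + e) := by
    unfold letterSpan
    rw [Submodule.span_mul_span]
    refine Submodule.span_le.2 ?_
    rintro _ ⟨a, ⟨l, h1, h2, h3, rfl⟩, b, ⟨l', h1', h2', h3', rfl⟩, rfl⟩
    refine Submodule.subset_span ⟨l ++ l', ?_, by simpa using add_le_add h2 h2', by
      simp [h3, h3'], by simp⟩
    intro y hy
    rcases List.mem_append.1 hy with h | h
    exacts [h1 y h, h1' y h]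
  exact this (Submodule.mul_mem_mul ha hb)

theorem letterSpan_le_deg (S : Set ℤ) (p d : ℤ) : letterSpan X S p d ≤ (top X).deg d := by
  refine Submodule.span_le.2 ?_
  rintro _ ⟨l, h1, -, rfl, rfl⟩
  refine Submodule.subset_span ⟨l.map fun y => (y.2.1, CurrentLie.J X y.1 (-y.2.1) y.2.2), ?_, by
    simp [Function.comp_def], by simp [Function.comp_def]; rfl⟩
  intro y hy
  obtain ⟨z, hz, rfl⟩ := List.mem_map.1 hy
  simpa using CurrentLie.J_mem_deg (h1 z hz).2 (-z.2.1)

theorem letterSpan_le_fil (S : Set ℤ) (p d : ℤ) : letterSpan X S p d ≤ fil X p := by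
  refine Submodule.span_le.2 ?_
  rintro _ ⟨l, h1, hp, -, rfl⟩
  refine fil_mono X hp (Submodule.subset_span
    ⟨l.map fun y => (y.1, CurrentLie.J X y.1 (-y.2.1) y.2.2), ?_, by
    simp [Function.comp_def], by simp [Function.comp_def]; rfl⟩)
  intro y hy
  obtain ⟨z, hz, rfl⟩ := List.mem_map.1 hy
  exact CurrentLie.J_mem_fil le_rfl (h1 z hz).2 _

theorem letterSpan_Ici_eq_bot {p d : ℤ} (hd : d < 0) : letterSpan X (Set.Ici 0) p d = ⊥ := by
  rw [letterSpan, Submodule.span_eq_bot]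
  rintro _ ⟨l, h1, -, h3, -⟩
  have : 0 ≤ (l.map fun y => y.2.1).sum := List.sum_nonneg fun z hz => by
    obtain ⟨y, hy, rfl⟩ := List.mem_map.1 hz
    exact (h1 y hy).1
  omega

theorem letterSpan_Iio_eq_bot {p d : ℤ} (hd : 0 < d) : letterSpan X (Set.Iio 0) p d = ⊥ := by
  rw [letterSpan, Submodule.span_eq_bot]
  rintro _ ⟨l, h1, -, h3, -⟩
  have : (l.map fun y => y.2.1).sum ≤ (l.map fun _ => (0 : ℤ)).sum :=
    List.sum_le_sum fun y hy => le_of_lt (h1 y hy).1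
  simp only [List.map_const', List.sum_replicate, smul_zero] at this
  omega

theorem mem_iSup_letterSpan_of_fil {p : ℤ} {a : X.UEA} (ha : a ∈ fil X p) :
    a ∈ ⨆ d, letterSpan X Set.univ p d := by
  have hlet : ∀ q, ∀ x ∈ CurrentLie.fil X q, ι X x ∈ ⨆ d, letterSpan X Set.univ q d := by
    intro q
    have : CurrentLie.fil X q ≤ (⨆ d, letterSpan X Set.univ q d).comap (ι X) := by
      refine iSup_le fun r => iSup_le fun hr => iSup_le fun n => ?_
      rintro _ ⟨u, hu, rfl⟩
      refine Submodule.mem_iSup_of_mem (-n) ?_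
      have := J_mem_letterSpan (S := Set.univ) (e := -n) trivial hu
      rw [neg_neg] at this
      exact letterSpan_mono subset_rfl hr _ this
    exact this
  have : fil X p ≤ ⨆ d, letterSpan X Set.univ p d := by
    refine Submodule.span_le.2 ?_
    rintro _ ⟨l, hl, rfl, rfl⟩
    clear ha
    induction l with
    | nil => exact Submodule.mem_iSup_of_mem 0 one_mem_letterSpan
    | cons y l ih =>
      simp only [List.map_cons, List.prod_cons, List.sum_cons]
      exact bilin_mem_of_iSup (letterSpan X Set.univ y.1)
        (letterSpan X Set.univ (l.map Prod.fst).sum) (LinearMap.mul k X.UEA)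
        (⨆ d, letterSpan X Set.univ (y.1 + (l.map Prod.fst).sum) d)
        (fun d e a ha b hb => Submodule.mem_iSup_of_mem (d + e) (mul_mem_letterSpan ha hb)) _
        (hlet _ _ (hl y List.mem_cons_self)) _
        (ih fun z hz => hl z (List.mem_cons_of_mem _ hz))
  exact this ha

theorem mem_iSup_letterSpan_of_deg {d : ℤ} {a : X.UEA} (ha : a ∈ (top X).deg d) :
    a ∈ ⨆ p, letterSpan X Set.univ p d := by
  have hlet : ∀ e, ∀ x ∈ CurrentLie.deg X e, ι X x ∈ ⨆ p, letterSpan X Set.univ p e := by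
    intro e
    have : CurrentLie.deg X e ≤ (⨆ p, letterSpan X Set.univ p e).comap (ι X) := by
      refine iSup_le fun r => ?_
      rintro _ ⟨u, hu, rfl⟩
      exact Submodule.mem_iSup_of_mem r (J_mem_letterSpan (S := Set.univ) trivial hu)
    exact this
  have : (top X).deg d ≤ ⨆ p, letterSpan X Set.univ p d := by
    refine Submodule.span_le.2 ?_
    rintro _ ⟨l, hl, rfl, rfl⟩
    clear ha
    induction l with
    | nil => exact Submodule.mem_iSup_of_mem 0 one_mem_letterSpan
    | cons y l ih =>
      simp only [List.map_cons, List.prod_cons, List.sum_cons]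
      exact bilin_mem_of_iSup (fun p => letterSpan X Set.univ p y.1)
        (fun p => letterSpan X Set.univ p (l.map Prod.fst).sum) (LinearMap.mul k X.UEA)
        (⨆ p, letterSpan X Set.univ p (y.1 + (l.map Prod.fst).sum))
        (fun p q a ha b hb => Submodule.mem_iSup_of_mem (p + q) (mul_mem_letterSpan ha hb)) _
        (hlet _ _ (hl y List.mem_cons_self)) _
        (ih fun z hz => hl z (List.mem_cons_of_mem _ hz))
  exact this ha

/-- The filtration by weights is compatible with the grading by degrees. -/
theorem fil_inf_deg_le (p d : ℤ) : fil X p ⊓ (top X).deg d ≤ letterSpan X Set.univ p d :=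
  fun _ ha => mem_of_mem_iSup_of_iSupIndep (iSupIndep_deg X)
    (fun d => letterSpan_le_deg Set.univ p d) ha.2 (mem_iSup_letterSpan_of_fil ha.1)

variable (X) in
/-- The span of the normally ordered products `x y` of degree `d` and of weight at most `p`, where
`x` is a product of elements of nonnegative degrees, `y` is a product of elements of negative
degrees and the degree of `y` is in `E`. -/
noncomputable def sortedSpan (E : Set ℤ) (p d : ℤ) : Submodule k X.UEA :=
  Submodule.span k {z | ∃ a b e : ℤ, a + b = p ∧ e ∈ E ∧
    ∃ x ∈ letterSpan X (Set.Ici 0) a (d - e), ∃ y ∈ letterSpan X (Set.Iio 0) b e, z = x * y}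

theorem mul_mem_sortedSpan {E : Set ℤ} {a b d e : ℤ} (he : e ∈ E) {x y : X.UEA}
    (hx : x ∈ letterSpan X (Set.Ici 0) a d) (hy : y ∈ letterSpan X (Set.Iio 0) b e) :
    x * y ∈ sortedSpan X E (a + b) (d + e) :=
  Submodule.subset_span ⟨a, b, e, rfl, he, x, by rwa [add_sub_cancel_right], y, hy, rfl⟩

theorem letterSpan_mul_mem_sortedSpan {E : Set ℤ} {a p c d : ℤ} {x z : X.UEA}
    (hx : x ∈ letterSpan X (Set.Ici 0) a c) (hz : z ∈ sortedSpan X E p d) :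
    x * z ∈ sortedSpan X E (a + p) (c + d) := by
  have : sortedSpan X E p d ≤ (sortedSpan X E (a + p) (c + d)).comap (LinearMap.mulLeft k x) := by
    refine Submodule.span_le.2 ?_
    rintro _ ⟨a', b, e, rfl, he, x', hx', y, hy, rfl⟩
    have := mul_mem_sortedSpan he (mul_mem_letterSpan hx hx') hy
    rw [mul_assoc, show a + a' + b = a + (a' + b) by ring,
      show c + (d - e) + e = c + d by ring] at this
    exact this
  exact this hz

theorem sortedSpan_mono (E : Set ℤ) {p p' : ℤ} (hp : p ≤ p') (d : ℤ) :
    sortedSpan X E p d ≤ sortedSpan X E p' d := by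
  refine Submodule.span_mono ?_
  rintro _ ⟨a, b, e, rfl, he, x, hx, y, hy, rfl⟩
  exact ⟨p' - b, b, e, by ring, he, x, letterSpan_mono subset_rfl (by omega) _ hx, y, hy, rfl⟩

/-- A generator times a normally ordered product is a combination of normally ordered products
without increase of weights: move the generator to the right through the factors of nonnegative
degrees; the commutators are combinations of generators of lower weights. -/
theorem J_mul_mem_sortedSpan (l : List (ℤ × ℤ × V))
    (hl : ∀ y ∈ l, y.2.1 ∈ Set.Ici (0 : ℤ) ∧ y.2.2 ∈ X.wt y.1) {b e : ℤ} {y : X.UEA}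
    (hy : y ∈ letterSpan X (Set.Iio 0) b e) {r c : ℤ} {u : V} (hu : u ∈ X.wt r) :
    J X r (-c) u * ((l.map fun y => J X y.1 (-y.2.1) y.2.2).prod * y) ∈
      sortedSpan X Set.univ (r + ((l.map fun y => y.1).sum + b))
        (c + ((l.map fun y => y.2.1).sum + e)) := by
  induction l generalizing r c u with
  | nil =>
    simp only [List.map_nil, List.prod_nil, one_mul, List.sum_nil, zero_add]
    rcases le_or_gt 0 c with h | h
    · exact mul_mem_sortedSpan (E := Set.univ) (Set.mem_univ _)
        (J_mem_letterSpan (Set.mem_Ici.2 h) hu) hy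
    · have := mul_mem_sortedSpan (E := Set.univ) trivial one_mem_letterSpan
        (mul_mem_letterSpan (J_mem_letterSpan (Set.mem_Iio.2 h) hu) hy)
      simpa using this
  | cons z l ih =>
    have hl' := fun w hw => hl w (List.mem_cons_of_mem z hw)
    obtain ⟨hz, hz'⟩ := hl z List.mem_cons_self
    obtain ⟨N, hN⟩ := X.trunc u z.2.2
    have hlie := CurrentLie.lie_J X r z.1 (-c) (-z.2.1) u z.2.2 N fun i hi => hN i (by omega)
    have hcomm : J X r (-c) u * J X z.1 (-z.2.1) z.2.2 =
        J X z.1 (-z.2.1) z.2.2 * J X r (-c) u +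
        ∑ i ∈ Finset.range N, Ring.choose (-c + r - 1) i •
          J X (r + z.1 - i - 1) (-(c + z.2.1)) (X.prod i u z.2.2) := by
      have h := ι_lie X (CurrentLie.J X r (-c) u) (CurrentLie.J X z.1 (-z.2.1) z.2.2)
      rw [hlie, map_sum, show -c + -z.2.1 = -(c + z.2.1) by ring] at h
      simp only [map_zsmul] at h
      exact sub_eq_iff_eq_add'.1 h.symm
    simp only [List.map_cons, List.prod_cons, List.sum_cons]
    rw [mul_assoc, ← mul_assoc, hcomm, add_mul, mul_assoc, Finset.sum_mul]
    refine add_mem ?_ (sum_mem fun i _ => ?_)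
    · have := letterSpan_mul_mem_sortedSpan (J_mem_letterSpan hz hz') (ih hl' hu (c := c))
      convert this using 2 <;> ring
    · rw [smul_mul_assoc]
      refine zsmul_mem ?_ _
      have := ih hl' (X.prod_mem i hu hz') (c := c + z.2.1)
      have h := sortedSpan_mono Set.univ (p' := r + (z.1 + (l.map fun y => y.1).sum + b))
        (by omega) _ this
      convert h using 2
      ring

theorem letterSpan_le_sortedSpan (p d : ℤ) :
    letterSpan X Set.univ p d ≤ sortedSpan X Set.univ p d := by
  refine Submodule.span_le.2 ?_
  rintro _ ⟨l, hl, hp, rfl, rfl⟩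
  refine sortedSpan_mono Set.univ hp _ ?_
  clear hp
  induction l with
  | nil =>
    have := mul_mem_sortedSpan (X := X) (E := Set.univ) trivial one_mem_letterSpan
      one_mem_letterSpan
    simpa using this
  | cons z l ih =>
    simp only [List.map_cons, List.prod_cons, List.sum_cons]
    set q := (l.map fun y => y.1).sum
    set d := (l.map fun y => y.2.1).sum
    have : sortedSpan X Set.univ q d ≤ (sortedSpan X Set.univ (z.1 + q) (z.2.1 + d)).comap
        (LinearMap.mulLeft k (J X z.1 (-z.2.1) z.2.2)) := by
      refine Submodule.span_le.2 ?_
      rintro _ ⟨a, b, e, hab, -, x, hx, y, hy, rfl⟩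
      have h2 : letterSpan X (Set.Ici 0) a (d - e) ≤
          (sortedSpan X Set.univ (z.1 + q) (z.2.1 + d)).comap
          (LinearMap.mulLeft k (J X z.1 (-z.2.1) z.2.2) ∘ₗ LinearMap.mulRight k y) := by
        refine Submodule.span_le.2 ?_
        rintro _ ⟨l', hl', hp, hd, rfl⟩
        have := J_mul_mem_sortedSpan l' hl' hy (hl z List.mem_cons_self).2 (c := z.2.1)
        rw [hd, sub_add_cancel] at this
        exact sortedSpan_mono Set.univ (by omega) _ this
      exact h2 hx
    exact this (ih fun y hy => hl y (List.mem_cons_of_mem _ hy))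

theorem letterSpan_univ_mul_sorted {p q d c e : ℤ} {w y : X.UEA}
    (hw : w ∈ letterSpan X Set.univ p d) (he : e ≤ c) (hy : y ∈ letterSpan X (Set.Iio 0) q e) :
    w * y ∈ sortedSpan X (Set.Iic c) (p + q) (d + e) := by
  have : sortedSpan X Set.univ p d ≤ (sortedSpan X (Set.Iic c) (p + q) (d + e)).comap
      (LinearMap.mulRight k y) := by
    refine Submodule.span_le.2 ?_
    rintro _ ⟨a, b, f, rfl, -, x, hx, z, hz, rfl⟩
    change x * z * y ∈ sortedSpan X (Set.Iic c) (a + b + q) (d + e)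
    rcases le_or_gt f 0 with h | h
    · have := mul_mem_sortedSpan (E := Set.Iic c) (Set.mem_Iic.2 (by omega)) hx
        (mul_mem_letterSpan hz hy)
      rw [mul_assoc]
      convert this using 2 <;> ring
    · rw [letterSpan_Iio_eq_bot h, Submodule.mem_bot] at hz
      rw [hz, mul_zero, zero_mul]
      exact zero_mem _
  exact this (letterSpan_le_sortedSpan p d hw)

/-- The neighbourhood `Iₙ(𝒰(d))` is spanned by the normally ordered products with negative part of
degree at most `-n-1`. -/
theorem nhd_le_sortedSpan (d : ℤ) (n : ℕ) :
    (top X).nhd d n ≤ ⨆ p, sortedSpan X (Set.Iic (-(n : ℤ) - 1)) p d := by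
  refine iSup₂_le fun j hj => Submodule.mul_le.2 fun w hw v hv => ?_
  refine bilin_mem_of_iSup _ _ (LinearMap.mul k X.UEA) _ (fun q p w hw v hv => ?_) w
    (mem_iSup_letterSpan_of_deg hw) v (mem_iSup_letterSpan_of_deg hv)
  refine Submodule.mem_iSup_of_mem (q + p) ?_
  have : sortedSpan X Set.univ p j ≤ (sortedSpan X (Set.Iic (-(n : ℤ) - 1)) (q + p) d).comap
      (LinearMap.mulLeft k w) := by
    refine Submodule.span_le.2 ?_
    rintro _ ⟨a, b, e, rfl, -, x, hx, y, hy, rfl⟩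
    change w * (x * y) ∈ sortedSpan X (Set.Iic (-(n : ℤ) - 1)) (q + (a + b)) d
    rcases lt_or_ge (j - e) 0 with h | h
    · rw [letterSpan_Ici_eq_bot h, Submodule.mem_bot] at hx
      rw [hx, zero_mul, mul_zero]
      exact zero_mem _
    · have := letterSpan_univ_mul_sorted (c := -(n : ℤ) - 1)
        (mul_mem_letterSpan hw (letterSpan_mono (Set.subset_univ _) le_rfl _ hx)) (by omega) hy
      rw [← mul_assoc]
      convert this using 2 <;> ring
  exact this (letterSpan_le_sortedSpan p j hv)

variable (X) in
/-- The normal ordering map on normally ordered products. -/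
theorem exists_normalOrdering_letterSpan : ∃ θ : X.UEA →ₗ[k] AddMonoidAlgebra X.UEA ℤ,
    ∀ a b d e, ∀ x ∈ letterSpan X (Set.Ici 0) a d, ∀ y ∈ letterSpan X (Set.Iio 0) b e,
      θ (x * y) = AddMonoidAlgebra.single e (x * y) := by
  obtain ⟨θ, h1, h2⟩ := exists_normalOrdering X
  refine ⟨θ, fun a b d e x hx y hy => ?_⟩
  have hy' : θ y = AddMonoidAlgebra.single e y := by
    have : letterSpan X (Set.Iio 0) b e ≤
        LinearMap.ker (θ - AddMonoidAlgebra.lsingle (R := k) e) := by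
      refine Submodule.span_le.2 ?_
      rintro _ ⟨l, hl, -, rfl, rfl⟩
      rw [SetLike.mem_coe, LinearMap.mem_ker, LinearMap.sub_apply, sub_eq_zero]
      have := h2 (l.map fun y => (y.2.1, CurrentLie.J X y.1 (-y.2.1) y.2.2)) (by
        intro y hy
        obtain ⟨z, hz, rfl⟩ := List.mem_map.1 hy
        refine ⟨(hl z hz).1, ?_⟩
        simpa using CurrentLie.J_mem_deg (hl z hz).2 (-z.2.1))
      simp only [List.map_map, Function.comp_def] at this
      exact this
    exact sub_eq_zero.1 (this hy)
  have : letterSpan X (Set.Ici 0) a d ≤ LinearMap.ker (θ ∘ₗ LinearMap.mulRight k y -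
      AddMonoidAlgebra.lsingle (R := k) e ∘ₗ LinearMap.mulRight k y) := by
    refine Submodule.span_le.2 ?_
    rintro _ ⟨l, hl, -, -, rfl⟩
    rw [SetLike.mem_coe, LinearMap.mem_ker, LinearMap.sub_apply, sub_eq_zero]
    change θ (_ * y) = AddMonoidAlgebra.single e (_ * y)
    induction l with
    | nil => simpa using hy'
    | cons z l ih =>
      obtain ⟨hz, hz'⟩ := hl z List.mem_cons_self
      have h3 := CurrentLie.J_mem_deg hz' (-z.2.1)
      rw [neg_neg] at h3
      simp only [List.map_cons, List.prod_cons]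
      rw [mul_assoc]
      refine (h1 _ hz _ h3 _).trans ?_
      rw [ih fun w hw => hl w (List.mem_cons_of_mem _ hw), AddMonoidAlgebra.single_mul_single,
        zero_add]
      rfl
  exact sub_eq_zero.1 (this hx)

/-- Strictness of the weight filtration with respect to the topology: an element of
`G_p ∩ Iₙ(𝒰(d))` is a combination of normally ordered products of weights at most `p` which are
all in `Iₙ(𝒰(d))`. -/
theorem fil_inf_nhd_le (p d : ℤ) (n : ℕ) :
    fil X p ⊓ (top X).nhd d n ≤ sortedSpan X (Set.Iic (-(n : ℤ) - 1)) p d := by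
  obtain ⟨θ, hθ⟩ := exists_normalOrdering_letterSpan X
  set c : ℤ := -(n : ℤ) - 1
  have hE : ∀ (E : Set ℤ) (p : ℤ), ∀ z ∈ sortedSpan X E p d, ∀ j ∉ E, (θ z).coeff j = 0 := by
    intro E p z hz j hj
    induction hz using Submodule.span_induction with
    | mem z hz =>
      obtain ⟨a, b, e, -, he, x, hx, y, hy, rfl⟩ := hz
      rw [hθ _ _ _ _ x hx y hy, AddMonoidAlgebra.coeff_single, Finsupp.single_apply, if_neg]
      rintro rfl
      exact hj he
    | zero => simp
    | add x y _ _ hx hy =>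
      rw [map_add, AddMonoidAlgebra.coeff_add, Finsupp.add_apply, hx, hy, add_zero]
    | smul r x _ hx => rw [map_smul, AddMonoidAlgebra.coeff_smul, Finsupp.smul_apply, hx, smul_zero]
  have hE' : ∀ x ∈ ⨆ p, sortedSpan X (Set.Iic c) p d, ∀ j, c < j → (θ x).coeff j = 0 := by
    intro x hx j hj
    induction hx using Submodule.iSup_induction' with
    | mem p x hx => exact hE _ p x hx j (by simpa using hj)
    | zero => simp
    | add x y _ _ hx hy =>
      rw [map_add, AddMonoidAlgebra.coeff_add, Finsupp.add_apply, hx, hy, add_zero]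
  -- setting `T = 1` recovers the element
  have hT : ∀ (E : Set ℤ) (p : ℤ), ∀ z ∈ sortedSpan X E p d,
      (θ z).coeff.sum (fun _ a => a) = z := by
    intro E p z hz
    induction hz using Submodule.span_induction with
    | mem z hz =>
      obtain ⟨a, b, e, -, he, x, hx, y, hy, rfl⟩ := hz
      rw [hθ _ _ _ _ x hx y hy, AddMonoidAlgebra.coeff_single, Finsupp.sum_single_index rfl]
    | zero => simp
    | add x y _ _ hx hy =>
      rw [map_add, AddMonoidAlgebra.coeff_add, Finsupp.sum_add_index' (fun _ => rfl)
        (fun _ _ _ => rfl), hx, hy]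
    | smul r x _ hx =>
      rw [map_smul, AddMonoidAlgebra.coeff_smul, Finsupp.sum_smul_index' (fun _ => rfl),
        ← Finsupp.smul_sum, hx]
  rintro z ⟨hz, hz'⟩
  have h1 := letterSpan_le_sortedSpan p d (fil_inf_deg_le p d ⟨hz, (top X).nhd_le d n hz'⟩)
  have h2 : sortedSpan X Set.univ p d ≤ sortedSpan X (Set.Iic c) p d ⊔
      sortedSpan X (Set.Ioi c) p d := by
    refine Submodule.span_le.2 ?_
    rintro _ ⟨a, b, e, hab, -, h⟩
    rcases le_or_gt e c with he | he
    · exact Submodule.mem_sup_left (Submodule.subset_span ⟨a, b, e, hab, he, h⟩)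
    · exact Submodule.mem_sup_right (Submodule.subset_span ⟨a, b, e, hab, he, h⟩)
  obtain ⟨z₁, hz₁, z₂, hz₂, rfl⟩ := Submodule.mem_sup.1 (h2 h1)
  -- the powers of `T` in `θ z₂` are larger than `c` since `z₂` is in the second span, and at most
  -- `c` since `z₂` is in `Iₙ(𝒰(d))`
  have h3 : z₂ ∈ ⨆ p, sortedSpan X (Set.Iic c) p d := by
    have := sub_mem (nhd_le_sortedSpan d n hz') (Submodule.mem_iSup_of_mem p hz₁)
    rwa [add_sub_cancel_left] at this
  have h4 := hE' z₂ h3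
  have h5 : z₂ = 0 := by
    rw [← hT _ p z₂ hz₂]
    have : (θ z₂).coeff = 0 := by
      ext j
      rcases le_or_gt j c with h | h
      · exact hE _ p z₂ hz₂ j (by simpa using h)
      · exact h4 j h
    rw [this, Finsupp.sum_zero_index]
  rw [h5, add_zero]
  exact hz₁

end UEA

end VertexOperatorAlgebra

/-! ### Principal symbols -/

namespace TopFiltration

variable {k A : Type*} [Field k] [Ring A] [Algebra k A] (F : TopFiltration k A)

theorem single_mem_rees {p d : ℤ} {a : A} (ha : a ∈ F.fil p d) :
    AddMonoidAlgebra.single p a ∈ F.rees :=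
  le_iSup F.reesDeg d (single_mem_laurent (S := fun p => F.fil p d) ha)

theorem exists_symbol (p : ℤ) : ∃ σ : A →ₗ[k] F.Gr,
    ∀ a (h : AddMonoidAlgebra.single p a ∈ F.rees), σ a = Ideal.Quotient.mk F.reesIdeal ⟨_, h⟩ := by
  let S : Submodule k A :=
    (Subalgebra.toSubmodule F.rees).comap (AddMonoidAlgebra.lsingle (R := k) p)
  let g : S →ₗ[k] F.Gr := (Ideal.Quotient.mkₐ k F.reesIdeal).toLinearMap ∘ₗ
    LinearMap.codRestrict (Subalgebra.toSubmodule F.rees)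
      (AddMonoidAlgebra.lsingle (R := k) p ∘ₗ S.subtype) fun a => a.2
  obtain ⟨σ, hσ⟩ := LinearMap.exists_extend g
  exact ⟨σ, fun a h => LinearMap.congr_fun hσ ⟨a, h⟩⟩

/-- The symbol `G_p A → G_p A / G_{p-1} A ⊆ gr A`, extended in an arbitrary way to a linear map on
`A`. -/
noncomputable def symbol (p : ℤ) : A →ₗ[k] F.Gr := (F.exists_symbol p).choose

variable {F}

theorem symbol_eq {p d : ℤ} {a : A} (ha : a ∈ F.fil p d) : F.symbol p a =
    Ideal.Quotient.mk F.reesIdeal ⟨AddMonoidAlgebra.single p a, F.single_mem_rees ha⟩ :=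
  (F.exists_symbol p).choose_spec a (F.single_mem_rees ha)

theorem symbol_one : F.symbol 0 1 = 1 := symbol_eq F.one_mem

theorem symbol_mul {p q d e : ℤ} {a b : A} (ha : a ∈ F.fil p d) (hb : b ∈ F.fil q e) :
    F.symbol (p + q) (a * b) = F.symbol p a * F.symbol q b := by
  rw [symbol_eq (F.mul_mem ha hb), symbol_eq ha, symbol_eq hb, ← map_mul]
  exact congrArg (Ideal.Quotient.mk F.reesIdeal)
    (Subtype.ext (AddMonoidAlgebra.single_mul_single ..).symm)

theorem symbol_comm {p q d e : ℤ} {a b : A} (ha : a ∈ F.fil p d) (hb : b ∈ F.fil q e) :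
    F.gr.br (F.symbol p a) (F.symbol q b) = F.symbol (p + q - 1) (a * b - b * a) := by
  rw [symbol_eq (F.comm_mem ha hb), symbol_eq ha, symbol_eq hb]
  refine congrArg (Ideal.Quotient.mk F.reesIdeal) (Subtype.ext ?_)
  change (laurentBracket k A).br (AddMonoidAlgebra.single p a) (AddMonoidAlgebra.single q b) =
    AddMonoidAlgebra.single (p + q - 1) (a * b - b * a)
  rw [laurentBracket_apply]
  simp only [AddMonoidAlgebra.single_mul_single, mul_sub, one_mul]
  rw [add_comm q p, show -1 + (p + q) = p + q - 1 by ring, ← AddMonoidAlgebra.single_sub]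

theorem symbol_eq_zero {p d : ℤ} {a : A} (ha : a ∈ F.fil (p - 1) d) : F.symbol p a = 0 := by
  rw [symbol_eq (F.mono d (by omega : p - 1 ≤ p) ha), Ideal.Quotient.eq_zero_iff_mem]
  exact le_iSup F.reesIdealDeg d (single_mem_laurent (S := fun p => F.fil (p - 1) d) ha)

theorem symbol_mem_deg {p d : ℤ} {a : A} (ha : a ∈ F.fil p d) : F.symbol p a ∈ F.gr.deg d :=
  ⟨⟨_, F.single_mem_rees ha⟩, single_mem_laurent (S := fun p => F.fil p d) ha, (symbol_eq ha).symm⟩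

theorem symbol_mem_nhd {p d : ℤ} {n : ℕ} {a : A} (ha : a ∈ F.nhd p d n) :
    F.symbol p a ∈ F.gr.nhd d n :=
  ⟨⟨_, F.single_mem_rees (F.nhd_le p d n ha)⟩,
    single_mem_laurent (S := fun p => F.nhd p d n) ha, (symbol_eq (F.nhd_le p d n ha)).symm⟩

theorem imageSub_laurent_le {S : ℤ → Submodule k A} {d : ℤ} (hS : ∀ p, S p ≤ F.fil p d) :
    imageSub F.rees F.reesIdeal (laurent S) ≤ ⨆ p, (S p).map (F.symbol p) := by
  rintro _ ⟨⟨x, hx'⟩, hx, rfl⟩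
  have h : ∀ x ∈ laurent S, ∀ hx : x ∈ F.rees,
      Ideal.Quotient.mk F.reesIdeal ⟨x, hx⟩ ∈ ⨆ p, (S p).map (F.symbol p) := by
    intro x hx
    induction hx using Submodule.iSup_induction' with
    | mem p x hx =>
      obtain ⟨a, ha, rfl⟩ := hx
      exact fun _ => Submodule.mem_iSup_of_mem p ⟨a, ha, symbol_eq (hS p ha)⟩
    | zero => exact fun _ => zero_mem _
    | add x y hx hy ihx ihy =>
      have h1 : laurent S ≤ Subalgebra.toSubmodule F.rees :=
        (laurent_mono hS).trans (le_iSup F.reesDeg d)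
      exact fun _ => add_mem (ihx (h1 hx)) (ihy (h1 hy))
  exact h x hx hx'

theorem gr_deg_le (d : ℤ) : F.gr.deg d ≤ ⨆ p, (F.fil p d).map (F.symbol p) :=
  imageSub_laurent_le fun _ => le_rfl

theorem gr_nhd_le (d : ℤ) (n : ℕ) : F.gr.nhd d n ≤ ⨆ p, (F.nhd p d n).map (F.symbol p) :=
  imageSub_laurent_le fun p => F.nhd_le p d n

/-- If the grading of `A` is given by the eigenspaces of an inner derivation, the sum of the
homogeneous components of `gr A` is direct. -/
theorem iSupIndep_gr_deg [CharZero k] (w : A)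
    (hw : ∀ p d, ∀ a ∈ F.fil p d, w * a - a * w = (d : k) • a) : iSupIndep F.gr.deg := by
  have h1 : iSupIndep F.reesDeg := by
    refine iSupIndep_of_eigen ((PoissonBracket.commutator k (AddMonoidAlgebra A ℤ)).br
      (AddMonoidAlgebra.single 0 w)) fun d x hx => ?_
    have : F.reesDeg d ≤ LinearMap.ker ((PoissonBracket.commutator k (AddMonoidAlgebra A ℤ)).br
        (AddMonoidAlgebra.single 0 w) - (d : k) • LinearMap.id) := by
      refine iSup_le fun p => ?_
      rintro _ ⟨a, ha, rfl⟩
      rw [LinearMap.mem_ker, LinearMap.sub_apply, PoissonBracket.commutator_apply,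
        LinearMap.smul_apply, LinearMap.id_apply, AddMonoidAlgebra.lsingle_apply,
        AddMonoidAlgebra.single_mul_single, AddMonoidAlgebra.single_mul_single, zero_add, add_zero,
        ← AddMonoidAlgebra.single_sub, hw p d a ha, AddMonoidAlgebra.smul_single, sub_self]
    exact sub_eq_zero.1 (this hx)
  have h2 : iSupIndep fun d => (F.reesDeg d).comap F.rees.val.toLinearMap := by
    rw [iSupIndep_def] at h1 ⊢
    intro d
    rw [Submodule.disjoint_def]
    intro x hx hx'
    have h3 : (⨆ (e : ℤ) (_ : e ≠ d), (F.reesDeg e).comap F.rees.val.toLinearMap) ≤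
        (⨆ (e : ℤ) (_ : e ≠ d), F.reesDeg e).comap F.rees.val.toLinearMap :=
      iSup₂_le fun e he => Submodule.comap_mono
        (le_iSup₂_of_le (f := fun e (_ : e ≠ d) => F.reesDeg e) e he le_rfl)
    exact Subtype.ext ((Submodule.disjoint_def.1 (h1 d)) _ hx (h3 hx'))
  refine iSupIndep_map_of_ker h2 (Ideal.Quotient.mkₐ k F.reesIdeal).toLinearMap fun x hx => ?_
  have hx : x.1 ∈ ⨆ d, F.reesIdealDeg d := Ideal.Quotient.eq_zero_iff_mem.1 hx
  have h3 : ∀ d, F.reesIdealDeg d ≤ F.reesDeg d := fun d =>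
    laurent_mono fun p => F.mono d (by omega)
  have h4 : ∀ x ∈ ⨆ d, F.reesIdealDeg d, ∀ hx : x ∈ F.rees,
      (⟨x, hx⟩ : F.rees) ∈ ⨆ d, LinearMap.ker (Ideal.Quotient.mkₐ k F.reesIdeal).toLinearMap ⊓
        (F.reesDeg d).comap F.rees.val.toLinearMap := by
    intro x hx
    induction hx using Submodule.iSup_induction' with
    | mem d x hx =>
      exact fun _ => Submodule.mem_iSup_of_mem d
        ⟨Ideal.Quotient.eq_zero_iff_mem.2 (le_iSup F.reesIdealDeg d hx), h3 d hx⟩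
    | zero => exact fun _ => zero_mem _
    | add x y hx hy ihx ihy =>
      have h5 : (⨆ d, F.reesIdealDeg d) ≤ Subalgebra.toSubmodule F.rees := iSup_mono h3
      exact fun _ => add_mem (ihx (h5 hx)) (ihy (h5 hy))
  exact h4 x.1 hx x.2

end TopFiltration

/-! ### Symbols of elements of the enveloping algebra -/

namespace VertexOperatorAlgebra

variable {k V : Type*} [Field k] [AddCommGroup V] [Module k V] (X : VertexOperatorAlgebra k V)
  [CharZero k]

theorem toCurrentAlgebra_borcherdsElt {r s : ℤ} {u v : V} (hu : u ∈ X.wt r) (hv : v ∈ X.wt s)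
    (l m n : ℤ) : X.toCurrentAlgebra (UEA.borcherdsElt X hu hv l m n) = 0 :=
  Ideal.Quotient.eq_zero_iff_mem.2 (Submodule.mem_iSup_of_mem (-(l + m + n))
    ⟨(UEA.top X).limit_mem _, fun _ => ⟨_, (UEA.top X).completion.mem_genIdeal (UEA.borcherdsSet X)
      ⟨r, s, u, v, hu, hv, l, m, n, rfl, rfl⟩, by simp⟩⟩)

/-- The sum of the homogeneous components of `gr U(V)` is direct. -/
theorem iSupIndep_grCurrent_deg : iSupIndep X.grCurrent.deg := by
  refine TopFiltration.iSupIndep_gr_deg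
    (X.toCurrentAlgebra ((UEA.top X).of (UEA.J X 2 0 X.conf))) ?_
  rintro p d _ ⟨a, ⟨⟨⟨a, ha'⟩, ha, rfl⟩, -⟩, rfl⟩
  have h : (⟨_, (UEA.top X).const_mem_cauchySubalg (UEA.J X 2 0 X.conf)⟩ *
      (⟨a, ha'⟩ : (UEA.top X).cauchySubalg) - ⟨a, ha'⟩ *
      ⟨_, (UEA.top X).const_mem_cauchySubalg (UEA.J X 2 0 X.conf)⟩) = (d : k) • ⟨a, ha'⟩ :=
    Subtype.ext (funext fun i => UEA.comm_conf X (ha.1 i))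
  exact congrArg (fun x => X.toCurrentAlgebra (Ideal.Quotient.mk (UEA.top X).nullIdeal x)) h

namespace UEA

/-- The symbol in `gr U(V)` of the image in `U(V)` of an element of `G_p 𝒰`. -/
noncomputable def symbol (p : ℤ) : X.UEA →ₗ[k] X.currentFiltration.Gr :=
  X.currentFiltration.symbol p ∘ₗ X.toCurrentAlgebra.toLinearMap ∘ₗ (top X).of.toLinearMap

variable {X}

theorem of_mem_currentFiltration {p d : ℤ} {a : X.UEA} (ha : a ∈ fil X p)
    (had : a ∈ (top X).deg d) :
    X.toCurrentAlgebra ((top X).of a) ∈ X.currentFiltration.fil p d :=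
  ⟨_, ⟨(top X).of_mem had, fun _ => ⟨_, ⟨a, ⟨ha, had⟩, rfl⟩, by simp⟩⟩, rfl⟩

theorem symbol_one : symbol X 0 1 = 1 := by
  change X.currentFiltration.symbol 0 (X.toCurrentAlgebra ((top X).of 1)) = 1
  rw [map_one, map_one, TopFiltration.symbol_one]

theorem symbol_mul {p q d e : ℤ} {a b : X.UEA} (ha : a ∈ fil X p) (had : a ∈ (top X).deg d)
    (hb : b ∈ fil X q) (hbe : b ∈ (top X).deg e) :
    symbol X (p + q) (a * b) = symbol X p a * symbol X q b := by
  change X.currentFiltration.symbol (p + q) (X.toCurrentAlgebra ((top X).of (a * b))) = _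
  rw [map_mul, map_mul]
  exact TopFiltration.symbol_mul (of_mem_currentFiltration ha had) (of_mem_currentFiltration hb hbe)

theorem symbol_comm {p q d e : ℤ} {a b : X.UEA} (ha : a ∈ fil X p) (had : a ∈ (top X).deg d)
    (hb : b ∈ fil X q) (hbe : b ∈ (top X).deg e) :
    X.grCurrent.br (symbol X p a) (symbol X q b) = symbol X (p + q - 1) (a * b - b * a) := by
  change _ = X.currentFiltration.symbol (p + q - 1)
    (X.toCurrentAlgebra ((top X).of (a * b - b * a)))
  simp only [map_sub, map_mul]
  rw [← map_sub]
  exact TopFiltration.symbol_comm (of_mem_currentFiltration ha had)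
    (of_mem_currentFiltration hb hbe)

theorem symbol_eq_zero {p q d : ℤ} {a : X.UEA} (hq : q < p) (ha : a ∈ fil X q)
    (had : a ∈ (top X).deg d) : symbol X p a = 0 :=
  TopFiltration.symbol_eq_zero (of_mem_currentFiltration (fil_mono X (by omega : q ≤ p - 1) ha) had)

theorem symbol_mem_deg {p d : ℤ} {a : X.UEA} (ha : a ∈ fil X p) (had : a ∈ (top X).deg d) :
    symbol X p a ∈ X.grCurrent.deg d :=
  TopFiltration.symbol_mem_deg (of_mem_currentFiltration ha had)

theorem symbol_mem_nhd {p d : ℤ} {n : ℕ} {a : X.UEA} (ha : a ∈ fil X p)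
    (had : a ∈ (top X).nhd d n) : symbol X p a ∈ X.grCurrent.nhd d n := by
  have had' := (top X).nhd_le d n had
  exact TopFiltration.symbol_mem_nhd
    ⟨_, ⟨⟨(top X).of_mem had', fun _ => ⟨_, ⟨a, ⟨ha, had'⟩, rfl⟩, by simp⟩⟩,
      (top X).of_mem_nhd had⟩, rfl⟩

/-- The symbols of a sequence in `G_p 𝒰(d)` which converges to zero in `U(V)` converge to zero. -/
theorem symbol_mem_nhd_of_limit {p d : ℤ} {a : ℕ → X.UEA} (ha : a ∈ (top X).cauchySeq d)
    (hp : ∀ i, a i ∈ fil X p) (h : X.toCurrentAlgebra ((top X).limit a ha) = 0) (n : ℕ) :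
    ∃ M, ∀ i, M ≤ i → symbol X p (a i) ∈ X.grCurrent.nhd d n := by
  obtain ⟨M, hM⟩ := (top X).limit_sub_of_mem ha (n := n)
  refine ⟨M, fun i hi => TopFiltration.symbol_mem_nhd
    ⟨-((top X).limit a ha - (top X).of (a i)), ⟨neg_mem (sub_mem ?_ ?_), neg_mem (hM i hi)⟩, ?_⟩⟩
  · exact (top X).limit_mem_closure ha hp
  · exact ⟨(top X).of_mem (ha.1 i), fun _ => ⟨_, ⟨a i, ⟨hp i, ha.1 i⟩, rfl⟩, by simp⟩⟩
  · simp [h]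

theorem nhd_le_symbol (d : ℤ) (m n : ℕ) : X.grCurrent.nhd d n ≤
    (⨆ p, (fil X p ⊓ (top X).nhd d n).map (symbol X p)) ⊔ X.grCurrent.nhd d m := by
  suffices h : (⨆ p, (X.currentFiltration.nhd p d n).map (X.currentFiltration.symbol p)) ≤
      (⨆ p, (fil X p ⊓ (top X).nhd d n).map (symbol X p)) ⊔ X.grCurrent.nhd d m from
    fun x hx => h (TopFiltration.gr_nhd_le d n hx)
  refine iSup_le fun p => ?_
  rintro _ ⟨_, ⟨a, ⟨ha, han⟩, rfl⟩, rfl⟩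
  obtain ⟨_, ⟨y, hy, rfl⟩, h⟩ := ha.2 (max m n)
  have hy' : y ∈ (top X).nhd d n := by
    refine (top X).mem_nhd_of_of_mem (iSupIndep_deg X) hy.2 ?_
    have := sub_mem han ((top X).completion.nhd_anti d (le_max_right m n) h)
    rwa [sub_sub_cancel] at this
  refine Submodule.mem_sup.2 ⟨symbol X p y, Submodule.mem_iSup_of_mem p ⟨y, ⟨hy.1, hy'⟩, rfl⟩,
    X.currentFiltration.symbol p (X.toCurrentAlgebra (a - (top X).of y)),
    TopFiltration.symbol_mem_nhd ⟨_, ⟨sub_mem ha ?_,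
      (top X).completion.nhd_anti d (le_max_left m n) h⟩, rfl⟩, ?_⟩
  · exact ⟨(top X).of_mem hy.2, fun _ => ⟨_, ⟨y, hy, rfl⟩, by simp⟩⟩
  · rw [map_sub, map_sub]
    exact add_sub_cancel _ _

theorem deg_le_symbol (d : ℤ) (m : ℕ) : X.grCurrent.deg d ≤
    (⨆ p, (fil X p ⊓ (top X).deg d).map (symbol X p)) ⊔ X.grCurrent.nhd d m := by
  suffices h : (⨆ p, (X.currentFiltration.fil p d).map (X.currentFiltration.symbol p)) ≤
      (⨆ p, (fil X p ⊓ (top X).deg d).map (symbol X p)) ⊔ X.grCurrent.nhd d m from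
    fun x hx => h (TopFiltration.gr_deg_le d hx)
  refine iSup_le fun p => ?_
  rintro _ ⟨_, ⟨a, ha, rfl⟩, rfl⟩
  obtain ⟨_, ⟨y, hy, rfl⟩, h⟩ := ha.2 m
  refine Submodule.mem_sup.2 ⟨symbol X p y, Submodule.mem_iSup_of_mem p ⟨y, hy, rfl⟩,
    X.currentFiltration.symbol p (X.toCurrentAlgebra (a - (top X).of y)),
    TopFiltration.symbol_mem_nhd ⟨_, ⟨sub_mem ha ?_, h⟩, rfl⟩, ?_⟩
  · exact ⟨(top X).of_mem hy.2, fun _ => ⟨_, ⟨y, hy, rfl⟩, by simp⟩⟩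
  · rw [map_sub, map_sub]
    exact add_sub_cancel _ _

end UEA

end VertexOperatorAlgebra

/-! ### The homomorphism from `𝕊` to `gr U(V)` -/

/-- The universal property of the symmetric algebra, for targets whose multiplication is
commutative without being bundled as such. -/
theorem exists_algHom_symmetricAlgebra {k L A : Type*} [Field k] [AddCommGroup L] [Module k L]
    [Ring A] [Algebra k A] (h : ∀ a b : A, a * b = b * a) (φ : L →ₗ[k] A) :
    ∃ f : SymmetricAlgebra k L →ₐ[k] A, ∀ x, f (SymmetricAlgebra.ι k L x) = φ x := by
  let _ : CommRing A := { ‹Ring A› with mul_comm := h }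
  exact ⟨SymmetricAlgebra.lift φ, fun x => SymmetricAlgebra.lift_ι_apply ..⟩

theorem map_mem_of_mem_wordSpan {k A A' L : Type*} [Field k] [Ring A] [Algebra k A] [Ring A']
    [Algebra k A'] [AddCommGroup L] [Module k L] (F : ℤ → Submodule k L) (j : L →ₗ[k] A)
    (f : A →ₐ[k] A') (S : ℤ → Submodule k A') (h1 : 1 ∈ S 0)
    (hmul : ∀ d e, ∀ a ∈ S d, ∀ b ∈ S e, a * b ∈ S (d + e)) (hj : ∀ d, ∀ x ∈ F d, f (j x) ∈ S d)
    {d : ℤ} {a : A} (ha : a ∈ wordSpan F j d) : f a ∈ S d := by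
  have : wordSpan F j d ≤ (S d).comap f.toLinearMap := by
    refine Submodule.span_le.2 ?_
    rintro _ ⟨l, hl, rfl, rfl⟩
    clear ha
    induction l with
    | nil => simpa using h1
    | cons y l ih =>
      have := hmul _ _ _ (hj _ _ (hl y List.mem_cons_self)) _
        (ih fun z hz => hl z (List.mem_cons_of_mem _ hz))
      simpa using this
  exact this ha

namespace VertexOperatorAlgebra

variable {k V : Type*} [Field k] [AddCommGroup V] [Module k V] (X : VertexOperatorAlgebra k V)
  [CharZero k]

namespace UEA

variable {X}

theorem J_mem_fil {r p : ℤ} (h : r ≤ p) {u : V} (hu : u ∈ X.wt r) (n : ℤ) : J X r n u ∈ fil X p :=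
  mem_wordSpan _ _ (CurrentLie.J_mem_fil h hu n)

theorem borcherdsTerm_mem_fil {r s : ℤ} {u v : V} (hu : u ∈ X.wt r) (hv : v ∈ X.wt s)
    (l m n : ℤ) (i : ℕ) : borcherdsTerm X r s l m n u v i ∈ fil X (r + s) := by
  refine add_mem (neg_mem (zsmul_mem ?_ _)) (zsmul_mem (zsmul_mem ?_ _) _)
  · exact mul_mem_wordSpan _ _ (J_mem_fil le_rfl hu _) (J_mem_fil le_rfl hv _)
  · rw [add_comm r s]
    exact mul_mem_wordSpan _ _ (J_mem_fil le_rfl hv _) (J_mem_fil le_rfl hu _)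

variable (X) in
/-- For `l = 1 - r` only the first term of the finite sum in `B_{l,m,n}(u, v)` remains. -/
theorem borcherdsConst_one_sub (r s m n : ℤ) (u v : V) :
    borcherdsConst X r s (1 - r) m n u v = J X (r + s - n - 1) (1 - r + m + n) (X.prod n u v) := by
  rw [borcherdsConst, finsum_eq_single _ 0]
  · simp
  · intro i hi
    obtain ⟨i, rfl⟩ := Nat.exists_eq_succ_of_ne_zero hi
    rw [show 1 - r + r - 1 = (0 : ℤ) by ring, Nat.succ_eq_add_one, Ring.choose_zero_succ, zero_smul]

/-- The elements `Jₘ(w)` with `w ∈ C₂(V)` have symbol zero: the relation `B_{1-r,m,n}(u, v) = 0`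
expresses `J(u₍ₙ₎v)` as a limit of elements of `G_{r+s}`, whereas `u₍ₙ₎v` has weight
`r + s - n - 1 > r + s` for `n ≤ -2`. -/
theorem symbol_J_prod_eq_zero {r s : ℤ} {u v : V} (hu : u ∈ X.wt r) (hv : v ∈ X.wt s) {n : ℤ}
    (hn : n ≤ -2) (m : ℤ) :
    symbol X (r + s - n - 1) (J X (r + s - n - 1) m (X.prod n u v)) = 0 := by
  obtain ⟨m, rfl⟩ : ∃ m', m = 1 - r + m' + n := ⟨m - 1 + r - n, by ring⟩
  have hc := borcherds_mem_cauchySeq X hu hv (1 - r) m n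
  have h0 : X.toCurrentAlgebra ((top X).limit _ hc) = 0 :=
    X.toCurrentAlgebra_borcherdsElt hu hv (1 - r) m n
  rw [← borcherdsConst_one_sub X r s m n u v]
  set c := borcherdsConst X r s (1 - r) m n u v with hcdef
  have hcd : c ∈ (top X).deg (-(1 - r + m + n)) := by
    rw [hcdef, borcherdsConst_one_sub]
    exact J_mem (X.prod_mem n hu hv) _
  have hc' : (fun N => c - (c + ∑ i ∈ Finset.range N, borcherdsTerm X r s (1 - r) m n u v i)) ∈
      (top X).cauchySeq (-(1 - r + m + n)) := sub_mem ((top X).const_mem_cauchySeq hcd) hc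
  have h1 := (top X).limit_mem_closure (G := fil X (r + s)) hc' fun N => by
    rw [sub_add_cancel_left]
    exact neg_mem (sum_mem fun i _ => borcherdsTerm_mem_fil hu hv _ _ _ i)
  have h2 : X.toCurrentAlgebra ((top X).of c) =
      X.toCurrentAlgebra ((top X).limit _ hc') := by
    have : (top X).limit _ hc' = (top X).of c - (top X).limit _ hc := rfl
    rw [this, map_sub, h0, sub_zero]
  have h3 : X.toCurrentAlgebra ((top X).of c) ∈
      X.currentFiltration.fil (r + s - n - 1 - 1) (-(1 - r + m + n)) :=
    X.currentFiltration.mono _ (by omega : r + s ≤ r + s - n - 1 - 1) ⟨_, h1, h2.symm⟩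
  exact TopFiltration.symbol_eq_zero h3

end UEA

/-- The map `V → gr U(V)` which sends a homogeneous element `u` to the symbol of `u ⊗ tⁿ`. -/
theorem exists_symbolMap (n : ℤ) : ∃ g : X.Zhu →ₗ[k] X.currentFiltration.Gr,
    ∀ r, ∀ u ∈ X.wt r, g (Zhu.mk X u) =
      UEA.symbol X r (UEA.ι X (CurrentLie.mk X (Finsupp.single n u))) := by
  obtain ⟨g, hg⟩ := exists_linearMap_of_isInternal X.isInternal fun r =>
    UEA.symbol X r ∘ₗ UEA.ι X ∘ₗ CurrentLie.mk X ∘ₗ Finsupp.lsingle n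
  have hC : X.C2 ≤ LinearMap.ker g := by
    refine Submodule.span_le.2 ?_
    rintro _ ⟨l, hl, u, v, rfl⟩
    refine bilin_mem_of_iSup X.wt X.wt (X.prod l) (LinearMap.ker g) ?_ u
      (X.iSup_wt ▸ Submodule.mem_top) v (X.iSup_wt ▸ Submodule.mem_top)
    intro r s u hu v hv
    rw [LinearMap.mem_ker, hg _ _ (X.prod_mem l hu hv)]
    have := UEA.symbol_J_prod_eq_zero hu hv hl (n - (r + s - l - 1) + 1)
    rw [UEA.J, LinearMap.comp_apply, CurrentLie.J, LinearMap.comp_apply,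
      show n - (r + s - l - 1) + 1 + (r + s - l - 1) - 1 = n by ring] at this
    exact this
  exact ⟨X.C2.liftQ g hC, fun r u hu => hg r u hu⟩

theorem CurrentLie.mk_single_vac {n : ℤ} (hn : n ≠ -1) :
    CurrentLie.mk X (Finsupp.single n X.vac) = 0 := by
  have h : CurrentLie.mk X (X.del (Finsupp.single (n + 1) X.vac)) = 0 :=
    CurrentLie.mk_eq_zero ⟨_, rfl⟩
  rw [X.del_single, X.vac_two_vac, Finsupp.single_zero, zero_add, add_sub_cancel_right, map_zsmul,
    ← Int.cast_smul_eq_zsmul k] at h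
  exact (smul_eq_zero.1 h).resolve_left (by exact_mod_cast fun h => hn (by omega))

/-- The homomorphism `𝕊 → gr U(V)` which sends `Ψ̃ₙ(u)` to the symbol of `Jₙ(u)`. -/
theorem exists_symbolHom : ∃ f : X.zhu.LoopSym →ₐ[k] X.currentFiltration.Gr,
    ∀ r n, ∀ u ∈ X.wt r, f (GradedPoissonAlgebra.LoopSym.psi X.zhu r n (Zhu.mk X u)) =
      UEA.symbol X r (UEA.J X r n u) := by
  choose g hg using X.exists_symbolMap
  have h1 : GradedPoissonAlgebra.units (k := k) (P := X.Zhu) ≤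
      LinearMap.ker (Finsupp.lsum k g) := by
    refine Submodule.span_le.2 ?_
    rintro _ ⟨n, hn, rfl⟩
    rw [SetLike.mem_coe, LinearMap.mem_ker, Finsupp.lsum_single, Zhu.one_def,
      hg n 0 X.vac X.vac_mem, CurrentLie.mk_single_vac X hn, map_zero, map_zero]
  let φ : X.zhu.LoopLie →ₗ[k] X.currentFiltration.Gr :=
    (GradedPoissonAlgebra.units (k := k) (P := X.Zhu)).liftQ _ h1
  have hφ : ∀ r n, ∀ u ∈ X.wt r, φ (GradedPoissonAlgebra.LoopLie.psi X.zhu r n (Zhu.mk X u)) =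
      UEA.symbol X r (UEA.J X r n u) := by
    intro r n u hu
    have : φ (GradedPoissonAlgebra.LoopLie.psi X.zhu r n (Zhu.mk X u)) =
        Finsupp.lsum k g (Finsupp.single (n + r - 1) (Zhu.mk X u)) := rfl
    rw [this, Finsupp.lsum_single, hg _ r u hu]
    rfl
  obtain ⟨f, hf⟩ := exists_algHom_symmetricAlgebra X.grCurrent.mul_comm φ
  have h2 : ∀ a ∈ X.zhu.unitIdeal, f a = 0 := by
    intro a ha
    obtain ⟨b, rfl⟩ := Ideal.mem_span_singleton'.1 ha
    rw [map_mul, map_sub, hf, map_one f, Zhu.one_def, hφ 0 0 X.vac X.vac_mem]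
    have : UEA.J X 0 0 X.vac = 1 := UEA.ι_vac X
    rw [this, UEA.symbol_one, sub_self, mul_zero]
  refine ⟨Ideal.Quotient.liftₐ X.zhu.unitIdeal f h2, fun r n u hu => ?_⟩
  exact (hf _).trans (hφ r n u hu)

end VertexOperatorAlgebra

theorem exists_sub_mem_of_le_sup {k A B : Type*} [Field k] [Ring A] [Algebra k A] [Ring B]
    [Algebra k B] (f : A →ₐ[k] B) {P : Submodule k A} {Q S S' : Submodule k B} (h : S ≤ Q ⊔ S')
    (hQ : Q ≤ P.map f.toLinearMap) {b : B} (hb : b ∈ S) : ∃ a ∈ P, b - f a ∈ S' := by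
  obtain ⟨x, hx, y, hy, rfl⟩ := Submodule.mem_sup.1 (h hb)
  obtain ⟨a, ha, rfl⟩ := hQ hx
  exact ⟨a, ha, by simpa using hy⟩

namespace VertexOperatorAlgebra

variable {k V : Type*} [Field k] [AddCommGroup V] [Module k V] (X : VertexOperatorAlgebra k V)
  [CharZero k]

open GradedPoissonAlgebra

/-- The homomorphism `𝕊 → gr U(V)` which sends `Ψ̃ₙ(u)` to the symbol of `Jₙ(u)`. -/
noncomputable def symbolHom : X.zhu.LoopSym →ₐ[k] X.currentFiltration.Gr :=
  X.exists_symbolHom.choose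

variable {X} in
theorem symbolHom_psi (r n : ℤ) {u : V} (hu : u ∈ X.wt r) :
    X.symbolHom (LoopSym.psi X.zhu r n (Zhu.mk X u)) = UEA.symbol X r (UEA.J X r n u) :=
  X.exists_symbolHom.choose_spec r n u hu

/-- The span of the symbols of the homogeneous elements of degree `d` of `𝒰`. -/
noncomputable def symbolSpan (d : ℤ) : Submodule k X.currentFiltration.Gr :=
  ⨆ p, (UEA.fil X p ⊓ (UEA.top X).deg d).map (UEA.symbol X p)

variable {X}

theorem symbol_mem_symbolSpan {p d : ℤ} {a : X.UEA} (ha : a ∈ UEA.fil X p)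
    (had : a ∈ (UEA.top X).deg d) : UEA.symbol X p a ∈ X.symbolSpan d :=
  Submodule.mem_iSup_of_mem p ⟨a, ⟨ha, had⟩, rfl⟩

theorem mul_mem_symbolSpan (d e : ℤ) : ∀ a ∈ X.symbolSpan d, ∀ b ∈ X.symbolSpan e,
    a * b ∈ X.symbolSpan (d + e) := by
  refine bilin_mem_of_iSup _ _ (LinearMap.mul k X.currentFiltration.Gr) (X.symbolSpan (d + e)) ?_
  rintro p q _ ⟨a, ⟨ha, had⟩, rfl⟩ _ ⟨b, ⟨hb, hbe⟩, rfl⟩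
  rw [LinearMap.mul_apply', ← UEA.symbol_mul ha had hb hbe]
  exact symbol_mem_symbolSpan (mul_mem_wordSpan _ _ ha hb) ((UEA.top X).mul_mem had hbe)

theorem mul_mem_nhd_of_symbolSpan {d j : ℤ} {n : ℕ} (hj : j ≤ -(n : ℤ) - 1) :
    ∀ a ∈ X.symbolSpan (d - j), ∀ b ∈ X.symbolSpan j, a * b ∈ X.grCurrent.nhd d n := by
  refine bilin_mem_of_iSup _ _ (LinearMap.mul k X.currentFiltration.Gr) (X.grCurrent.nhd d n) ?_
  rintro p q _ ⟨a, ⟨ha, had⟩, rfl⟩ _ ⟨b, ⟨hb, hbe⟩, rfl⟩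
  rw [LinearMap.mul_apply', ← UEA.symbol_mul ha had hb hbe]
  exact UEA.symbol_mem_nhd (mul_mem_wordSpan _ _ ha hb)
    (Submodule.mem_iSup_of_mem j (Submodule.mem_iSup_of_mem hj (Submodule.mul_mem_mul had hbe)))

theorem symbolHom_mem_symbolSpan {d : ℤ} {a : X.zhu.LoopSym}
    (ha : a ∈ (LoopSym.poisson X.zhu).deg d) : X.symbolHom a ∈ X.symbolSpan d := by
  refine map_mem_of_mem_wordSpan (LoopLie.deg X.zhu) (LoopSym.ι X.zhu) X.symbolHom X.symbolSpan
    ?_ mul_mem_symbolSpan ?_ ha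
  · rw [← UEA.symbol_one]
    exact symbol_mem_symbolSpan (one_mem_wordSpan _ _) (UEA.top X).one_mem
  · intro d
    have : LoopLie.deg X.zhu d ≤
        (X.symbolSpan d).comap (X.symbolHom.toLinearMap ∘ₗ LoopSym.ι X.zhu) := by
      refine iSup_le fun r => ?_
      rintro _ ⟨_, ⟨u, hu, rfl⟩, rfl⟩
      change X.symbolHom (LoopSym.psi X.zhu r (-d) (Zhu.mk X u)) ∈ X.symbolSpan d
      rw [symbolHom_psi r (-d) hu]
      have := UEA.J_mem hu (-d)
      rw [neg_neg] at this
      exact symbol_mem_symbolSpan (UEA.J_mem_fil le_rfl hu _) this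
    exact this

variable (X) in
theorem isContHom_symbolHom : DegreewiseTop.IsContHom (LoopSym.poisson X.zhu).toDegreewiseTop
    X.grCurrent.toDegreewiseTop X.symbolHom where
  map_deg d a ha := by
    have : X.symbolSpan d ≤ X.grCurrent.deg d := by
      refine iSup_le fun p => ?_
      rintro _ ⟨a, ⟨ha, had⟩, rfl⟩
      exact UEA.symbol_mem_deg ha had
    exact this (symbolHom_mem_symbolSpan ha)
  continuous d n := by
    refine ⟨n, ?_⟩
    have : (LoopSym.poisson X.zhu).nhd d n ≤
        (X.grCurrent.nhd d n).comap X.symbolHom.toLinearMap :=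
      iSup₂_le fun j hj => Submodule.mul_le.2 fun a ha b hb => by
        rw [Submodule.mem_comap, AlgHom.toLinearMap_apply, map_mul]
        exact mul_mem_nhd_of_symbolSpan hj _ (symbolHom_mem_symbolSpan ha) _
          (symbolHom_mem_symbolSpan hb)
    exact this

/-! ### Lifting symbols -/

/-- A product of generators of total weight `p` has as symbol the product of their symbols, and
products of smaller weights have symbol zero. -/
theorem exists_symbolHom_eq_of_letterSpan {S : Set ℤ} {p d : ℤ} {a : X.UEA}
    (ha : a ∈ UEA.letterSpan X S p d) :
    ∃ b ∈ (LoopSym.poisson X.zhu).deg d, X.symbolHom b = UEA.symbol X p a := by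
  have : UEA.letterSpan X S p d ≤
      (((LoopSym.poisson X.zhu).deg d).map X.symbolHom.toLinearMap).comap (UEA.symbol X p) := by
    refine Submodule.span_le.2 ?_
    rintro _ ⟨l, hl, hp, rfl, rfl⟩
    have key : (l.map fun y => UEA.J X y.1 (-y.2.1) y.2.2).prod ∈
        UEA.letterSpan X S (l.map fun y => y.1).sum (l.map fun y => y.2.1).sum :=
      Submodule.subset_span ⟨l, hl, le_rfl, rfl, rfl⟩
    rcases hp.lt_or_eq with h | rfl
    · rw [SetLike.mem_coe, Submodule.mem_comap,
        UEA.symbol_eq_zero h (UEA.letterSpan_le_fil _ _ _ key) (UEA.letterSpan_le_deg _ _ _ key)]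
      exact zero_mem _
    · clear ha hp key
      induction l with
      | nil =>
        refine ⟨1, (LoopSym.poisson X.zhu).one_mem, ?_⟩
        simp only [List.map_nil, List.prod_nil, List.sum_nil, UEA.symbol_one]
        exact map_one X.symbolHom
      | cons y l ih =>
        have hl' := fun z hz => hl z (List.mem_cons_of_mem y hz)
        have hy := (hl y List.mem_cons_self).2
        obtain ⟨b, hb, hb'⟩ := ih hl'
        have key : (l.map fun y => UEA.J X y.1 (-y.2.1) y.2.2).prod ∈
            UEA.letterSpan X S (l.map fun y => y.1).sum (l.map fun y => y.2.1).sum :=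
          Submodule.subset_span ⟨l, hl', le_rfl, rfl, rfl⟩
        refine ⟨LoopSym.psi X.zhu y.1 (-y.2.1) (Zhu.mk X y.2.2) * b, ?_, ?_⟩
        · have := (LoopSym.poisson X.zhu).mul_mem
            (LoopSym.psi_mem (Q := X.zhu) (r := y.1) ⟨_, hy, rfl⟩ (-y.2.1)) hb
          rw [neg_neg] at this
          exact this
        · simp only [List.map_cons, List.prod_cons, List.sum_cons]
          rw [UEA.symbol_mul (UEA.J_mem_fil le_rfl hy _) (UEA.J_mem hy _)
            (UEA.letterSpan_le_fil _ _ _ key) (UEA.letterSpan_le_deg _ _ _ key),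
            AlgHom.toLinearMap_apply, map_mul, symbolHom_psi _ _ hy]
          exact congrArg _ hb'
  exact this ha

theorem exists_symbolHom_eq_of_sortedSpan {n : ℕ} {p d : ℤ} {a : X.UEA}
    (ha : a ∈ UEA.sortedSpan X (Set.Iic (-(n : ℤ) - 1)) p d) :
    ∃ b ∈ (LoopSym.poisson X.zhu).nhd d n, X.symbolHom b = UEA.symbol X p a := by
  have : UEA.sortedSpan X (Set.Iic (-(n : ℤ) - 1)) p d ≤
      (((LoopSym.poisson X.zhu).nhd d n).map X.symbolHom.toLinearMap).comap (UEA.symbol X p) := by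
    refine Submodule.span_le.2 ?_
    rintro _ ⟨q, q', e, rfl, he, x, hx, y, hy, rfl⟩
    obtain ⟨b, hb, hb'⟩ := exists_symbolHom_eq_of_letterSpan hx
    obtain ⟨c, hc, hc'⟩ := exists_symbolHom_eq_of_letterSpan hy
    refine ⟨b * c, Submodule.mem_iSup_of_mem e (Submodule.mem_iSup_of_mem he
      (Submodule.mul_mem_mul hb hc)), ?_⟩
    rw [AlgHom.toLinearMap_apply, map_mul, hb', hc']
    exact (UEA.symbol_mul (UEA.letterSpan_le_fil _ _ _ hx) (UEA.letterSpan_le_deg _ _ _ hx)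
      (UEA.letterSpan_le_fil _ _ _ hy) (UEA.letterSpan_le_deg _ _ _ hy)).symm
  exact this ha

variable (X) in
/-- The homomorphism of completions induced by `𝕊 → gr U(V)` is surjective, by the strictness of
the weight filtration. -/
theorem completionMap_symbolHom_surjective :
    Function.Surjective X.isContHom_symbolHom.completionMap := by
  refine X.isContHom_symbolHom.completionMap_surjective (fun d n b hb => ?_) fun d m n b hb => ?_
  · have h : (⨆ p, (UEA.fil X p ⊓ (UEA.top X).deg d).map (UEA.symbol X p)) ≤
        ((LoopSym.poisson X.zhu).deg d).map X.symbolHom.toLinearMap := by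
      refine iSup_le fun p => ?_
      rintro _ ⟨a, ha, rfl⟩
      exact exists_symbolHom_eq_of_letterSpan (UEA.fil_inf_deg_le p d ha)
    exact exists_sub_mem_of_le_sup X.symbolHom (UEA.deg_le_symbol d n) h hb
  · have h : (⨆ p, (UEA.fil X p ⊓ (UEA.top X).nhd d n).map (UEA.symbol X p)) ≤
        ((LoopSym.poisson X.zhu).nhd d n).map X.symbolHom.toLinearMap := by
      refine iSup_le fun p => ?_
      rintro _ ⟨a, ha, rfl⟩
      exact exists_symbolHom_eq_of_sortedSpan (UEA.fil_inf_nhd_le p d n ha)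
    exact exists_sub_mem_of_le_sup X.symbolHom (UEA.nhd_le_symbol d m n) h hb

/-! ### Compatibility with the brackets -/

theorem symbolHom_br_psi (r s m n : ℤ) {u v : V} (hu : u ∈ X.wt r) (hv : v ∈ X.wt s) :
    X.symbolHom (LoopSym.psi X.zhu (r + s - 1) (m + n) (X.zhu.br (Zhu.mk X u) (Zhu.mk X v))) =
      X.grCurrent.br (UEA.symbol X r (UEA.J X r m u)) (UEA.symbol X s (UEA.J X s n v)) := by
  rw [UEA.symbol_comm (UEA.J_mem_fil le_rfl hu m) (UEA.J_mem hu m) (UEA.J_mem_fil le_rfl hv n)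
    (UEA.J_mem hv n)]
  obtain ⟨N, hN⟩ := X.trunc u v
  have h0 := X.prod_mem 0 hu hv
  rw [sub_zero] at h0
  have h1 : UEA.J X r m u * UEA.J X s n v - UEA.J X s n v * UEA.J X r m u =
      ∑ i ∈ Finset.range (N + 1), Ring.choose (m + r - 1) i •
        UEA.J X (r + s - i - 1) (m + n) (X.prod i u v) := by
    have h := UEA.ι_lie X (CurrentLie.J X r m u) (CurrentLie.J X s n v)
    rw [CurrentLie.lie_J X r s m n u v (N + 1) fun i hi => hN i (by omega), map_sum] at h
    simp only [map_zsmul] at h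
    exact h.symm
  -- the terms with `i > 0` have smaller weights
  have h2 : ∀ i ∈ Finset.range N, UEA.symbol X (r + s - 1)
      (Ring.choose (m + r - 1) (i + 1) • UEA.J X (r + s - ((i + 1 : ℕ) : ℤ) - 1) (m + n)
        (X.prod ((i + 1 : ℕ) : ℤ) u v)) = 0 := by
    intro i _
    have h := X.prod_mem ((i + 1 : ℕ) : ℤ) hu hv
    exact UEA.symbol_eq_zero (by push_cast; omega)
      (zsmul_mem (UEA.J_mem_fil le_rfl h (m + n)) _) (zsmul_mem (UEA.J_mem h (m + n)) _)
  rw [h1, Finset.sum_range_succ', map_add, map_sum, Finset.sum_eq_zero h2, zero_add,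
    Ring.choose_zero_right, one_smul, Nat.cast_zero, sub_zero]
  exact symbolHom_psi (r + s - 1) (m + n) h0

variable (X) in
theorem symbolHom_br (a b : X.zhu.LoopSym) :
    X.symbolHom ((LoopSym.poisson X.zhu).br a b) =
      X.grCurrent.br (X.symbolHom a) (X.symbolHom b) := by
  refine PoissonBracket.map_br_of_adjoin (LoopSym.poissonBracket X.zhu)
    X.grCurrent.toPoissonBracket X.symbolHom (LoopSym.ι X.zhu) (LoopSym.adjoin_ι X.zhu) ?_ a b
  let φ : X.zhu.LoopLie →ₗ[k] X.currentFiltration.Gr :=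
    X.symbolHom.toLinearMap ∘ₗ LoopSym.ι X.zhu
  let B : X.zhu.LoopLie →ₗ[k] X.zhu.LoopLie →ₗ[k] X.currentFiltration.Gr :=
    (LoopLie.bracket X.zhu).compr₂ φ - X.grCurrent.br.compl₁₂ φ φ
  have hB : ∀ d e, ∀ x ∈ LoopLie.deg X.zhu d, ∀ y ∈ LoopLie.deg X.zhu e,
      B x y ∈ (⊥ : Submodule k X.currentFiltration.Gr) := by
    intro d e
    refine bilin_mem_of_iSup (fun r => (X.zhu.wt r).map (LoopLie.psi X.zhu r (-d)))
      (fun r => (X.zhu.wt r).map (LoopLie.psi X.zhu r (-e))) B ⊥ ?_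
    rintro r s _ ⟨_, ⟨u, hu, rfl⟩, rfl⟩ _ ⟨_, ⟨v, hv, rfl⟩, rfl⟩
    refine (Submodule.mem_bot k).2 (sub_eq_zero.2 ?_)
    change X.symbolHom (LoopSym.ι X.zhu (LoopLie.bracket X.zhu _ _)) =
      X.grCurrent.br (X.symbolHom (LoopSym.psi X.zhu r (-d) (Zhu.mk X u)))
        (X.symbolHom (LoopSym.psi X.zhu s (-e) (Zhu.mk X v)))
    rw [LoopLie.bracket_psi, symbolHom_psi _ _ hu, symbolHom_psi _ _ hv]
    exact symbolHom_br_psi r s (-d) (-e) hu hv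
  intro x y
  have h := bilin_mem_of_iSup (LoopLie.deg X.zhu) (LoopLie.deg X.zhu) B ⊥ hB x
    (LoopLie.iSup_deg X.zhu ▸ Submodule.mem_top) y (LoopLie.iSup_deg X.zhu ▸ Submodule.mem_top)
  rw [LoopSym.br_ι]
  exact sub_eq_zero.1 ((Submodule.mem_bot k).1 h)

end VertexOperatorAlgebra

/-! ### The relations of the Poisson current algebra -/

theorem sum_add_sum_eq_sum_Ico {M : Type*} [AddCommMonoid M] (g : ℤ → M) (m : ℤ) (K : ℕ) :
    (∑ i ∈ Finset.range K, g (m + i)) + ∑ i ∈ Finset.range K, g (m - 1 - i) =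
      ∑ j ∈ Finset.Ico (m - K) (m + K), g j := by
  induction K with
  | zero => simp
  | succ K ih =>
    have h : Finset.Ico (m - ((K + 1 : ℕ) : ℤ)) (m + ((K + 1 : ℕ) : ℤ)) =
        insert (m + (K : ℤ)) (insert (m - 1 - (K : ℤ)) (Finset.Ico (m - K) (m + K))) := by
      ext j
      simp only [Finset.mem_insert, Finset.mem_Ico]
      omega
    rw [h, Finset.sum_insert (by simp only [Finset.mem_insert, Finset.mem_Ico]; omega),
      Finset.sum_insert (by simp only [Finset.mem_Ico]; omega), ← ih, Finset.sum_range_succ,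
      Finset.sum_range_succ, add_add_add_comm, add_comm, add_assoc]

namespace VertexOperatorAlgebra

variable {k V : Type*} [Field k] [AddCommGroup V] [Module k V] {X : VertexOperatorAlgebra k V}
  [CharZero k]

open GradedPoissonAlgebra

theorem UEA.borcherdsTerm_neg_one (r s l m : ℤ) (u v : V) (i : ℕ) :
    UEA.borcherdsTerm X r s l m (-1) u v i =
      -(UEA.J X r (l - 1 - i) u * UEA.J X s (m + i) v +
        UEA.J X s (m - 1 - i) v * UEA.J X r (l + i) u) := by
  have h : (-1 : ℤ) ^ i * Ring.choose (-1 : ℤ) i = 1 := by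
    rw [choose_neg_one_pow, ← mul_assoc, ← mul_pow, show (1 : ℤ) + i - 1 = i by ring,
      Ring.choose_natCast]
    simp
  rw [UEA.borcherdsTerm, h]
  simp only [one_smul, Int.negOnePow_neg, Int.negOnePow_one, Units.val_neg, Units.val_one, neg_smul,
    ← sub_eq_add_neg]
  abel

/-- The partial sums of `B_{1-r,m+r,-1}(u, v)` have as symbols the images of partial sums of
`Ψ̃ₘ(xy) - ∑ⱼ Ψ̃ₘ₋ⱼ(x) Ψ̃ⱼ(y)`, where `x` and `y` are the classes of `u` and `v`. -/
theorem symbol_borcherds_eq {r s : ℤ} {u v : V} (hu : u ∈ X.wt r) (hv : v ∈ X.wt s) (m : ℤ)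
    (K : ℕ) :
    UEA.symbol X (r + s) (UEA.borcherdsConst X r s (1 - r) (m + r) (-1) u v +
      ∑ i ∈ Finset.range K, UEA.borcherdsTerm X r s (1 - r) (m + r) (-1) u v i) =
    X.symbolHom (LoopSym.psi X.zhu (r + s) m (Zhu.mk X u * Zhu.mk X v) -
      ∑ j ∈ Finset.Ico (m + r - K) (m + r + K),
        LoopSym.psi X.zhu r (m - j) (Zhu.mk X u) * LoopSym.psi X.zhu s j (Zhu.mk X v)) := by
  have h0 := X.prod_mem (-1) hu hv
  rw [show r + s - (-1) - 1 = r + s by ring] at h0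
  have h1 : ∀ j, UEA.symbol X (r + s) (UEA.J X r (m - j) u * UEA.J X s j v) =
      X.symbolHom (LoopSym.psi X.zhu r (m - j) (Zhu.mk X u) *
        LoopSym.psi X.zhu s j (Zhu.mk X v)) := fun j => by
    rw [UEA.symbol_mul (UEA.J_mem_fil le_rfl hu _) (UEA.J_mem hu _) (UEA.J_mem_fil le_rfl hv _)
      (UEA.J_mem hv _), map_mul, symbolHom_psi _ _ hu, symbolHom_psi _ _ hv]
  have h2 : ∀ j, UEA.symbol X (r + s) (UEA.J X s j v * UEA.J X r (m - j) u) =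
      X.symbolHom (LoopSym.psi X.zhu r (m - j) (Zhu.mk X u) *
        LoopSym.psi X.zhu s j (Zhu.mk X v)) := fun j => by
    rw [add_comm r s, UEA.symbol_mul (UEA.J_mem_fil le_rfl hv _) (UEA.J_mem hv _)
      (UEA.J_mem_fil le_rfl hu _) (UEA.J_mem hu _), X.grCurrent.mul_comm, map_mul,
      symbolHom_psi _ _ hu, symbolHom_psi _ _ hv]
  rw [UEA.borcherdsConst_one_sub, show r + s - (-1) - 1 = r + s by ring,
    show 1 - r + (m + r) + -1 = m by ring, map_add, map_sum, map_sub, map_sum, Zhu.mk_mul,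
    symbolHom_psi _ _ h0, sub_eq_add_neg (UEA.symbol X (r + s) (UEA.J X (r + s) m _))]
  congr 1
  rw [← sum_add_sum_eq_sum_Ico, ← Finset.sum_add_distrib, ← Finset.sum_neg_distrib]
  refine Finset.sum_congr rfl fun i _ => ?_
  rw [UEA.borcherdsTerm_neg_one, map_neg, map_add, ← h1, ← h2]
  rw [show m - (m + r + (i : ℤ)) = 1 - r - 1 - i by ring,
    show m - (m + r - 1 - (i : ℤ)) = 1 - r + i by ring]

/-- The relations of the Poisson current algebra hold in the completion of `gr U(V)`. -/
theorem symbolHom_relSeq_mem_nullSeq {r s : ℤ} {u v : V} (hu : u ∈ X.wt r) (hv : v ∈ X.wt s)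
    (m : ℤ) : DegreewiseTop.seqMap X.symbolHom
      (LoopSym.relSeq X.zhu r s m (Zhu.mk X u) (Zhu.mk X v)) ∈ X.grCurrent.nullSeq (-m) := by
  have hx : Zhu.mk X u ∈ X.zhu.wt r := ⟨u, hu, rfl⟩
  have hy : Zhu.mk X v ∈ X.zhu.wt s := ⟨v, hv, rfl⟩
  have hrel := LoopSym.relSeq_mem hx hy m
  refine X.grCurrent.mem_nullSeq (fun i => X.isContHom_symbolHom.map_deg _ _ (hrel.1 i))
    fun n => ?_
  have hc := UEA.borcherds_mem_cauchySeq X hu hv (1 - r) (m + r) (-1)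
  obtain ⟨M₁, hM₁⟩ := UEA.symbol_mem_nhd_of_limit (p := r + s) hc (fun K => by
      have h0 := X.prod_mem (-1) hu hv
      rw [show r + s - (-1) - 1 = r + s by ring] at h0
      rw [UEA.borcherdsConst_one_sub, show r + s - (-1) - 1 = r + s by ring]
      exact add_mem (UEA.J_mem_fil le_rfl h0 _)
        (sum_mem fun i _ => UEA.borcherdsTerm_mem_fil hu hv _ _ _ i))
    (X.toCurrentAlgebra_borcherdsElt hu hv (1 - r) (m + r) (-1)) n
  rw [show -(1 - r + (m + r) + -1) = -m by ring] at hM₁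
  obtain ⟨n', hn'⟩ := X.isContHom_symbolHom.continuous (-m) n
  obtain ⟨M₂, hM₂⟩ := LoopSym.psi_mul_mem_nhd hx hy m n'
  refine ⟨max M₁ M₂, fun N hN => ?_⟩
  -- the interval of summation of the `K`-th partial sum contains `[-N, N]`
  set K : ℕ := N + 1 + (m + r).natAbs with hK
  have hsub : Finset.Icc (-(N : ℤ)) N ⊆ Finset.Ico (m + r - K) (m + r + K) := by
    intro j hj
    rw [Finset.mem_Icc] at hj
    rw [Finset.mem_Ico]
    omega
  have h1 := hM₁ K (by omega)
  rw [symbol_borcherds_eq hu hv, ← Finset.sum_sdiff hsub, sub_add_eq_sub_sub_swap, map_sub] at h1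
  have h2 : X.symbolHom (∑ j ∈ Finset.Ico (m + r - K) (m + r + K) \ Finset.Icc (-(N : ℤ)) N,
      LoopSym.psi X.zhu r (m - j) (Zhu.mk X u) * LoopSym.psi X.zhu s j (Zhu.mk X v)) ∈
        X.grCurrent.nhd (-m) n := by
    refine hn' _ (sum_mem fun j hj => hM₂ j ?_)
    rw [Finset.mem_sdiff, Finset.mem_Icc] at hj
    rcases abs_cases j with h | h <;> omega
  have h3 := add_mem h1 h2
  rw [sub_add_cancel] at h3
  exact h3

variable (X) in
theorem completionMap_symbolHom_eq_zero : ∀ a ∈ (LoopSym.poisson X.zhu).completion.closedIdeal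
    (LoopSym.relSet X.zhu), X.isContHom_symbolHom.completionMap a = 0 := by
  refine DegreewiseTop.IsContHom.eq_zero_of_mem_closedIdeal X.isContHom_symbolHom.completion
    (fun d b hb => X.grCurrent.eq_zero_of_forall_mem_nhd X.iSupIndep_grCurrent_deg hb) _ ?_
  rintro d _ ⟨r, s, _, _, ⟨u, hu, rfl⟩, ⟨v, hv, rfl⟩, m, rfl, rfl⟩
  refine (DegreewiseTop.IsContHom.completionMap_limit X.isContHom_symbolHom
    (LoopSym.relSeq_mem (Q := X.zhu) (r := r) (s := s) (x := Zhu.mk X u) (y := Zhu.mk X v)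
      ⟨u, hu, rfl⟩ ⟨v, hv, rfl⟩ m)).trans ?_
  exact Ideal.Quotient.eq_zero_iff_mem.2
    (le_iSup X.grCurrent.nullSeq (-m) (symbolHom_relSeq_mem_nullSeq hu hv m))

end VertexOperatorAlgebra

end CurrentAlg

theorem mainTheorem10 {k V : Type*} [Field k] [IsAlgClosed k] [CharZero k]
    [AddCommGroup V] [Module k V] (X : CurrentAlg.VertexOperatorAlgebra k V) :
    ∃ Φ : X.zhu.PoissonCurrentAlgebra →ₐ[k] X.grCurrent.Completion,
      CurrentAlg.IsDegreewisePoissonHom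
        (CurrentAlg.GradedPoissonAlgebra.PoissonCurrentAlgebra.poisson X.zhu) X.completedGr Φ ∧
      Function.Surjective Φ := by
  have hf := X.isContHom_symbolHom
  let Φ : X.zhu.PoissonCurrentAlgebra →ₐ[k] X.grCurrent.Completion :=
    Ideal.Quotient.liftₐ _ hf.completionMap X.completionMap_symbolHom_eq_zero
  have hΦ : ∀ a, Φ (Ideal.Quotient.mk _ a) = hf.completionMap a := fun _ => rfl
  refine ⟨Φ, ⟨?_, ?_, fun d n => ?_⟩, fun y => ?_⟩
  · intro a b
    obtain ⟨a, rfl⟩ := Ideal.Quotient.mk_surjective a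
    obtain ⟨b, rfl⟩ := Ideal.Quotient.mk_surjective b
    exact CurrentAlg.DegreewisePoisson.completionMap_br _ X.grCurrent hf X.symbolHom_br a b
  · rintro d _ ⟨a, ha, rfl⟩
    exact hf.completion.map_deg d a ha
  · obtain ⟨m, hm⟩ := hf.completion.continuous d n
    refine ⟨m, ?_⟩
    rintro _ ⟨a, ha, rfl⟩
    exact hm a ha
  · obtain ⟨a, rfl⟩ := X.completionMap_symbolHom_surjective y
    exact ⟨Ideal.Quotient.mk _ a, rfl⟩
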